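/- Let $k$ be a field and let $A$, $B$ be connected graded $k$-algebras (locally finite, $A_i=B_i=0$ for $i<0$, $A_0=B_0=k$), with augmentations $\varepsilon_A,\varepsilon_B$. Let $y_1,\dots,y_m$ be a minimal set of homogeneous generators of $B$, and let $$Q=(\cdots\to B\otimes W_2\to B\otimes W_1\to B\to 0)\xrightarrow{\ \varepsilon_B\ }k$$ be a minimal graded free resolution of the trivial left $B$-module $k$ which is pure: $W_i=k(-l_i)^{\oplus s_i}$ with $s_i<\infty$, $W_0=k$, $s_1=m$, and the first differential sends the $j$-th basis vector of $W_1$ to $y_j$. Let $\sigma=(\sigma_{ij}):A\to\mathbb M_m(A)$ be a graded algebra homomorphism and $\tau=(\sigma,0):B\otimes A\to A\otimes B$ a graded twisting map, i.e. a graded linear map with $\tau(y_i\otimes a)=\sum_t\sigma_{it}(a)\otimes y_t$ such that the multiplication $(m_A\otimes m_B)(\mathrm{id}_A\otimes\tau\otimes\mathrm{id}_B)$ on $C:=A\otimes^\tau B=A\otimes B$ is associative with unit $1\otimes1$. Regard $A$ as a graded $C$-$A$-bimodule through $\pi_A:C\to A$, $a\otimes b\mapsto a\,\varepsilon_B(b)$.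 Assume that $B$ is AS-regular of type $(h_B,l_B)$, i.e. $\operatorname{gldim}B=h_B$, $\underline{\mathrm{Ext}}^{h_B}_B(k,B)\cong k(l_B)$ and $\underline{\mathrm{Ext}}^i_B(k,B)=0$ for $i\ne h_B$. Assume that $\sigma$ is invertible, i.e. there is a graded algebra homomorphism $\varphi=(\varphi_{ij}):A\to\mathbb M_m(A)$ with $\sum_s\varphi_{js}\circ\sigma_{is}=\delta_{ij}\,\mathrm{id}_A$ and $\sum_s\sigma_{sj}\circ\varphi_{si}=\delta_{ij}\,\mathrm{id}_A$ for all $i,j$. Then there are graded algebra homomorphisms $\phi_i:A\to\mathbb M_{s_i}(A)$, $i\ge0$, with $\phi_0=\mathrm{id}_A$ and $\phi_1=\sigma$, such that, with the right $A$-action $(c\otimes e_j)*a=\sum_p c\,(\phi_i)_{jp}(a)\otimes e_p$ on the $i$-th term (where $e_1,\dots,e_{s_i}$ is the canonical basis of $W_i$), the complex $A\otimes^\tau Q$ becomes a complex of graded $C$-$A$-bimodules $$F_\phi=(\cdots\to(C\otimes W_2)^{\phi_2}\to(C\otimes W_1)^{\sigma}\to C\to0),$$ which is a resolution of the bimodule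 $A$ through $\pi_A$. For every such family $(\phi_i)$ one has $W_{h_B}=k(-l_B)$ and $W_i=0$ for $i>h_B$, the map $\phi_{h_B}$ is a graded algebra automorphism of $A$, and, as graded $A$-bimodules, $$\underline{\mathrm{Ext}}^i_{A\otimes^\tau B}(A,A\otimes^\tau B)\cong\begin{cases}{}^{\phi_{h_B}}A(l_B), & i=h_B,\\ 0,& i\neq h_B,\end{cases}$$ where ${}^{\nu}A$ is $A$ with the bimodule structure $a*x*a'=\nu(a)\,x\,a'$. Moreover, $\phi_{h_B}$ is the only graded automorphism $\nu$ of $A$ for which there are integers $d,l$ such that $\underline{\mathrm{Ext}}^i_{A\otimes^\tau B}(A,A\otimes^\tau B)$ is isomorphic, as a graded $A$-bimodule, to ${}^\nu A(l)$ for $i=d$ and is $0$ for $i\ne d$. In other words, the determinant of $\sigma$ exists and $\det\sigma=\phi_{h_B}$. -/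

import Mathlib

open scoped TensorProduct

/-! ### Graded `Hom` and `Ext` over a graded algebra

Let `R` be a `ℤ`-graded algebra over a field `k`, and let `M`, `N` be graded left `R`-modules with
homogeneous components `𝓜 e`, `𝓝 e`. The bar resolution `⋯ → R ⊗ R ⊗ M → R ⊗ M → M` is a
resolution of `M` by graded free `R`-modules (all tensor products over `k`), and
`Hom_R (R ⊗ R^{⊗ n} ⊗ M, N)` consists of the `k`-multilinear maps `R^n × M → N`. Hence
`Ext^n_{GrMod R} (M, N(j))` is the cohomology of the complex of those multilinear maps which
are homogeneous of degree `j`, and `\underline{Ext}^n_R (M, N)` is the graded vector space with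
these components. -/

section Bar

variable {k R M M' N N' : Type*} [Field k] [Ring R] [Algebra k R]
  [AddCommGroup M] [Module k M] [Module R M] [IsScalarTower k R M]
  [AddCommGroup M'] [Module k M'] [Module R M'] [IsScalarTower k R M']
  [AddCommGroup N] [Module k N] [Module R N] [IsScalarTower k R N]
  [AddCommGroup N'] [Module k N'] [Module R N'] [IsScalarTower k R N']

theorem contractNth_update {n : ℕ} [DecidableEq (Fin (n + 1))] (j : Fin n)
    (r : Fin (n + 1) → R) (i : Fin (n + 1)) :
    ∃ (i' : Fin n) (l : R →ₗ[k] R), ∀ x : R,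
      Fin.contractNth j.castSucc (· * ·) (Function.update r i x) =
        Function.update (Fin.contractNth j.castSucc (· * ·) r) i' (l x) := by
  obtain ⟨j, hj⟩ := j
  obtain ⟨i, hi⟩ := i
  rcases lt_trichotomy i j with h | h | h
  · refine ⟨⟨i, by omega⟩, LinearMap.id, fun x => ?_⟩
    funext ⟨t, ht⟩
    simp only [Fin.contractNth, Function.update_apply, Fin.ext_iff, Fin.val_castSucc, Fin.val_succ,
      LinearMap.id_apply]
    split_ifs <;> first | rfl | omega
  · refine ⟨⟨j, hj⟩, LinearMap.mulRight k (r ⟨j + 1, by omega⟩), fun x => ?_⟩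
    funext ⟨t, ht⟩
    simp only [Fin.contractNth, Function.update_apply, Fin.ext_iff, Fin.val_castSucc, Fin.val_succ,
      LinearMap.mulRight_apply]
    split_ifs <;> first | rfl | omega | (subst_vars; rfl)
  · rcases Nat.lt_or_ge (j + 1) i with h' | h'
    · refine ⟨⟨i - 1, by omega⟩, LinearMap.id, fun x => ?_⟩
      funext ⟨t, ht⟩
      simp only [Fin.contractNth, Function.update_apply, Fin.ext_iff, Fin.val_castSucc,
        Fin.val_succ, LinearMap.id_apply]
      split_ifs <;> first | rfl | omega
    · refine ⟨⟨j, hj⟩, LinearMap.mulLeft k (r ⟨j, by omega⟩), fun x => ?_⟩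
      funext ⟨t, ht⟩
      simp only [Fin.contractNth, Function.update_apply, Fin.ext_iff, Fin.val_castSucc,
        Fin.val_succ, LinearMap.mulLeft_apply]
      split_ifs <;> first | rfl | omega | (subst_vars; rfl)

variable (k R M N) in
/-- Bar cochains: `Hom_R (R ⊗ R^{⊗ n} ⊗ M, N)`, that is, `k`-multilinear maps `R^n × M → N`. -/
abbrev BarCochain (n : ℕ) : Type _ := MultilinearMap k (fun _ : Fin n => R) (M →ₗ[k] N)

instance instAddCommGroupBarCochain (n : ℕ) : AddCommGroup (BarCochain k R M N n) := inferInstance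

/-- `(r₀, …, rₙ) ↦ g (r₀, …, r_j r_{j+1}, …, rₙ)`. -/
def barContract {L : Type*} [AddCommGroup L] [Module k L] {n : ℕ}
    (g : MultilinearMap k (fun _ : Fin n => R) L) (j : Fin n) :
    MultilinearMap k (fun _ : Fin (n + 1) => R) L where
  toFun r := g (Fin.contractNth j.castSucc (· * ·) r)
  map_update_add' r i x y := by
    obtain ⟨i', l, h⟩ := contractNth_update (k := k) j r i
    simp only [h, map_add, MultilinearMap.map_update_add]
  map_update_smul' r i c x := by
    obtain ⟨i', l, h⟩ := contractNth_update (k := k) j r i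
    simp only [h, map_smul, MultilinearMap.map_update_smul]

/-- `(r₀, …, rₙ) ↦ (m ↦ r₀ • f (r₁, …, rₙ) m)`. -/
def barFirst {n : ℕ} (f : BarCochain k R M N n) : BarCochain k R M N (n + 1) :=
  LinearMap.uncurryLeft (M := fun _ : Fin (n + 1) => R)
    { toFun := fun r => ((Algebra.lsmul k k N r).compRight k (M := M)).compMultilinearMap f
      map_add' := fun r s => by ext; simp
      map_smul' := fun c r => by ext; simp }

/-- `(r₀, …, rₙ) ↦ (m ↦ f (r₀, …, rₙ₋₁) (rₙ • m))`. -/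
def barLast {n : ℕ} (f : BarCochain k R M N n) : BarCochain k R M N (n + 1) :=
  MultilinearMap.uncurryRight (M := fun _ : Fin (n + 1) => R)
    (LinearMap.compMultilinearMap
      (LinearMap.mk₂ k (fun (g : M →ₗ[k] N) (r : R) => g ∘ₗ Algebra.lsmul k k M r)
        (fun _ _ _ => by ext; simp) (fun _ _ _ => by ext; simp)
        (fun _ _ _ => by ext; simp) (fun _ _ _ => by ext; simp)) f)

variable (k R M N) in
/-- The differential of the bar complex:
`(d f)(r₀, …, rₙ)(m) = r₀ f(r₁, …, rₙ)(m) + ∑ⱼ (-1)^{j+1} f(…, r_j r_{j+1}, …)(m)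
  + (-1)^{n+1} f(r₀, …, rₙ₋₁)(rₙ m)`. -/
def barDifferential (n : ℕ) : BarCochain k R M N n →ₗ[k] BarCochain k R M N (n + 1) where
  toFun f := barFirst f + ∑ j : Fin n, (-1 : k) ^ ((j : ℕ) + 1) • barContract f j
    + (-1 : k) ^ (n + 1) • barLast f
  map_add' f g := by
    ext r m
    simp [barFirst, barContract, barLast, Finset.sum_add_distrib]
    abel
  map_smul' c f := by
    ext r m
    simp [barFirst, barContract, barLast, Finset.smul_sum, smul_comm c]

theorem barDifferential_apply {n : ℕ} (f : BarCochain k R M N n) (r : Fin (n + 1) → R) (m : M) :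
    barDifferential k R M N n f r m = r 0 • f (Fin.tail r) m
      + ∑ j : Fin n, (-1 : k) ^ ((j : ℕ) + 1) • f (Fin.contractNth j.castSucc (· * ·) r) m
      + (-1 : k) ^ (n + 1) • f (Fin.init r) (r (Fin.last n) • m) := by
  simp [barDifferential, barFirst, barContract, barLast]

/-- Composition of a cochain with an `R`-linear map `u : M → M'`. -/
def barPrecomp (u : M →ₗ[R] M') (n : ℕ) :
    BarCochain k R M' N n →ₗ[k] BarCochain k R M N n where
  toFun f := (LinearMap.lcomp k N (u.restrictScalars k)).compMultilinearMap f
  map_add' f g := by ext; simp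
  map_smul' c f := by ext; simp

/-- Composition of a cochain with an `R`-linear map `v : N → N'`. -/
def barPostcomp (v : N →ₗ[R] N') (n : ℕ) :
    BarCochain k R M N n →ₗ[k] BarCochain k R M N' n where
  toFun f := ((v.restrictScalars k).compRight k (M := M)).compMultilinearMap f
  map_add' f g := by ext; simp
  map_smul' c f := by ext; simp

theorem barDifferential_precomp (u : M →ₗ[R] M') (n : ℕ) (f : BarCochain k R M' N n) :
    barDifferential k R M N n (barPrecomp u n f) =
      barPrecomp u (n + 1) (barDifferential k R M' N n f) := by
  ext r m
  simp [barDifferential_apply, barPrecomp]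

theorem barDifferential_postcomp (v : N →ₗ[R] N') (n : ℕ) (f : BarCochain k R M N n) :
    barDifferential k R M N' n (barPostcomp v n f) =
      barPostcomp v (n + 1) (barDifferential k R M N n f) := by
  ext r m
  have h (c : k) (x : N) : v (c • x) = c • v x := (v.restrictScalars k).map_smul c x
  simp [barDifferential_apply, barPostcomp, h]

variable (𝓡 : ℤ → Submodule k R) (𝓜 : ℤ → Submodule k M) (𝓜' : ℤ → Submodule k M')
  (𝓝 : ℤ → Submodule k N) (𝓝' : ℤ → Submodule k N')

/-- Bar cochains of internal degree `j`, i.e. degree preserving cochains with values in `N(j)`. -/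
def homCochains (n : ℕ) (j : ℤ) : Submodule k (BarCochain k R M N n) where
  carrier := {f | ∀ (d : Fin n → ℤ) (e : ℤ) (r : Fin n → R) (m : M),
    (∀ i, r i ∈ 𝓡 (d i)) → m ∈ 𝓜 e → f r m ∈ 𝓝 (∑ i, d i + e + j)}
  add_mem' hf hg d e r m hr hm := add_mem (hf d e r m hr hm) (hg d e r m hr hm)
  zero_mem' _ _ _ _ _ _ := zero_mem _
  smul_mem' c _ hf d e r m hr hm := Submodule.smul_mem _ c (hf d e r m hr hm)

/-- Cocycles of cohomological degree `n` and internal degree `j`. -/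
def extCocycles (n : ℕ) (j : ℤ) : Submodule k (BarCochain k R M N n) :=
  homCochains 𝓡 𝓜 𝓝 n j ⊓ LinearMap.ker (barDifferential k R M N n)

/-- Coboundaries of cohomological degree `n` and internal degree `j`. -/
def extCoboundaries : (n : ℕ) → (j : ℤ) → Submodule k (BarCochain k R M N n)
  | 0, _ => ⊥
  | n + 1, j => (homCochains 𝓡 𝓜 𝓝 n j).map (barDifferential k R M N n)

/-- The degree `j` component `Ext^n_{GrMod R} (M, N(j))` of `\underline{Ext}^n_R (M, N)`. -/
abbrev uExt (n : ℕ) (j : ℤ) : Type _ :=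
  extCocycles 𝓡 𝓜 𝓝 n j ⧸ (extCoboundaries 𝓡 𝓜 𝓝 n j).submoduleOf (extCocycles 𝓡 𝓜 𝓝 n j)

variable {𝓜 𝓜' 𝓝 𝓝'}

theorem barPrecomp_mem {u : M →ₗ[R] M'} {i : ℤ} (hu : ∀ e, ∀ m ∈ 𝓜 e, u m ∈ 𝓜' (e + i))
    {n : ℕ} {j : ℤ} {f : BarCochain k R M' N n} (hf : f ∈ homCochains 𝓡 𝓜' 𝓝 n j) :
    barPrecomp u n f ∈ homCochains 𝓡 𝓜 𝓝 n (j + i) := by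
  intro d e r m hr hm
  have := hf d (e + i) r (u m) hr (hu e m hm)
  rwa [show ∑ i, d i + (e + i) + j = ∑ i, d i + e + (j + i) by ring] at this

theorem barPostcomp_mem {v : N →ₗ[R] N'} {i : ℤ} (hv : ∀ e, ∀ x ∈ 𝓝 e, v x ∈ 𝓝' (e + i))
    {n : ℕ} {j : ℤ} {f : BarCochain k R M N n} (hf : f ∈ homCochains 𝓡 𝓜 𝓝 n j) :
    barPostcomp v n f ∈ homCochains 𝓡 𝓜 𝓝' n (j + i) := by
  intro d e r m hr hm
  have := hv _ _ (hf d e r m hr hm)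
  rwa [add_assoc] at this

/-- Functoriality of `\underline{Ext}` in the first variable, for an `R`-linear map `u : M → M'`
which is homogeneous of degree `i`. -/
def uExtPrecomp (𝓝 : ℤ → Submodule k N) (u : M →ₗ[R] M') {i : ℤ}
    (hu : ∀ e, ∀ m ∈ 𝓜 e, u m ∈ 𝓜' (e + i)) (n : ℕ) (j : ℤ) :
    uExt 𝓡 𝓜' 𝓝 n j →ₗ[k] uExt 𝓡 𝓜 𝓝 n (j + i) :=
  Submodule.mapQ _ _
    ((barPrecomp u n).restrict (p := extCocycles 𝓡 𝓜' 𝓝 n j) (q := extCocycles 𝓡 𝓜 𝓝 n (j + i))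
      (fun f hf => ⟨barPrecomp_mem 𝓡 hu hf.1, by
        have h : barDifferential k R M' N n f = 0 := hf.2
        rw [SetLike.mem_coe, LinearMap.mem_ker, barDifferential_precomp, h, map_zero]⟩))
    (by
      rintro ⟨f, hf⟩ h
      simp only [Submodule.submoduleOf, Submodule.mem_comap, Submodule.subtype_apply] at h ⊢
      cases n with
      | zero =>
        have h' : f = 0 := h
        subst h'
        exact (Submodule.mem_bot k).2 (map_zero _)
      | succ n =>
        obtain ⟨g, hg, rfl⟩ := h
        exact ⟨barPrecomp u n g, barPrecomp_mem 𝓡 hu hg, barDifferential_precomp u n g⟩)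

/-- Functoriality of `\underline{Ext}` in the second variable, for an `R`-linear map `v : N → N'`
which is homogeneous of degree `i`. -/
def uExtPostcomp (𝓜 : ℤ → Submodule k M) (v : N →ₗ[R] N') {i : ℤ}
    (hv : ∀ e, ∀ x ∈ 𝓝 e, v x ∈ 𝓝' (e + i)) (n : ℕ) (j : ℤ) :
    uExt 𝓡 𝓜 𝓝 n j →ₗ[k] uExt 𝓡 𝓜 𝓝' n (j + i) :=
  Submodule.mapQ _ _
    ((barPostcomp v n).restrict (p := extCocycles 𝓡 𝓜 𝓝 n j) (q := extCocycles 𝓡 𝓜 𝓝' n (j + i))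
      (fun f hf => ⟨barPostcomp_mem 𝓡 hv hf.1, by
        have h : barDifferential k R M N n f = 0 := hf.2
        rw [SetLike.mem_coe, LinearMap.mem_ker, barDifferential_postcomp, h, map_zero]⟩))
    (by
      rintro ⟨f, hf⟩ h
      simp only [Submodule.submoduleOf, Submodule.mem_comap, Submodule.subtype_apply] at h ⊢
      cases n with
      | zero =>
        have h' : f = 0 := h
        subst h'
        exact (Submodule.mem_bot k).2 (map_zero _)
      | succ n =>
        obtain ⟨g, hg, rfl⟩ := h
        exact ⟨barPostcomp v n g, barPostcomp_mem 𝓡 hv hg, barDifferential_postcomp v n g⟩)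

end Bar

/-! ### Connected graded algebras and Artin-Schelter regularity -/

universe u

section Connected

variable {k A B : Type*} [Field k] [Ring A] [Algebra k A] [Ring B] [Algebra k B]

/-- A graded algebra is connected if it is locally finite, lives in degrees `≥ 0`, and `A₀ = k`. -/
class ConnectedGraded (𝒜 : ℤ → Submodule k A) [GradedAlgebra 𝒜] : Prop where
  nontrivial : Nontrivial A
  finite : ∀ i, Module.Finite k (𝒜 i)
  neg : ∀ i < 0, 𝒜 i = ⊥
  zero : 𝒜 0 = 1

theorem exists_augmentation (𝒜 : ℤ → Submodule k A) [GradedAlgebra 𝒜] [h : ConnectedGraded 𝒜] :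
    ∃ ε : A →ₐ[k] k, ∀ i, i ≠ 0 → ∀ a ∈ 𝒜 i, ε a = 0 := by
  have := h.nontrivial
  let f : k →ₗ[k] 𝒜 0 := (Algebra.linearMap k A).codRestrict (𝒜 0) fun c => by
    rw [h.zero]; exact Submodule.algebraMap_mem c
  have hf : Function.Bijective f := by
    constructor
    · intro c d hcd
      exact (algebraMap k A).injective (congrArg Subtype.val hcd)
    · rintro ⟨a, ha⟩
      have ha' := ha
      rw [h.zero] at ha'
      obtain ⟨c, hc⟩ := Submodule.mem_one.1 ha'
      exact ⟨c, Subtype.ext hc⟩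
  let e := LinearEquiv.ofBijective f hf
  let p : A →ₗ[k] k := e.symm.toLinearMap ∘ₗ DirectSum.component k ℤ (fun i => 𝒜 i) 0 ∘ₗ
    (DirectSum.decomposeLinearEquiv 𝒜).toLinearMap
  have hp (i : ℤ) (hi : i ≠ 0) (a : A) (ha : a ∈ 𝒜 i) : p a = 0 := by
    have : DirectSum.decompose 𝒜 a 0 = 0 := by
      apply Subtype.ext
      rw [DirectSum.decompose_of_mem_ne 𝒜 ha hi]; rfl
    change e.symm (DirectSum.decompose 𝒜 a 0) = 0
    rw [this, map_zero]
  have hs (c : k) : p (algebraMap k A c) = c := by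
    have : DirectSum.decompose 𝒜 (algebraMap k A c) 0 = e c := by
      apply Subtype.ext
      exact DirectSum.decompose_of_mem_same 𝒜 (f c).2
    change e.symm (DirectSum.decompose 𝒜 (algebraMap k A c) 0) = c
    rw [this, LinearEquiv.symm_apply_apply]
  have hz (a : A) (ha : a ∈ 𝒜 0) : ∃ c, algebraMap k A c = a := by
    rw [h.zero] at ha
    exact Submodule.mem_one.1 ha
  have hmul (a b : A) : p (a * b) = p a * p b := by
    induction a using DirectSum.Decomposition.inductionOn 𝒜 with
    | zero => simp
    | add a a' h1 h2 => rw [add_mul, map_add, map_add, add_mul, h1, h2]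
    | @homogeneous i a =>
      induction b using DirectSum.Decomposition.inductionOn 𝒜 with
      | zero => simp
      | add b b' h1 h2 => rw [mul_add, map_add, map_add, mul_add, h1, h2]
      | @homogeneous j b =>
        obtain ⟨a, ha⟩ := a
        obtain ⟨b, hb⟩ := b
        have hab := SetLike.mul_mem_graded ha hb
        change p (a * b) = p a * p b
        by_cases hi : i = 0
        · subst hi
          obtain ⟨c, rfl⟩ := hz a ha
          rw [hs, ← Algebra.smul_def, map_smul, smul_eq_mul]
        · rw [hp i hi a ha, zero_mul]
          by_cases hij : i + j = 0
          · rcases lt_or_gt_of_ne hi with hi' | hi'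
            · rw [h.neg i hi', Submodule.mem_bot] at ha
              rw [ha, zero_mul, map_zero]
            · rw [h.neg j (by omega), Submodule.mem_bot] at hb
              rw [hb, mul_zero, map_zero]
          · exact hp _ hij _ hab
  refine ⟨AlgHom.ofLinearMap p ?_ hmul, fun i hi a ha => hp i hi a ha⟩
  rw [← map_one (algebraMap k A), hs]

/-- The augmentation `ε : A → k` of a connected graded algebra, i.e. the unique algebra map
which vanishes in all degrees `≠ 0`. -/
noncomputable def augmentation (𝒜 : ℤ → Submodule k A) [GradedAlgebra 𝒜] [ConnectedGraded 𝒜] :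
    A →ₐ[k] k :=
  (exists_augmentation 𝒜).choose

theorem augmentation_eq_zero (𝒜 : ℤ → Submodule k A) [GradedAlgebra 𝒜] [ConnectedGraded 𝒜]
    {i : ℤ} (hi : i ≠ 0) {a : A} (ha : a ∈ 𝒜 i) : augmentation 𝒜 a = 0 :=
  (exists_augmentation 𝒜).choose_spec i hi a ha

/-- The trivial module `k` over a connected graded algebra. -/
def TrivialModule (_𝒜 : ℤ → Submodule k A) : Type _ := k

noncomputable instance (𝒜 : ℤ → Submodule k A) : AddCommGroup (TrivialModule 𝒜) :=
  inferInstanceAs (AddCommGroup k)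

noncomputable instance (𝒜 : ℤ → Submodule k A) : Module k (TrivialModule 𝒜) :=
  inferInstanceAs (Module k k)

noncomputable instance (𝒜 : ℤ → Submodule k A) [GradedAlgebra 𝒜] [ConnectedGraded 𝒜] :
    Module A (TrivialModule 𝒜) :=
  Module.compHom k (augmentation 𝒜).toRingHom

instance (𝒜 : ℤ → Submodule k A) [GradedAlgebra 𝒜] [ConnectedGraded 𝒜] :
    IsScalarTower k A (TrivialModule 𝒜) :=
  ⟨fun c a x => by
    have h (x : k) : augmentation 𝒜 (c • a) * x = c * (augmentation 𝒜 a * x) := by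
      rw [map_smul, smul_eq_mul, mul_assoc]
    exact h x⟩

/-- The trivial module is concentrated in degree `0`. -/
noncomputable def trivialGrading (𝒜 : ℤ → Submodule k A) (i : ℤ) : Submodule k (TrivialModule 𝒜) :=
  if i = 0 then ⊤ else ⊥

/-- The (left) global dimension of a ring. -/
noncomputable def globalDimension (R : Type u) [Ring R] : WithBot ℕ∞ :=
  ⨆ M : ModuleCat.{u} R, CategoryTheory.projectiveDimension M

/-- Artin-Schelter regularity of type `(d, l)` of a connected graded algebra: the global dimension
is `d`, and `\underline{Ext}^i_A (k, A)` is `k(l)`, which is one-dimensional and concentrated in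
degree `-l`, for `i = d`, and `0` for `i ≠ d`. -/
structure IsASRegular (𝒜 : ℤ → Submodule k A) [GradedAlgebra 𝒜] [ConnectedGraded 𝒜]
    (d : ℕ) (l : ℤ) : Prop where
  globalDimension_eq : globalDimension A = d
  ext_eq_zero : ∀ (i : ℕ) (j : ℤ), ¬ (i = d ∧ j = -l) →
    Subsingleton (uExt 𝒜 (trivialGrading 𝒜) 𝒜 i j)
  ext_eq : Nonempty (uExt 𝒜 (trivialGrading 𝒜) 𝒜 d (-l) ≃ₗ[k] k)

/-- `y₁, …, yₘ` is a minimal set of homogeneous generators (of positive degree). -/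
structure IsMinimalGeneratingSet (ℬ : ℤ → Submodule k B) {m : ℕ} (y : Fin m → B) : Prop where
  homogeneous : ∀ i, ∃ d : ℤ, 0 < d ∧ y i ∈ ℬ d
  adjoin_eq_top : Algebra.adjoin k (Set.range y) = ⊤
  minimal : ∀ i, Algebra.adjoin k (y '' {i}ᶜ) ≠ ⊤

/-- A minimal free resolution
`⋯ → B ⊗ W₂ → B ⊗ W₁ → B → k → 0` of the trivial module `k` which is pure, that is,
`Wᵢ = k(-lᵢ)^{⊕ sᵢ}` with `sᵢ = rank i` and `lᵢ = deg i`. The free module `B ⊗ Wᵢ` is the module of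
row vectors of length `sᵢ`, with basis vectors in degree `lᵢ`, and the `i`-th differential
`B ⊗ W_{i+1} → B ⊗ Wᵢ` is right multiplication by the matrix `mat i`. It is normalised so that the
first differential sends the basis vector `e_j` to the generator `y_j`. -/
structure PureMinimalResolution (ℬ : ℤ → Submodule k B) [GradedAlgebra ℬ] [ConnectedGraded ℬ]
    {m : ℕ} (y : Fin m → B) where
  rank : ℕ → ℕ
  deg : ℕ → ℤ
  mat : ∀ i, Matrix (Fin (rank (i + 1))) (Fin (rank i)) B
  rank_zero : rank 0 = 1
  deg_zero : deg 0 = 0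
  rank_one : rank 1 = m
  mat_zero : ∀ j p, mat 0 j p = y (Fin.cast rank_one j)
  homogeneous : ∀ i j p, mat i j p ∈ ℬ (deg (i + 1) - deg i)
  minimal : ∀ i j p, augmentation ℬ (mat i j p) = 0
  exact_zero : ∀ x : Fin (rank 0) → B,
    ∑ p, augmentation ℬ (x p) = 0 ↔ ∃ z, Matrix.vecMul z (mat 0) = x
  exact_succ : ∀ i, ∀ x : Fin (rank (i + 1)) → B,
    Matrix.vecMul x (mat i) = 0 ↔ ∃ z, Matrix.vecMul z (mat (i + 1)) = x

/-- A homomorphism `σ = (σᵢⱼ) : A → M_m(A)` is graded if every `σᵢⱼ` preserves degrees. -/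
def IsGradedMatrixHom (𝒜 : ℤ → Submodule k A) {m : ℕ} (σ : A →ₐ[k] Matrix (Fin m) (Fin m) A) :
    Prop :=
  ∀ d, ∀ a ∈ 𝒜 d, ∀ i j, σ a i j ∈ 𝒜 d

/-- Invertibility of a graded homomorphism `σ : A → M_m(A)`: there is a graded homomorphism
`φ : A → M_m(A)` with `∑ₛ φⱼₛ ∘ σᵢₛ = δᵢⱼ id` and `∑ₛ σₛⱼ ∘ φₛᵢ = δᵢⱼ id`. -/
def IsInvertibleMatrixHom (𝒜 : ℤ → Submodule k A) {m : ℕ}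
    (σ : A →ₐ[k] Matrix (Fin m) (Fin m) A) : Prop :=
  ∃ φ : A →ₐ[k] Matrix (Fin m) (Fin m) A, IsGradedMatrixHom 𝒜 φ ∧
    (∀ i j a, ∑ s, φ (σ a i s) j s = if i = j then a else 0) ∧
    (∀ i j a, ∑ s, σ (φ a s i) s j = if i = j then a else 0)

end Connected

/-! ### Twisted tensor products -/

section Twisted

variable {k A B : Type*} [Field k] [Ring A] [Algebra k A] [Ring B] [Algebra k B]

/-- The total grading of `A ⊗ B`. -/
def tensorGrading (𝒜 : ℤ → Submodule k A) (ℬ : ℤ → Submodule k B) (n : ℤ) :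
    Submodule k (A ⊗[k] B) :=
  ⨆ i : ℤ, Submodule.map₂ (TensorProduct.mk k A B) (𝒜 i) (ℬ (n - i))

theorem mulLeft_mem_tensorGrading {𝒜 : ℤ → Submodule k A} [GradedAlgebra 𝒜]
    {ℬ : ℤ → Submodule k B} {p n : ℤ} {a : A} (ha : a ∈ 𝒜 p) {x : A ⊗[k] B}
    (hx : x ∈ tensorGrading 𝒜 ℬ n) :
    TensorProduct.map (LinearMap.mulLeft k a) (LinearMap.mulRight k (1 : B)) x ∈
      tensorGrading 𝒜 ℬ (p + n) := by
  have h : tensorGrading 𝒜 ℬ n ≤ (tensorGrading 𝒜 ℬ (p + n)).comap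
      (TensorProduct.map (LinearMap.mulLeft k a) (LinearMap.mulRight k (1 : B))) := by
    refine iSup_le fun q => Submodule.map₂_le.2 fun b hb c hc => ?_
    rw [Submodule.mem_comap, TensorProduct.mk_apply, TensorProduct.map_tmul,
      LinearMap.mulLeft_apply, LinearMap.mulRight_apply, mul_one]
    refine Submodule.mem_iSup_of_mem (p + q)
      (Submodule.apply_mem_map₂ _ (SetLike.mul_mem_graded ha hb) ?_)
    rwa [show p + n - (p + q) = n - q by ring]
  exact h hx

/-- The multiplication `(m_A ⊗ m_B) ∘ (id_A ⊗ τ ⊗ id_B)` on `A ⊗ B`. -/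
noncomputable def twistedMul (τ : B ⊗[k] A →ₗ[k] A ⊗[k] B) :
    A ⊗[k] B →ₗ[k] A ⊗[k] B →ₗ[k] A ⊗[k] B :=
  TensorProduct.curry
    (TensorProduct.map (LinearMap.mul' k A) (LinearMap.mul' k B)
      ∘ₗ (TensorProduct.assoc k A A (B ⊗[k] B)).symm.toLinearMap
      ∘ₗ LinearMap.lTensor A
        ((TensorProduct.assoc k A B B).toLinearMap
          ∘ₗ LinearMap.rTensor B τ
          ∘ₗ (TensorProduct.assoc k B A B).symm.toLinearMap)
      ∘ₗ (TensorProduct.assoc k A B (A ⊗[k] B)).toLinearMap)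

theorem twistedMul_tmul (τ : B ⊗[k] A →ₗ[k] A ⊗[k] B) (a a' : A) (b b' : B) :
    twistedMul τ (a ⊗ₜ b) (a' ⊗ₜ b') =
      TensorProduct.map (LinearMap.mulLeft k a) (LinearMap.mulRight k b') (τ (b ⊗ₜ a')) := by
  simp only [twistedMul, TensorProduct.curry_apply, LinearMap.comp_apply,
    LinearEquiv.coe_coe, TensorProduct.assoc_tmul, LinearMap.lTensor_tmul,
    TensorProduct.assoc_symm_tmul, LinearMap.rTensor_tmul]
  induction τ (b ⊗ₜ a') with
  | zero => simp
  | add x y hx hy => simp only [map_add, TensorProduct.add_tmul, TensorProduct.tmul_add, hx, hy]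
  | tmul x y => simp

/-- A graded twisting map `τ : B ⊗ A → A ⊗ B`: a graded linear map for which the multiplication
above is associative with unit `1 ⊗ 1`. -/
structure GradedTwistingMap (𝒜 : ℤ → Submodule k A) (ℬ : ℤ → Submodule k B) where
  τ : B ⊗[k] A →ₗ[k] A ⊗[k] B
  graded : ∀ n, ∀ x ∈ tensorGrading ℬ 𝒜 n, τ x ∈ tensorGrading 𝒜 ℬ n
  mul_assoc : ∀ x y z, twistedMul τ (twistedMul τ x y) z = twistedMul τ x (twistedMul τ y z)
  one_mul : ∀ x, twistedMul τ (1 ⊗ₜ 1) x = x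
  mul_one : ∀ x, twistedMul τ x (1 ⊗ₜ 1) = x

variable {𝒜 : ℤ → Submodule k A} {ℬ : ℤ → Submodule k B}

/-- The twisted tensor product `A ⊗^τ B`. -/
def TwistedTensor (_T : GradedTwistingMap 𝒜 ℬ) : Type _ := A ⊗[k] B

namespace TwistedTensor

variable (T : GradedTwistingMap 𝒜 ℬ)

noncomputable instance : AddCommGroup (TwistedTensor T) :=
  inferInstanceAs (AddCommGroup (A ⊗[k] B))

noncomputable instance : Module k (TwistedTensor T) := inferInstanceAs (Module k (A ⊗[k] B))

noncomputable instance : Ring (TwistedTensor T) :=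
  { (inferInstance : AddCommGroup (TwistedTensor T)) with
    mul := fun x y => twistedMul T.τ x y
    one := (1 ⊗ₜ 1 : A ⊗[k] B)
    mul_assoc := T.mul_assoc
    one_mul := T.one_mul
    mul_one := T.mul_one
    left_distrib := fun x y z => map_add (twistedMul T.τ x) y z
    right_distrib := fun x y z => LinearMap.map_add₂ (twistedMul T.τ) x y z
    zero_mul := fun x => LinearMap.map_zero₂ (twistedMul T.τ) x
    mul_zero := fun x => map_zero (twistedMul T.τ x) }

theorem mul_def (x y : TwistedTensor T) : x * y = twistedMul T.τ x y := rfl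

noncomputable instance : Algebra k (TwistedTensor T) :=
  Algebra.ofModule (fun c x y => LinearMap.map_smul₂ (twistedMul T.τ) c x y)
    (fun c x y => map_smul (twistedMul T.τ x) c y)

/-- The total grading of `A ⊗^τ B`. -/
def grading (n : ℤ) : Submodule k (TwistedTensor T) := tensorGrading 𝒜 ℬ n

/-- The element `a ⊗^τ b`. -/
def tmul (a : A) (b : B) : TwistedTensor T := (a ⊗ₜ b : A ⊗[k] B)

theorem τ_one_tmul (a : A) : T.τ (1 ⊗ₜ a) = a ⊗ₜ 1 := by
  have h := T.one_mul (a ⊗ₜ 1)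
  rw [twistedMul_tmul] at h
  simpa using h

theorem τ_tmul_one (b : B) : T.τ (b ⊗ₜ 1) = 1 ⊗ₜ b := by
  have h := T.mul_one (1 ⊗ₜ b)
  rw [twistedMul_tmul] at h
  simpa using h

/-- The injection `ι_A : A → A ⊗^τ B`. -/
noncomputable def ιA : A →ₐ[k] TwistedTensor T :=
  AlgHom.ofLinearMap ((TensorProduct.mk k A B).flip 1 : A →ₗ[k] A ⊗[k] B) rfl (fun a a' => by
    change (a * a') ⊗ₜ[k] (1 : B) = twistedMul T.τ (a ⊗ₜ 1) (a' ⊗ₜ 1)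
    rw [twistedMul_tmul, τ_one_tmul]
    simp)

/-- The injection `ι_B : B → A ⊗^τ B`. -/
noncomputable def ιB : B →ₐ[k] TwistedTensor T :=
  AlgHom.ofLinearMap (TensorProduct.mk k A B 1 : B →ₗ[k] A ⊗[k] B) rfl (fun b b' => by
    change (1 : A) ⊗ₜ[k] (b * b') = twistedMul T.τ (1 ⊗ₜ b) (1 ⊗ₜ b')
    rw [twistedMul_tmul, τ_tmul_one]
    simp)

end TwistedTensor

/-- A graded twisting map of the form `τ = (σ, 0)` with respect to a minimal generating set
`y₁, …, yₘ` of `B`, that is, `τ(yᵢ ⊗ a) = ∑ₜ σᵢₜ(a) ⊗ yₜ` for a graded homomorphism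
`σ = (σᵢⱼ) : A → M_m(A)`. -/
structure DiagonalTwistingMap (𝒜 : ℤ → Submodule k A) (ℬ : ℤ → Submodule k B) {m : ℕ}
    (y : Fin m → B) extends GradedTwistingMap 𝒜 ℬ where
  generating : IsMinimalGeneratingSet ℬ y
  σ : A →ₐ[k] Matrix (Fin m) (Fin m) A
  σ_graded : IsGradedMatrixHom 𝒜 σ
  τ_tmul : ∀ i a, τ (y i ⊗ₜ a) = ∑ t, σ a i t ⊗ₜ y t

namespace DiagonalTwistingMap

open TwistedTensor

variable {m : ℕ} {y : Fin m → B} [GradedAlgebra ℬ] [ConnectedGraded ℬ]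

/-- The `k`-linear map `π_A : a ⊗^τ b ↦ a ε_B(b)`. -/
noncomputable def πLin (T : GradedTwistingMap 𝒜 ℬ) : TwistedTensor T →ₗ[k] A :=
  (TensorProduct.lift ((LinearMap.lsmul k A).flip.compl₂ (augmentation ℬ).toLinearMap) :
    A ⊗[k] B →ₗ[k] A)

theorem πLin_tmul (T : GradedTwistingMap 𝒜 ℬ) (a : A) (b : B) :
    πLin T (a ⊗ₜ b : A ⊗[k] B) = augmentation ℬ b • a := by
  rfl

theorem πLin_map (T : GradedTwistingMap 𝒜 ℬ) (a : A) (b : B) (x : A ⊗[k] B) :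
    πLin T (TensorProduct.map (LinearMap.mulLeft k a) (LinearMap.mulRight k b) x : A ⊗[k] B) =
      augmentation ℬ b • (a * πLin T x) := by
  induction x with
  | zero =>
    rw [map_zero]
    erw [map_zero (πLin T)]
    rw [mul_zero, smul_zero]
  | add x y hx hy =>
    rw [map_add]
    erw [map_add (πLin T), map_add (πLin T)]
    rw [hx, hy, mul_add, smul_add]
  | tmul x y =>
    rw [TensorProduct.map_tmul, πLin_tmul, πLin_tmul]
    simp [mul_smul, mul_comm]

variable (D : DiagonalTwistingMap 𝒜 ℬ y)

theorem πLin_tmul_mul (T : GradedTwistingMap 𝒜 ℬ) (a a' : A) (b b' : B) :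
    πLin T (tmul T a b * tmul T a' b') =
      augmentation ℬ b' • (a * πLin T (T.τ (b ⊗ₜ a') : A ⊗[k] B)) := by
  rw [mul_def, tmul, tmul, twistedMul_tmul]
  exact πLin_map T a b' _

theorem πLin_tmul' (T : GradedTwistingMap 𝒜 ℬ) (a : A) (b : B) :
    πLin T (tmul T a b) = augmentation ℬ b • a := rfl

theorem tmul_induction (T : GradedTwistingMap 𝒜 ℬ) {P : TwistedTensor T → Prop}
    (x : TwistedTensor T) (h0 : P 0) (ht : ∀ a b, P (tmul T a b))
    (ha : ∀ x y, P x → P y → P (x + y)) : P x :=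
  TensorProduct.induction_on (motive := fun x => P x) x h0 ht ha

theorem augmentation_generator (hy : IsMinimalGeneratingSet ℬ y) (i : Fin m) :
    augmentation ℬ (y i) = 0 := by
  obtain ⟨d, hd, h⟩ := hy.homogeneous i
  exact augmentation_eq_zero ℬ (by omega) h

theorem πLin_τ (b : B) (a : A) :
    πLin D.toGradedTwistingMap (D.τ (b ⊗ₜ a) : A ⊗[k] B) = augmentation ℬ b • a := by
  have hb : b ∈ Algebra.adjoin k (Set.range y) := by
    rw [D.generating.adjoin_eq_top]; trivial
  induction hb using Algebra.adjoin_induction generalizing a with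
  | mem b hb =>
    obtain ⟨i, rfl⟩ := hb
    rw [D.τ_tmul, augmentation_generator D.generating, zero_smul]
    refine (map_sum (πLin D.toGradedTwistingMap) _ _).trans (Finset.sum_eq_zero fun t _ => ?_)
    rw [πLin_tmul, augmentation_generator D.generating, zero_smul]
  | algebraMap c =>
    rw [Algebra.algebraMap_eq_smul_one, TensorProduct.smul_tmul, τ_one_tmul, πLin_tmul]
    simp
  | add b b' _ _ h h' =>
    rw [TensorProduct.add_tmul, map_add]
    refine (map_add (πLin D.toGradedTwistingMap) _ _).trans ?_
    rw [h, h', map_add, add_smul]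
  | mul b b' _ _ h h' =>
    have key (w : TwistedTensor D.toGradedTwistingMap) :
        πLin D.toGradedTwistingMap (tmul D.toGradedTwistingMap 1 b * w) =
          augmentation ℬ b • πLin D.toGradedTwistingMap w := by
      induction w using tmul_induction with
      | h0 => simp
      | ht a' c => rw [πLin_tmul_mul, h, πLin_tmul', one_mul, smul_comm]
      | ha x z hx hz => rw [mul_add, map_add, map_add, hx, hz, smul_add]
    have e (c : B) : tmul D.toGradedTwistingMap 1 c * tmul D.toGradedTwistingMap a 1 =
        (D.τ (c ⊗ₜ a) : A ⊗[k] B) := by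
      rw [mul_def, tmul, tmul, twistedMul_tmul, LinearMap.mulLeft_one, LinearMap.mulRight_one,
        TensorProduct.map_id]
      rfl
    have e' : tmul D.toGradedTwistingMap 1 (b * b') =
        tmul D.toGradedTwistingMap 1 b * tmul D.toGradedTwistingMap 1 b' :=
      map_mul (ιB D.toGradedTwistingMap) b b'
    have h'' := h' a
    rw [← e] at h'' ⊢
    rw [e', mul_assoc, key, h'', map_mul, mul_smul]

theorem πLin_mul (x z : TwistedTensor D.toGradedTwistingMap) :
    πLin D.toGradedTwistingMap (x * z) =
      πLin D.toGradedTwistingMap x * πLin D.toGradedTwistingMap z := by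
  induction x using tmul_induction with
  | h0 => simp
  | ha x x' hx hx' => rw [add_mul, map_add, map_add, hx, hx', add_mul]
  | ht a b =>
    induction z using tmul_induction with
    | h0 => simp
    | ha x x' hx hx' => rw [mul_add, map_add, map_add, hx, hx', mul_add]
    | ht a' b' =>
      rw [πLin_tmul_mul, πLin_τ, πLin_tmul', πLin_tmul', mul_smul_comm, smul_mul_assoc,
        mul_smul_comm, smul_comm]

/-- The surjection `π_A : A ⊗^τ B → A`, `a ⊗^τ b ↦ a ε_B(b)`, of graded algebras. -/
noncomputable def πA : TwistedTensor D.toGradedTwistingMap →ₐ[k] A :=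
  AlgHom.ofLinearMap (πLin D.toGradedTwistingMap)
    (by
      change πLin D.toGradedTwistingMap ((1 : A) ⊗ₜ (1 : B) : A ⊗[k] B) = 1
      rw [πLin_tmul, map_one, one_smul])
    (πLin_mul D)

/-- `A` is a left module over `A ⊗^τ B` through `π_A`. -/
noncomputable instance : Module (TwistedTensor D.toGradedTwistingMap) A :=
  Module.compHom A (πA D).toRingHom

theorem smul_def (c : TwistedTensor D.toGradedTwistingMap) (a : A) : c • a = πA D c * a := rfl

instance : IsScalarTower k (TwistedTensor D.toGradedTwistingMap) A :=
  ⟨fun c x a => by rw [smul_def, smul_def, map_smul, smul_mul_assoc]⟩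

/-- Right multiplication by `a` on `A`, as a map of left `A ⊗^τ B`-modules. -/
noncomputable def rightMulA (a : A) : A →ₗ[TwistedTensor D.toGradedTwistingMap] A where
  toFun x := x * a
  map_add' x z := add_mul x z a
  map_smul' c x := by simp only [smul_def, RingHom.id_apply, mul_assoc]

/-- Right multiplication by `ι_A(a)` on `A ⊗^τ B`, as a map of left `A ⊗^τ B`-modules. -/
noncomputable def rightMulC (a : A) : TwistedTensor D.toGradedTwistingMap
    →ₗ[TwistedTensor D.toGradedTwistingMap] TwistedTensor D.toGradedTwistingMap :=
  LinearMap.toSpanSingleton _ _ (ιA D.toGradedTwistingMap a)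

theorem rightMulC_apply (a : A) (x : TwistedTensor D.toGradedTwistingMap) :
    D.rightMulC a x = x * ιA D.toGradedTwistingMap a := rfl

variable [GradedAlgebra 𝒜]

theorem rightMulA_mem {i : ℤ} {a : A} (ha : a ∈ 𝒜 i) (e : ℤ) (x : A) (hx : x ∈ 𝒜 e) :
    D.rightMulA a x ∈ 𝒜 (e + i) :=
  SetLike.mul_mem_graded hx ha

theorem rightMulC_mem {i : ℤ} {a : A} (ha : a ∈ 𝒜 i) (e : ℤ)
    (x : TwistedTensor D.toGradedTwistingMap) (hx : x ∈ grading D.toGradedTwistingMap e) :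
    D.rightMulC a x ∈ grading D.toGradedTwistingMap (e + i) := by
  have h : tensorGrading 𝒜 ℬ e ≤ (tensorGrading 𝒜 ℬ (e + i)).comap
      ((twistedMul D.τ).flip (a ⊗ₜ 1)) := by
    refine iSup_le fun p => Submodule.map₂_le.2 fun b hb c hc => ?_
    rw [Submodule.mem_comap, LinearMap.flip_apply, TensorProduct.mk_apply, twistedMul_tmul,
      show e + i = p + (e - p + i) by ring]
    refine mulLeft_mem_tensorGrading hb (D.graded _ _ ?_)
    refine Submodule.mem_iSup_of_mem (e - p) (Submodule.apply_mem_map₂ _ hc ?_)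
    rwa [add_sub_cancel_left]
  exact h hx

/-! The graded `A`-bimodule structure on `\underline{Ext}_{A ⊗^τ B}(A, A ⊗^τ B)`: left
multiplication by `a` comes from right multiplication by `a` on the first argument `A`, and right
multiplication by `a` from right multiplication by `a` on the second argument `A ⊗^τ B`. -/

/-- The degree `j` component of `\underline{Ext}^n_{A ⊗^τ B}(A, A ⊗^τ B)`. -/
abbrev Ext (n : ℕ) (j : ℤ) : Type _ :=
  uExt (grading D.toGradedTwistingMap) 𝒜 (grading D.toGradedTwistingMap) n j

/-- Left multiplication by a homogeneous element `a` of degree `i`. -/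
noncomputable def extLeftMul {i : ℤ} (a : 𝒜 i) (n : ℕ) (j : ℤ) :
    D.Ext n j →ₗ[k] D.Ext n (j + i) :=
  uExtPrecomp _ _ (D.rightMulA (a : A)) (D.rightMulA_mem a.2) n j

/-- Right multiplication by a homogeneous element `a` of degree `i`. -/
noncomputable def extRightMul {i : ℤ} (a : 𝒜 i) (n : ℕ) (j : ℤ) :
    D.Ext n j →ₗ[k] D.Ext n (j + i) :=
  uExtPostcomp _ _ (D.rightMulC (a : A)) (D.rightMulC_mem a.2) n j

/-- `ν` is a graded automorphism of `A`, and as graded `A`-bimodules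
`\underline{Ext}^i_{A ⊗^τ B}(A, A ⊗^τ B)` is `0` for `i ≠ d` and isomorphic to `^ν A(l)` for `i = d`.
Here `A(l)_j = A_{j+l}`, and `a * x * a' = ν(a) x a'` in `^ν A`. -/
structure IsDeterminantOfType (ν : A ≃ₐ[k] A) (d : ℕ) (l : ℤ) : Prop where
  graded : ∀ i, ∀ a ∈ 𝒜 i, ν a ∈ 𝒜 i
  ext_eq_zero : ∀ (i : ℕ), i ≠ d → ∀ j : ℤ, Subsingleton (D.Ext i j)
  ext_iso : ∃ e : ∀ j : ℤ, D.Ext d j ≃ₗ[k] 𝒜 (j + l),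
    (∀ (i : ℤ) (a : 𝒜 i) (j : ℤ) (x : D.Ext d j),
      (e (j + i) (D.extLeftMul a d j x) : A) = ν a * (e j x : A)) ∧
    (∀ (i : ℤ) (a : 𝒜 i) (j : ℤ) (x : D.Ext d j),
      (e (j + i) (D.extRightMul a d j x) : A) = (e j x : A) * a)

/-- The graded automorphism `ν` of `A` is a determinant of `σ`, where `τ = (σ, 0)`. -/
def IsDeterminant (ν : A ≃ₐ[k] A) : Prop := ∃ (d : ℕ) (l : ℤ), D.IsDeterminantOfType ν d l

/-! ### The bimodule resolution `F_φ` -/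

variable (Q : PureMinimalResolution ℬ y)

/-- The `i`-th differential `A ⊗^τ d_Q` of `F = A ⊗^τ Q`, from `C ⊗ W_{i+1}` to `C ⊗ Wᵢ` for
`C = A ⊗^τ B`. -/
noncomputable def resolutionDiff (i : ℕ) :
    (Fin (Q.rank (i + 1)) → TwistedTensor D.toGradedTwistingMap)
      →ₗ[TwistedTensor D.toGradedTwistingMap]
    (Fin (Q.rank i) → TwistedTensor D.toGradedTwistingMap) :=
  Matrix.vecMulLinear ((Q.mat i).map (ιB D.toGradedTwistingMap))

/-- The augmentation `C = C ⊗ W₀ → A`, given by `π_A`. -/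
noncomputable def resolutionAug :
    (Fin (Q.rank 0) → TwistedTensor D.toGradedTwistingMap)
      →ₗ[TwistedTensor D.toGradedTwistingMap] A where
  toFun x := ∑ p, D.πA (x p)
  map_add' x z := by simp [Finset.sum_add_distrib]
  map_smul' c x := by simp [smul_def, Finset.mul_sum]

/-- The `ψ`-twisted right action of `A` on `(C ⊗ W)^ψ`, `W` having the basis `e₁, …, eₛ`:
`(c ⊗ eⱼ) * a = ∑ₚ c ψⱼₚ(a) ⊗ eₚ`. -/
noncomputable def twistedRightAction {s : ℕ} (ψ : A →ₐ[k] Matrix (Fin s) (Fin s) A)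
    (x : Fin s → TwistedTensor D.toGradedTwistingMap) (a : A) :
    Fin s → TwistedTensor D.toGradedTwistingMap :=
  Matrix.vecMul x ((ψ a).map (ιA D.toGradedTwistingMap))

/-- The graded homomorphisms `φᵢ : A → M_{sᵢ}(A)`, with `φ₀ = id` and `φ₁ = σ`, turn `F = A ⊗^τ Q`
into a complex
`F_φ = (⋯ → (C ⊗ W₂)^{φ₂} → (C ⊗ W₁)^σ → C)` of graded `C`-`A`-bimodules which
is a resolution of the bimodule `A` through `π_A`. -/
structure IsBimoduleResolution
    (φ : ∀ i, A →ₐ[k] Matrix (Fin (Q.rank i)) (Fin (Q.rank i)) A) : Prop where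
  graded : ∀ i, IsGradedMatrixHom 𝒜 (φ i)
  zero : ∀ a, φ 0 a = Matrix.scalar _ a
  one : ∀ a j p, φ 1 a j p = D.σ a (Fin.cast Q.rank_one j) (Fin.cast Q.rank_one p)
  diff_right : ∀ i x a, D.resolutionDiff Q i (D.twistedRightAction (φ (i + 1)) x a) =
    D.twistedRightAction (φ i) (D.resolutionDiff Q i x) a
  aug_right : ∀ x a, D.resolutionAug Q (D.twistedRightAction (φ 0) x a) = D.resolutionAug Q x * a
  aug_surjective : Function.Surjective (D.resolutionAug Q)
  exact_zero : ∀ x, D.resolutionAug Q x = 0 ↔ ∃ z, D.resolutionDiff Q 0 z = x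
  exact_succ : ∀ i x, D.resolutionDiff Q i x = 0 ↔ ∃ z, D.resolutionDiff Q (i + 1) z = x

end DiagonalTwistingMap

end Twisted

/-!
Write `C = A ⊗^τ B`, and let `Mᵢ` be the matrices of the resolution `Q`, with entries in `B`.

*Transfer from `B` to `C`.* Over a field the differentials of `Q` have homogeneous `k`-linear
generalised inverses (`exists_graded_generalizedInverse`). Since `C = A ⊗ B`, the algebra
`End_k B` acts on `C` through the second factor (`rowHom`), in such a way that right multiplication
by `b` acts as right multiplication by `b`. A linear map between powers of `B` is a matrix
over `End_k B`, and applying the action to its entries (`transfer`) carries the generalised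
inverses, and with them exactness, from `Q` to `A ⊗^τ Q`. As `σ` is invertible, `τ` is bijective
(`ofTensorRev_bijective`): it maps `Bₙ ⊗ A_d` onto `A_d ⊗ Bₙ`, and these have the same finite
dimension. So `C ≅ B ⊗ A` also carries an action of `End_k B` through the left factor (`colHom`),
and the dual complexes of column vectors transfer in the same way.

*The homomorphisms `φᵢ`.* The rows of `Mᵢ φᵢ(a)` are cycles, hence of the form `φ_{i+1}(a) Mᵢ`. By
purity the entries of `φ_{i+1}(a)` have degree zero in `B`, i.e. they lie in `A`, and row vectors
over `A` which are killed by `Mᵢ` vanish; so `φ_{i+1}(a)` is unique, and `φ_{i+1}` is a homomorphism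
(`exists_lift`).

*Computation of `Ext`.* The groups are defined by bar cochains. `SplitComplex.eval` evaluates a bar
cochain on the paths of matrix entries of a resolution by graded free modules; dimension shifting
shows that this induces an isomorphism with the cohomology of the complex of column vectors
(`SplitResolution.mem_extCoboundaries`, `SplitResolution.exists_evalAug_sub_mem`), which is
compatible with chain maps (`SplitResolution.evalAug_barPrecomp_sub_mem`). For `B` this turns
regularity into statements on `Q`: the term in position `hB` is `B(-lB)`
(`PureMinimalResolution.rank_top`, `PureMinimalResolution.deg_top`), and the dual complex is exact
except for the cokernel `k` at `hB`. For `C` the transferred dual complex is exact except for the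
cokernel `A`, through `π_A`, at `hB` (`mulVec_colSec`, `mulVec_colSec_top`). A left multiplication
by `a` on `Ext` comes from the chain map `(φᵢ(a))ᵢ`, so it is multiplication by `φ_{hB}(a)`.

*The automorphism.* If `φ_{i+1}(a) = 0` with `i < hB`, then `Mᵢ φᵢ(a) = 0`, so by exactness of the
dual complex `φᵢ(a)` is in the image of a matrix that `π_A` kills; hence `φᵢ(a) = 0`. Thus
`φ_{hB}` is injective, and bijective because `A` is locally finite. Uniqueness of the determinant
holds because a generator `x` of lowest degree of `^ν A(l)` is unique up to a scalar and satisfies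
`a x = x ν(a)` (`IsDeterminantOfType.unique`).
-/

set_option linter.unusedSectionVars false

/-! ### The bar complex: square zero, and acyclicity on free modules -/

section BarComplex

variable {k R M N : Type*} [Field k] [Ring R] [Algebra k R]
  [AddCommGroup M] [Module k M] [Module R M] [IsScalarTower k R M]
  [AddCommGroup N] [Module k N] [Module R N] [IsScalarTower k R N]

theorem contractNth_castSucc_snoc {α : Type*} (op : α → α → α) {n : ℕ} (j : Fin n)
    (r : Fin (n + 1) → α) (x : α) :
    Fin.contractNth j.castSucc.castSucc op (Fin.snoc (α := fun _ => α) r x) =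
      Fin.snoc (α := fun _ => α) (Fin.contractNth j.castSucc op r) x := by
  obtain ⟨j, hj⟩ := j
  funext ⟨t, ht⟩
  simp only [Fin.contractNth, Fin.snoc, Fin.castSucc_mk, Fin.succ_mk, Fin.castLT_mk]
  split_ifs <;> first | rfl | omega

theorem contractNth_last_snoc {α : Type*} (op : α → α → α) {n : ℕ}
    (r : Fin (n + 1) → α) (x : α) :
    Fin.contractNth (Fin.last n).castSucc op (Fin.snoc (α := fun _ => α) r x) =
      Fin.snoc (α := fun _ => α) (Fin.init r) (op (r (Fin.last n)) x) := by
  funext ⟨t, ht⟩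
  simp only [Fin.contractNth, Fin.snoc, Fin.val_castSucc, Fin.castSucc_mk, Fin.castLT_mk,
    Fin.succ_mk, Fin.val_last, Fin.init]
  split_ifs <;> first | rfl | omega | skip
  have : t = n := by omega
  subst this
  rfl

theorem tail_snoc {α : Type*} {n : ℕ} (r : Fin (n + 1) → α) (x : α) :
    Fin.tail (Fin.snoc (α := fun _ => α) r x) = Fin.snoc (α := fun _ => α) (Fin.tail r) x := by
  funext ⟨t, ht⟩
  simp only [Fin.tail, Fin.snoc, Fin.succ_mk]
  split_ifs <;> first | rfl | omega

theorem barPrecomp_apply {M' : Type*} [AddCommGroup M'] [Module k M'] [Module R M']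
    [IsScalarTower k R M'] (u : M →ₗ[R] M') {n : ℕ} (f : BarCochain k R M' N n) (r : Fin n → R)
    (m : M) : barPrecomp u n f r m = f r (u m) := rfl

/-- A bar cochain `f` on `M` of cohomological degree `n + 1`, regarded as the cochain
`(r₁, …, rₙ) ↦ (x ⊗ m ↦ f (r₁, …, rₙ, x) m)` of cohomological degree `n` on `R ⊗ M`. -/
noncomputable def barHat {n : ℕ} (f : BarCochain k R M N (n + 1)) :
    BarCochain k R (R ⊗[k] M) N n :=
  (TensorProduct.lift.equiv (RingHom.id k) R M N).toLinearMap.compMultilinearMap f.curryRight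

theorem barHat_apply {n : ℕ} (f : BarCochain k R M N (n + 1)) (r : Fin n → R) (x : R) (m : M) :
    barHat f r (x ⊗ₜ m) = f (Fin.snoc (α := fun _ => R) r x) m := by
  simp [barHat]

variable (k R M) in
/-- The action `R ⊗ M → M`, as a map of left `R`-modules. -/
noncomputable def actionMap : R ⊗[k] M →ₗ[R] M :=
  TensorProduct.AlgebraTensorModule.lift
    { toFun := fun r => (Algebra.lsmul k k M r)
      map_add' := fun r s => by ext; simp
      map_smul' := fun c r => by ext; simp }

theorem actionMap_tmul (r : R) (m : M) : actionMap k R M (r ⊗ₜ m) = r • m := by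
  simp [actionMap]

theorem barHat_barDifferential {n : ℕ} (f : BarCochain k R M N (n + 1)) :
    barHat (barDifferential k R M N (n + 1) f) =
      barDifferential k R (R ⊗[k] M) N n (barHat f)
        + (-1 : k) ^ (n + 2) • barPrecomp (actionMap k R M) (n + 1) f := by
  refine MultilinearMap.ext fun r => TensorProduct.ext' fun x m => ?_
  rw [barHat_apply, barDifferential_apply, add_apply, LinearMap.add_apply,
    barDifferential_apply, Fin.sum_univ_castSucc]
  simp only [contractNth_castSucc_snoc, contractNth_last_snoc, tail_snoc, barHat_apply,
    Fin.init_snoc, Fin.snoc_last, Fin.val_castSucc, Fin.val_last, TensorProduct.smul_tmul',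
    smul_eq_mul, barPrecomp_apply, smul_apply, LinearMap.smul_apply, actionMap_tmul]
  have h0 : Fin.snoc (α := fun _ => R) r x 0 = r 0 := by
    simp
  rw [h0]
  abel

theorem barDifferential_zero_apply (f : BarCochain k R M N 0) (r : Fin 1 → R) (m : M) :
    barDifferential k R M N 0 f r m = r 0 • f ![] m - f ![] (r 0 • m) := by
  have h (g : Fin 0 → R) : g = ![] := Subsingleton.elim _ _
  rw [barDifferential_apply, h (Fin.tail r), h (Fin.init r)]
  simp [sub_eq_add_neg]

theorem barHat_injective {n : ℕ} : Function.Injective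
    (barHat : BarCochain k R M N (n + 1) → BarCochain k R (R ⊗[k] M) N n) := by
  intro f g h
  refine MultilinearMap.ext fun r => LinearMap.ext fun m => ?_
  have := congrArg (fun F => F (Fin.init r) (r (Fin.last n) ⊗ₜ m)) h
  simpa only [barHat_apply, Fin.snoc_init_self] using this

theorem barHat_smul {n : ℕ} (c : k) (f : BarCochain k R M N (n + 1)) :
    barHat (c • f) = c • barHat f := by
  refine MultilinearMap.ext fun r => TensorProduct.ext' fun x m => ?_
  simp [barHat_apply]

end BarComplex

section SquareZero

universe w v

variable {k : Type w} {N : Type*} {R : Type v} [Field k] [Ring R] [Algebra k R]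
  [AddCommGroup N] [Module k N] [Module R N] [IsScalarTower k R N]

/-- `δ² = 0`. With `f̂` the cochain `barHat f` and `μ : R ⊗ M → M` the action, `(δ f)^` equals
`δ f̂ ± μ^* f`, so that `(δ δ f)^ = δ δ f̂` and induction applies. -/
theorem barDifferential_barDifferential (n : ℕ) : ∀ {M : Type v} [AddCommGroup M]
    [Module k M] [Module R M] [IsScalarTower k R M] (f : BarCochain k R M N n),
    barDifferential k R M N (n + 1) (barDifferential k R M N n f) = 0 := by
  induction n with
  | zero =>
    intro M _ _ _ _ f
    ext r m
    rw [barDifferential_apply]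
    have h : Fin.contractNth (Fin.castSucc 0) (· * ·) r 0 = r 0 * r 1 := rfl
    have h1 : Fin.tail r 0 = r 1 := rfl
    have h2 : Fin.init r 0 = r 0 := rfl
    have h3 : r (Fin.last 1) = r 1 := rfl
    simp only [barDifferential_zero_apply, Finset.univ_unique, Fin.default_eq_zero,
      Finset.sum_singleton, h, h1, h2, Nat.reduceAdd, h3]
    simp only [mul_smul, smul_sub]
    simp
    abel
  | succ n ih =>
    intro M _ _ _ _ f
    apply barHat_injective
    rw [barHat_barDifferential, barHat_barDifferential, map_add, ih, zero_add, map_smul,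
      barDifferential_precomp, ← add_smul]
    have : (-1 : k) ^ (n + 2) + (-1) ^ (n + 1 + 2) = 0 := by ring
    rw [this, zero_smul]
    refine MultilinearMap.ext fun r => TensorProduct.ext' fun x m => ?_
    simp [barHat_apply]

end SquareZero

section Free

variable {k R N : Type*} [Field k] [Ring R] [Algebra k R]
  [AddCommGroup N] [Module k N] [Module R N] [IsScalarTower k R N] {s : ℕ}

variable (k R s) in
/-- The `R`-linear section `∑ xₐ eₐ ↦ ∑ xₐ ⊗ eₐ` of the action `R ⊗ Rˢ → Rˢ`. -/
noncomputable def freeSection : (Fin s → R) →ₗ[R] R ⊗[k] (Fin s → R) where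
  toFun x := ∑ a, x a ⊗ₜ Pi.single a 1
  map_add' x z := by simp [TensorProduct.add_tmul, Finset.sum_add_distrib]
  map_smul' c x := by simp [Finset.smul_sum, TensorProduct.smul_tmul']

theorem freeSection_apply (x : Fin s → R) :
    freeSection k R s x = ∑ a, x a ⊗ₜ Pi.single a 1 := rfl

theorem actionMap_freeSection (x : Fin s → R) :
    actionMap k R (Fin s → R) (freeSection k R s x) = x := by
  rw [freeSection_apply, map_sum]
  simp only [actionMap_tmul]
  exact (pi_eq_sum_univ' x).symm

/-- The contracting homotopy of the bar complex of a free module, in positive degrees. -/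
noncomputable def barContraction {n : ℕ} (h : BarCochain k R (Fin s → R) N (n + 1)) :
    BarCochain k R (Fin s → R) N n :=
  (-1 : k) ^ (n + 1) • barPrecomp (freeSection k R s) n (barHat h)

theorem barContraction_apply {n : ℕ} (h : BarCochain k R (Fin s → R) N (n + 1)) (r : Fin n → R)
    (x : Fin s → R) : barContraction h r x =
      (-1 : k) ^ (n + 1) • ∑ a, h (Fin.snoc (α := fun _ => R) r (x a)) (Pi.single a 1) := by
  simp [barContraction, barPrecomp_apply, freeSection_apply, barHat_apply]

theorem barDifferential_barContraction {n : ℕ} (h : BarCochain k R (Fin s → R) N (n + 1))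
    (hh : barDifferential k R _ N (n + 1) h = 0) :
    barDifferential k R _ N n (barContraction h) = h := by
  have h1 := barHat_barDifferential h
  have h0 : barHat (0 : BarCochain k R (Fin s → R) N (n + 2)) = 0 := by
    simpa using barHat_smul (0 : k) (0 : BarCochain k R (Fin s → R) N (n + 2))
  rw [hh, h0, eq_comm, add_eq_zero_iff_eq_neg] at h1
  rw [barContraction, map_smul, barDifferential_precomp, h1]
  refine MultilinearMap.ext fun r => LinearMap.ext fun x => ?_
  simp only [smul_apply, LinearMap.smul_apply, barPrecomp_apply, neg_apply, LinearMap.neg_apply,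
    actionMap_freeSection]
  rw [← neg_smul, smul_smul]
  have : (-1 : k) ^ (n + 1) * -(-1) ^ (n + 2) = 1 := by
    rw [show n + 2 = n + 1 + 1 by rfl, pow_succ (-1 : k) (n + 1), mul_neg_one, neg_neg, ← mul_pow]
    simp
  rw [this, one_smul]

end Free

/-! ### Evaluating bar cochains along a split free resolution -/

section Evaluation

variable {k R M N : Type*} [Field k] [Ring R] [Algebra k R]
  [AddCommGroup M] [Module k M] [Module R M] [IsScalarTower k R M]
  [AddCommGroup N] [Module k N] [Module R N] [IsScalarTower k R N]

/-- Row or column vectors whose entries are homogeneous of the same degree. -/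
def vecGrading (𝓡 : ℤ → Submodule k R) (s : ℕ) (e : ℤ) : Submodule k (Fin s → R) :=
  Submodule.pi Set.univ fun _ => 𝓡 e

theorem mem_vecGrading {𝓡 : ℤ → Submodule k R} {s : ℕ} {e : ℤ} {x : Fin s → R} :
    x ∈ vecGrading 𝓡 s e ↔ ∀ a, x a ∈ 𝓡 e := by
  simp [vecGrading]

theorem mulVec_mem_vecGrading {𝓡 : ℤ → Submodule k R} [SetLike.GradedMonoid 𝓡] {s t : ℕ}
    {d e e' : ℤ} {P : Matrix (Fin t) (Fin s) R} (hP : ∀ a b, P a b ∈ 𝓡 d) {x : Fin s → R}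
    (hx : x ∈ vecGrading 𝓡 s e) (h : e' = d + e) : P.mulVec x ∈ vecGrading 𝓡 t e' := by
  rw [mem_vecGrading] at hx ⊢
  subst h
  intro a
  rw [Matrix.mulVec, dotProduct]
  exact sum_mem fun b _ => SetLike.mul_mem_graded (hP a b) (hx b)

theorem vecMul_mem_vecGrading {𝓡 : ℤ → Submodule k R} [SetLike.GradedMonoid 𝓡] {s t : ℕ}
    {d e e' : ℤ} {P : Matrix (Fin t) (Fin s) R} (hP : ∀ a b, P a b ∈ 𝓡 d) {x : Fin t → R}
    (hx : x ∈ vecGrading 𝓡 t e) (h : e' = e + d) : Matrix.vecMul x P ∈ vecGrading 𝓡 s e' := by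
  rw [mem_vecGrading] at hx ⊢
  subst h
  intro a
  rw [Matrix.vecMul, dotProduct]
  exact sum_mem fun b _ => SetLike.mul_mem_graded (hx b) (hP b a)

/-- A complex `⋯ → R^{s₂} → R^{s₁} → R^{s₀}` of graded free left `R`-modules, with basis vectors
of `R^{sᵢ}` in degree `lᵢ` and differentials `x ↦ x * mat i`, which is exact in positive degrees,
exactness being witnessed by graded `k`-linear maps `sec i` in the opposite direction. -/
structure SplitComplex (𝓡 : ℤ → Submodule k R) where
  rank : ℕ → ℕ
  deg : ℕ → ℤ
  mat : ∀ i, Matrix (Fin (rank (i + 1))) (Fin (rank i)) R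
  homogeneous : ∀ i a b, mat i a b ∈ 𝓡 (deg (i + 1) - deg i)
  mat_mul_mat : ∀ i, mat (i + 1) * mat i = 0
  sec : ∀ i, (Fin (rank i) → R) →ₗ[k] (Fin (rank (i + 1)) → R)
  sec_mem : ∀ i e x, x ∈ vecGrading 𝓡 _ (e - deg i) → sec i x ∈ vecGrading 𝓡 _ (e - deg (i + 1))
  sec_spec : ∀ i x, ∃ z, sec i (Matrix.vecMul x (mat i)) + Matrix.vecMul z (mat (i + 1)) = x

namespace SplitComplex

variable {𝓡 : ℤ → Submodule k R} (X : SplitComplex 𝓡)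

/-- The complex without its last term. -/
abbrev shift : SplitComplex 𝓡 where
  rank i := X.rank (i + 1)
  deg i := X.deg (i + 1)
  mat i := X.mat (i + 1)
  homogeneous i := X.homogeneous (i + 1)
  mat_mul_mat i := X.mat_mul_mat (i + 1)
  sec i := X.sec (i + 1)
  sec_mem i := X.sec_mem (i + 1)
  sec_spec i := X.sec_spec (i + 1)

/-- The term `R^{s₀}` of the complex. -/
abbrev Term : Type _ := Fin (X.rank 0) → R

/-- The grading of the term `R^{s₀}`. -/
def termGrading (e : ℤ) : Submodule k X.Term := vecGrading 𝓡 _ (e - X.deg 0)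

/-- The differential `R^{s₁} → R^{s₀}`. -/
def diff : X.shift.Term →ₗ[R] X.Term := Matrix.vecMulLinear (X.mat 0)

theorem diff_apply (x : X.shift.Term) : X.diff x = Matrix.vecMul x (X.mat 0) := rfl

theorem diff_shift_diff (x : X.shift.shift.Term) : X.diff (X.shift.diff x) = 0 := by
  rw [diff_apply, diff_apply, Matrix.vecMul_vecMul]
  rw [X.mat_mul_mat 0, Matrix.vecMul_zero]

theorem diff_single (c : Fin (X.rank 1)) :
    X.diff (Pi.single c 1) = ∑ b, X.mat 0 c b • (Pi.single b 1 : X.Term) := by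
  rw [diff_apply, Matrix.single_one_vecMul]
  exact pi_eq_sum_univ' _

/-- The sum of `F a₀ (mat_{q-1}[a, a_{q-1}], …, mat₀[a₁, a₀])` over all `a_{q-1}, …, a₀`. -/
def pathSum {Y : Type*} [AddCommMonoid Y] :
    ∀ q, (Fin (X.rank 0) → (Fin q → R) → Y) → Fin (X.rank q) → Y
  | 0, F, a => F a ![]
  | q + 1, F, a => ∑ b, pathSum q (fun c r => F c (Fin.cons (X.mat q a b) r)) b

theorem pathSum_map {Y Y' : Type*} [AddCommMonoid Y] [AddCommMonoid Y'] (φ : Y →+ Y') (q : ℕ)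
    (F : Fin (X.rank 0) → (Fin q → R) → Y) (a : Fin (X.rank q)) :
    X.pathSum q (fun c r => φ (F c r)) a = φ (X.pathSum q F a) := by
  induction q with
  | zero => rfl
  | succ q ih => simp only [pathSum, map_sum, ih]

theorem pathSum_zero {Y : Type*} [AddCommMonoid Y] (q : ℕ) (a : Fin (X.rank q)) :
    X.pathSum q (fun _ _ => (0 : Y)) a = 0 :=
  X.pathSum_map (0 : Y →+ Y) q (fun _ _ => 0) a

theorem pathSum_add {Y : Type*} [AddCommMonoid Y] (q : ℕ)
    (F G : Fin (X.rank 0) → (Fin q → R) → Y) (a : Fin (X.rank q)) :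
    X.pathSum q (fun c r => F c r + G c r) a = X.pathSum q F a + X.pathSum q G a := by
  induction q with
  | zero => rfl
  | succ q ih => simp only [pathSum, ih, Finset.sum_add_distrib]

theorem pathSum_sum {Y ι : Type*} [AddCommMonoid Y] (q : ℕ) (s : Finset ι)
    (F : ι → Fin (X.rank 0) → (Fin q → R) → Y) (a : Fin (X.rank q)) :
    X.pathSum q (fun c r => ∑ i ∈ s, F i c r) a = ∑ i ∈ s, X.pathSum q (F i) a := by
  classical
  induction s using Finset.induction_on with
  | empty => simp [pathSum_zero]
  | insert i s hi ih => simp only [Finset.sum_insert hi, pathSum_add, ih]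

theorem pathSum_mem {𝓨 : ℤ → Submodule k N} (q : ℕ) : ∀ (e : ℤ)
    (F : Fin (X.rank 0) → (Fin q → R) → N)
    (_ : ∀ (d : Fin q → ℤ) c r, (∀ i, r i ∈ 𝓡 (d i)) → F c r ∈ 𝓨 (∑ i, d i + e))
    (a : Fin (X.rank q)), X.pathSum q F a ∈ 𝓨 (X.deg q - X.deg 0 + e) := by
  induction q with
  | zero =>
    intro e F hF a
    simpa [pathSum] using hF ![] a ![] (fun i => i.elim0)
  | succ q ih =>
    intro e F hF a
    refine sum_mem fun b _ => ?_
    have := ih (e + (X.deg (q + 1) - X.deg q)) (fun c r => F c (Fin.cons (X.mat q a b) r)) ?_ b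
    · convert this using 2; ring
    · intro d c r hr
      have := hF (Fin.cons (X.deg (q + 1) - X.deg q) d) c (Fin.cons (X.mat q a b) r)
        (Fin.cases (X.homogeneous q a b) hr)
      rw [Fin.sum_univ_succ] at this
      simp only [Fin.cons_zero, Fin.cons_succ] at this
      convert this using 2; ring

theorem contractNth_zero_cons {α : Type*} (op : α → α → α) {n : ℕ} (x y : α) (r : Fin n → α) :
    Fin.contractNth (0 : Fin (n + 1)).castSucc op
      (Fin.cons (α := fun _ => α) x (Fin.cons (α := fun _ => α) y r)) =
      Fin.cons (α := fun _ => α) (op x y) r := by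
  funext t
  cases t using Fin.cases with
  | zero => simp [Fin.contractNth]
  | succ t => simp [Fin.contractNth]

theorem contractNth_succ_cons {α : Type*} (op : α → α → α) {n : ℕ} (j : Fin n) (x : α)
    (r : Fin (n + 1) → α) :
    Fin.contractNth j.succ.castSucc op (Fin.cons (α := fun _ => α) x r) =
      Fin.cons (α := fun _ => α) x (Fin.contractNth j.castSucc op r) := by
  funext t
  cases t using Fin.cases with
  | zero => simp [Fin.contractNth]
  | succ t => simp [Fin.contractNth]

theorem sum_contractNth {n : ℕ} (j : Fin n) (d : Fin (n + 1) → ℤ) :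
    ∑ i, Fin.contractNth j.castSucc (· + ·) d i = ∑ i, d i := by
  induction n with
  | zero => exact j.elim0
  | succ n ih =>
    rw [← Fin.cons_self_tail d]
    cases j using Fin.cases with
    | zero =>
      rw [← Fin.cons_self_tail (Fin.tail d), contractNth_zero_cons]
      simp only [Fin.sum_univ_succ, Fin.cons_zero, Fin.cons_succ, add_assoc]
    | succ j =>
      rw [contractNth_succ_cons, Fin.sum_univ_succ, Fin.sum_univ_succ (n := n + 1)]
      simp only [Fin.cons_zero, Fin.cons_succ, ih]

theorem contractNth_mem [SetLike.GradedMonoid 𝓡] {n : ℕ} (j : Fin n) (d : Fin (n + 1) → ℤ)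
    (r : Fin (n + 1) → R) (hr : ∀ i, r i ∈ 𝓡 (d i)) (i : Fin n) :
    Fin.contractNth j.castSucc (· * ·) r i ∈ 𝓡 (Fin.contractNth j.castSucc (· + ·) d i) := by
  simp only [Fin.contractNth]
  split_ifs
  · exact hr _
  · exact SetLike.mul_mem_graded (hr _) (hr _)
  · exact hr _

theorem barDifferential_mem {𝓜 : ℤ → Submodule k M} {𝓝 : ℤ → Submodule k N}
    [SetLike.GradedMonoid 𝓡]
    (hM : ∀ d e r m, r ∈ 𝓡 d → m ∈ 𝓜 e → r • m ∈ 𝓜 (d + e))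
    (hN : ∀ d e r m, r ∈ 𝓡 d → m ∈ 𝓝 e → r • m ∈ 𝓝 (d + e)) {n : ℕ} {j : ℤ}
    {f : BarCochain k R M N n} (hf : f ∈ homCochains 𝓡 𝓜 𝓝 n j) :
    barDifferential k R M N n f ∈ homCochains 𝓡 𝓜 𝓝 (n + 1) j := by
  intro d e r m hr hm
  rw [barDifferential_apply]
  refine add_mem (add_mem ?_ (sum_mem fun i _ => Submodule.smul_mem _ _ ?_))
    (Submodule.smul_mem _ _ ?_)
  · have := hN _ _ _ _ (hr 0) (hf (Fin.tail d) e (Fin.tail r) m (fun i => hr i.succ) hm)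
    rw [Fin.sum_univ_succ]
    simp only [Fin.tail] at this
    convert this using 2; ring
  · have := hf _ e _ m (contractNth_mem i d r hr) hm
    rwa [sum_contractNth] at this
  · have := hf (Fin.init d) _ (Fin.init r) _ (fun i => hr i.castSucc)
      (hM _ _ _ _ (hr (Fin.last n)) hm)
    rw [Fin.sum_univ_castSucc]
    simp only [Fin.init] at this
    convert this using 2; ring

/-- Sums over paths of a cochain with two adjacent arguments multiplied vanish, because
consecutive differentials compose to zero. -/
theorem pathSum_contract (q : ℕ) (j : Fin q)
    (G : Fin (X.rank 0) → MultilinearMap k (fun _ : Fin q => R) N) (a : Fin (X.rank (q + 1))) :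
    X.pathSum (q + 1) (fun c r => G c (Fin.contractNth j.castSucc (· * ·) r)) a = 0 := by
  induction q with
  | zero => exact j.elim0
  | succ q ih =>
    cases j using Fin.cases with
    | zero =>
      simp only [pathSum, contractNth_zero_cons]
      rw [Finset.sum_comm]
      refine Finset.sum_eq_zero fun b _ => ?_
      rw [← pathSum_sum]
      have h (c : Fin (X.rank 0)) (r : Fin q → R) :
          ∑ i, G c (Fin.cons (α := fun _ => R) (X.mat (q + 1) a i * X.mat q i b) r) = 0 := by
        simp only [← MultilinearMap.curryLeft_apply, ← sum_apply, ← map_sum]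
        have : ∑ i, X.mat (q + 1) a i * X.mat q i b = 0 := by
          have := congrFun (congrFun (X.mat_mul_mat q) a) b
          rwa [Matrix.mul_apply] at this
        rw [this, map_zero, zero_apply]
      simp only [h, pathSum_zero]
    | succ j =>
      rw [pathSum]
      refine Finset.sum_eq_zero fun b _ => ?_
      simp only [contractNth_succ_cons]
      exact ih j (fun c => (G c).curryLeft (X.mat (q + 1) a b)) b

theorem pathSum_last {Y : Type*} [AddCommMonoid Y] (q : ℕ)
    (H : Fin (X.rank 0) → (Fin q → R) → R → Y) (a : Fin (X.rank (q + 1))) :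
    X.pathSum (q + 1) (fun c r => H c (Fin.init r) (r (Fin.last q))) a =
      X.shift.pathSum q (fun c' r => ∑ c, H c r (X.mat 0 c' c)) a := by
  induction q with
  | zero =>
    simp only [pathSum]
    refine Finset.sum_congr rfl fun b _ => ?_
    congr 1
    exact Subsingleton.elim _ _
  | succ q ih =>
    change ∑ b, _ = ∑ b, _
    refine Finset.sum_congr rfl fun b _ => ?_
    rw [← ih (fun c r x => H c (Fin.cons (α := fun _ => R) (X.mat (q + 1) a b) r) x)]
    refine congrArg (fun F => X.pathSum (q + 1) F b) (funext fun c => funext fun r => ?_)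
    have h : Fin.init (Fin.cons (α := fun _ => R) (X.mat (q + 1) a b) r) =
        Fin.cons (α := fun _ => R) (X.mat (q + 1) a b) (Fin.init r) := by
      funext t
      cases t using Fin.cases <;> rfl
    exact congrArg (fun t => H c t (r (Fin.last q))) h

end SplitComplex

end Evaluation

section Comparison

universe v

variable {k : Type*} {R : Type v} [Field k] [Ring R] [Algebra k R]

namespace SplitComplex

variable {𝓡 : ℤ → Submodule k R} (X : SplitComplex 𝓡)

/-- Evaluation of bar cochains on `R^{s₀}` along the paths of the complex: the dual of the chain
map from `R^{s_•}` to the bar resolution which lifts the identity of `R^{s₀}` and sends a basis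
vector `e_a` to the sum of `[mat_{q-1}[a, a_{q-1}] | … | mat₀[a₁, a₀]] e_{a₀}`. -/
def eval (q : ℕ) : BarCochain k R X.Term R q →ₗ[k] (Fin (X.rank q) → R) where
  toFun g := X.pathSum q fun c r => g r (Pi.single c 1)
  map_add' _ _ := funext fun a => X.pathSum_add q _ _ a
  map_smul' t f := funext fun a =>
    X.pathSum_map (DistribSMul.toAddMonoidHom R t) q (fun c r => f r (Pi.single c 1)) a

theorem eval_apply (q : ℕ) (g : BarCochain k R X.Term R q) (a : Fin (X.rank q)) :
    X.eval q g a = X.pathSum q (fun c r => g r (Pi.single c 1)) a := rfl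

theorem eval_zero_apply (g : BarCochain k R X.Term R 0) (a : Fin (X.rank 0)) :
    X.eval 0 g a = g ![] (Pi.single a 1) := rfl

theorem eval_barDifferential (q : ℕ) (g : BarCochain k R X.Term R q) :
    X.eval (q + 1) (barDifferential k R _ R q g) =
      (X.mat q).mulVec (X.eval q g) +
        (-1 : k) ^ (q + 1) • X.shift.eval q (barPrecomp X.diff q g) := by
  funext a
  rw [eval_apply]
  simp only [barDifferential_apply]
  rw [pathSum_add, pathSum_add, pathSum_sum]
  have h1 : X.pathSum (q + 1) (fun c r => r 0 • g (Fin.tail r) (Pi.single c 1)) a =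
      (X.mat q).mulVec (X.eval q g) a := by
    rw [pathSum, Matrix.mulVec, dotProduct]
    refine Finset.sum_congr rfl fun b _ => ?_
    exact X.pathSum_map (AddMonoidHom.mulLeft (X.mat q a b)) q _ b
  have h2 (j : Fin q) : X.pathSum (q + 1) (fun c r => (-1 : k) ^ ((j : ℕ) + 1) •
      g (Fin.contractNth j.castSucc (· * ·) r) (Pi.single c 1)) a = 0 := by
    refine (X.pathSum_map (DistribSMul.toAddMonoidHom R ((-1 : k) ^ ((j : ℕ) + 1))) (q + 1)
      (fun c r => g (Fin.contractNth j.castSucc (· * ·) r) (Pi.single c 1)) a).trans ?_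
    exact (congrArg _ (X.pathSum_contract q j
      (fun c => (LinearMap.applyₗ (Pi.single c (1 : R))).compMultilinearMap g) a)).trans
      (map_zero (DistribSMul.toAddMonoidHom R ((-1 : k) ^ ((j : ℕ) + 1))))
  have h3 : X.pathSum (q + 1) (fun c r => (-1 : k) ^ (q + 1) •
      g (Fin.init r) (r (Fin.last q) • Pi.single c 1)) a =
      (-1 : k) ^ (q + 1) • X.shift.eval q (barPrecomp X.diff q g) a := by
    refine (X.pathSum_map (DistribSMul.toAddMonoidHom R ((-1 : k) ^ (q + 1))) (q + 1)
      (fun c r => g (Fin.init r) (r (Fin.last q) • Pi.single c 1)) a).trans ?_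
    refine congrArg ((-1 : k) ^ (q + 1) • ·)
      ((X.pathSum_last q (fun c r x => g r (x • Pi.single c 1)) a).trans ?_)
    rw [eval_apply]
    refine congrArg (fun F => X.shift.pathSum q F a) (funext fun c => funext fun r => ?_)
    rw [barPrecomp_apply]
    exact (map_sum (g r) _ _).symm.trans (congrArg (g r) (X.diff_single c).symm)
  rw [h1, h3, Finset.sum_eq_zero fun j _ => h2 j, add_zero]
  rfl

theorem eval_mem {q : ℕ} {j : ℤ} {g : BarCochain k R X.Term R q} [SetLike.GradedMonoid 𝓡]
    (hg : g ∈ homCochains 𝓡 X.termGrading 𝓡 q j) :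
    X.eval q g ∈ vecGrading 𝓡 _ (X.deg q + j) := by
  rw [mem_vecGrading]
  intro a
  have := X.pathSum_mem (𝓨 := 𝓡) q (X.deg 0 + j) (fun c r => g r (Pi.single c 1)) ?_ a
  · rw [eval_apply]
    convert this using 2; ring
  · intro d c r hr
    have := hg d (X.deg 0) r (Pi.single c 1) hr ?_
    · convert this using 2; ring
    · rw [termGrading, mem_vecGrading, sub_self]
      intro b
      by_cases h : b = c
      · subst h; simpa using SetLike.GradedOne.one_mem
      · simp [h]

variable (k) in
/-- Left multiplication of column vectors by a matrix, as a `k`-linear map. -/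
def mulVecHom {s t : ℕ} (P : Matrix (Fin t) (Fin s) R) : (Fin s → R) →ₗ[k] (Fin t → R) where
  toFun x := P.mulVec x
  map_add' := P.mulVec_add
  map_smul' c x := P.mulVec_smul c x

/-- The degree `j` coboundaries in position `q` of the complex `Hom_R (R^{s_•}, R)` of column
vectors. -/
def bdry : (q : ℕ) → (j : ℤ) → Submodule k (Fin (X.rank q) → R)
  | 0, _ => ⊥
  | q + 1, j => (vecGrading 𝓡 _ (X.deg q + j)).map (mulVecHom k (X.mat q))

theorem mulVec_mem_bdry {q : ℕ} {j : ℤ} {w : Fin (X.rank q) → R}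
    (hw : w ∈ vecGrading 𝓡 _ (X.deg q + j)) : (X.mat q).mulVec w ∈ X.bdry (q + 1) j :=
  ⟨w, hw, rfl⟩

theorem bdry_shift_le (q : ℕ) (j : ℤ) : X.shift.bdry q j ≤ X.bdry (q + 1) j := by
  cases q with
  | zero => exact bot_le
  | succ q => exact le_rfl

/-- Composition of a cochain with a `k`-linear map. -/
def barPrecompLin {M M' N : Type*} [AddCommGroup M] [Module k M] [AddCommGroup M'] [Module k M']
    [AddCommGroup N] [Module k N] (u : M →ₗ[k] M') {n : ℕ} (f : BarCochain k R M' N n) :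
    BarCochain k R M N n :=
  (LinearMap.lcomp k N u).compMultilinearMap f

theorem barPrecompLin_apply {M M' N : Type*} [AddCommGroup M] [Module k M] [AddCommGroup M']
    [Module k M'] [AddCommGroup N] [Module k N] (u : M →ₗ[k] M') {n : ℕ}
    (f : BarCochain k R M' N n) (r : Fin n → R) (m : M) : barPrecompLin u f r m = f r (u m) := rfl

theorem barPrecomp_comm {M M₁ M₂ M' N : Type*} [AddCommGroup M] [Module k M] [Module R M]
    [IsScalarTower k R M] [AddCommGroup M₁] [Module k M₁] [Module R M₁] [IsScalarTower k R M₁]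
    [AddCommGroup M₂] [Module k M₂] [Module R M₂] [IsScalarTower k R M₂]
    [AddCommGroup M'] [Module k M'] [Module R M'] [IsScalarTower k R M']
    [AddCommGroup N] [Module k N] [Module R N] [IsScalarTower k R N]
    {u : M →ₗ[R] M₁} {v : M₁ →ₗ[R] M'} {u' : M →ₗ[R] M₂} {v' : M₂ →ₗ[R] M'}
    (h : ∀ x, v (u x) = v' (u' x)) {n : ℕ} (f : BarCochain k R M' N n) :
    barPrecomp u n (barPrecomp v n f) = barPrecomp u' n (barPrecomp v' n f) := by
  refine MultilinearMap.ext fun r => LinearMap.ext fun x => ?_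
  rw [barPrecomp_apply, barPrecomp_apply, barPrecomp_apply, barPrecomp_apply, h]

theorem barPrecomp_eq_zero {M M₁ M' N : Type*} [AddCommGroup M] [Module k M] [Module R M]
    [IsScalarTower k R M] [AddCommGroup M₁] [Module k M₁] [Module R M₁] [IsScalarTower k R M₁]
    [AddCommGroup M'] [Module k M'] [Module R M'] [IsScalarTower k R M']
    [AddCommGroup N] [Module k N] [Module R N] [IsScalarTower k R N]
    {u : M →ₗ[R] M₁} {v : M₁ →ₗ[R] M'} (h : ∀ x, v (u x) = 0) {n : ℕ}
    (f : BarCochain k R M' N n) : barPrecomp u n (barPrecomp v n f) = 0 := by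
  refine MultilinearMap.ext fun r => LinearMap.ext fun x => ?_
  rw [barPrecomp_apply, barPrecomp_apply, h, map_zero]
  rfl

/-- A cochain on `R^{s₁}` which vanishes on the image of `R^{s₂}` extends along
`R^{s₁} → R^{s₀}`. -/
theorem barPrecomp_diff_barPrecompLin_sec {N : Type*} [AddCommGroup N] [Module k N] [Module R N]
    [IsScalarTower k R N] {n : ℕ} (h : BarCochain k R X.shift.Term N n)
    (hh : barPrecomp X.shift.diff n h = 0) :
    barPrecomp X.diff n (barPrecompLin (X.sec 0) h) = h := by
  refine MultilinearMap.ext fun r => LinearMap.ext fun x => ?_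
  rw [barPrecomp_apply, barPrecompLin_apply]
  obtain ⟨z, hz⟩ := X.sec_spec 0 x
  have h0 : h r (X.shift.diff z) = 0 := by
    rw [← barPrecomp_apply, hh]; rfl
  have h1 : X.sec 0 (X.diff x) + X.shift.diff z = x := hz
  conv_rhs => rw [← h1, map_add, h0, add_zero]

theorem barPrecompLin_sec_mem {n : ℕ} {j : ℤ} {h : BarCochain k R X.shift.Term R n}
    (hh : h ∈ homCochains 𝓡 X.shift.termGrading 𝓡 n j) :
    barPrecompLin (X.sec 0) h ∈ homCochains 𝓡 X.termGrading 𝓡 n j :=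
  fun d e r x hr hx => hh d e r (X.sec 0 x) hr (X.sec_mem 0 e x hx)

section

variable [SetLike.GradedMonoid 𝓡]

theorem smul_mem_termGrading (d e : ℤ) (r : R) (x : X.Term) (hr : r ∈ 𝓡 d)
    (hx : x ∈ X.termGrading e) : r • x ∈ X.termGrading (d + e) := by
  rw [termGrading, mem_vecGrading] at hx ⊢
  intro a
  rw [add_sub_assoc]
  exact SetLike.mul_mem_graded hr (hx a)

theorem barDifferential_term_mem {n : ℕ} {j : ℤ} {f : BarCochain k R X.Term R n}
    (hf : f ∈ homCochains 𝓡 X.termGrading 𝓡 n j) :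
    barDifferential k R _ R n f ∈ homCochains 𝓡 X.termGrading 𝓡 (n + 1) j :=
  barDifferential_mem X.smul_mem_termGrading (fun _ _ _ _ hr hm => SetLike.mul_mem_graded hr hm) hf

theorem barContraction_mem {n : ℕ} {j : ℤ} {f : BarCochain k R X.Term R (n + 1)}
    (hf : f ∈ homCochains 𝓡 X.termGrading 𝓡 (n + 1) j) :
    barContraction f ∈ homCochains 𝓡 X.termGrading 𝓡 n j := by
  intro d e r x hr hx
  rw [barContraction_apply]
  rw [termGrading, mem_vecGrading] at hx
  refine Submodule.smul_mem _ _ (sum_mem fun a _ => ?_)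
  have := hf (Fin.snoc (α := fun _ => ℤ) d (e - X.deg 0)) (X.deg 0)
    (Fin.snoc (α := fun _ => R) r (x a)) (Pi.single a 1) ?_ ?_
  · rw [Fin.sum_univ_castSucc] at this
    simp only [Fin.snoc_castSucc, Fin.snoc_last] at this
    convert this using 2; ring
  · intro i
    cases i using Fin.lastCases with
    | last => simpa using hx a
    | cast i => simpa using hr i
  · rw [termGrading, mem_vecGrading, sub_self]
    intro b
    by_cases h : b = a
    · subst h; simpa using SetLike.GradedOne.one_mem
    · simp [h]

theorem diff_mem (e : ℤ) (x : X.shift.Term) (hx : x ∈ X.shift.termGrading e) :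
    X.diff x ∈ X.termGrading (e + 0) :=
  vecMul_mem_vecGrading (X.homogeneous 0) hx (by simp)

theorem barPrecomp_diff_mem {n : ℕ} {j : ℤ} {f : BarCochain k R X.Term R n}
    (hf : f ∈ homCochains 𝓡 X.termGrading 𝓡 n j) :
    barPrecomp X.diff n f ∈ homCochains 𝓡 X.shift.termGrading 𝓡 n j := by
  simpa using barPrecomp_mem 𝓡 X.diff_mem hf

end

/-- A cocycle of cohomological degree `0` is `R`-linear. -/
theorem map_smul_of_barDifferential_eq_zero {M N : Type*} [AddCommGroup M] [Module k M] [Module R M]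
    [IsScalarTower k R M] [AddCommGroup N] [Module k N] [Module R N] [IsScalarTower k R N]
    {h : BarCochain k R M N 0} (hh : barDifferential k R M N 0 h = 0) (r : R) (x : M) :
    h ![] (r • x) = r • h ![] x := by
  have := congrArg (fun f => f ![r] x) hh
  simp only [barDifferential_zero_apply] at this
  exact (sub_eq_zero.1 this).symm

theorem apply_eq_sum_of_barDifferential_eq_zero {s : ℕ} {N : Type*} [AddCommGroup N] [Module k N]
    [Module R N] [IsScalarTower k R N] {h : BarCochain k R (Fin s → R) N 0}
    (hh : barDifferential k R _ N 0 h = 0) (x : Fin s → R) :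
    h ![] x = ∑ a, x a • h ![] (Pi.single a 1) := by
  conv_lhs => rw [pi_eq_sum_univ' x]
  simp only [map_sum, map_smul_of_barDifferential_eq_zero hh]

/-- The cocycle of cohomological degree `0` given by a column vector. -/
def ofVec {s : ℕ} (w : Fin s → R) : BarCochain k R (Fin s → R) R 0 :=
  MultilinearMap.constOfIsEmpty k _
    { toFun := fun x => x ⬝ᵥ w
      map_add' := fun x z => add_dotProduct x z w
      map_smul' := fun c x => smul_dotProduct c x w }

theorem ofVec_apply {s : ℕ} (w : Fin s → R) (r : Fin 0 → R) (x : Fin s → R) :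
    (ofVec w : BarCochain k R _ R 0) r x = x ⬝ᵥ w := rfl

theorem barDifferential_ofVec {s : ℕ} (w : Fin s → R) :
    barDifferential k R _ R 0 (ofVec w : BarCochain k R _ R 0) = 0 := by
  refine MultilinearMap.ext fun r => LinearMap.ext fun x => ?_
  rw [barDifferential_zero_apply, ofVec_apply, ofVec_apply, smul_dotProduct, sub_self]
  rfl

theorem eval_ofVec (w : Fin (X.rank 0) → R) : X.eval 0 (ofVec w) = w := by
  funext a
  rw [eval_zero_apply, ofVec_apply, single_one_dotProduct]

theorem ofVec_mem [SetLike.GradedMonoid 𝓡] {j : ℤ} {w : Fin (X.rank 0) → R}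
    (hw : w ∈ vecGrading 𝓡 _ (X.deg 0 + j)) :
    (ofVec w : BarCochain k R X.Term R 0) ∈ homCochains 𝓡 X.termGrading 𝓡 0 j := by
  intro d e r x _ hx
  rw [ofVec_apply]
  rw [termGrading, mem_vecGrading] at hx
  rw [mem_vecGrading] at hw
  refine sum_mem fun a _ => ?_
  have := SetLike.mul_mem_graded (hx a) (hw a)
  convert this using 2
  simp
  ring

end SplitComplex
end Comparison

/-! ### Comparison of bar cohomology with the complex of column vectors -/

section Comparison

universe v

variable {k : Type*} {R : Type v} [Field k] [Ring R] [Algebra k R]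

namespace SplitComplex

variable {𝓡 : ℤ → Submodule k R} [SetLike.GradedMonoid 𝓡]

theorem neg_one_pow_smul_smul {Y : Type*} [AddCommGroup Y] [Module k Y] (n : ℕ) (x : Y) :
    (-1 : k) ^ n • (-1 : k) ^ n • x = x := by
  rw [smul_smul, ← mul_pow, neg_one_mul, neg_neg, one_pow, one_smul]

theorem eq_zero_of_eval_eq_zero (X : SplitComplex 𝓡) {h : BarCochain k R X.Term R 0}
    (hδ : barDifferential k R _ R 0 h = 0) (h0 : X.eval 0 h = 0) : h = 0 := by
  refine MultilinearMap.ext fun r => LinearMap.ext fun x => ?_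
  have hr : r = ![] := Subsingleton.elim _ _
  rw [hr, apply_eq_sum_of_barDifferential_eq_zero hδ]
  refine Finset.sum_eq_zero fun a _ => ?_
  rw [← eval_zero_apply, h0]
  exact smul_zero _

/-- Injectivity of the comparison for the cokernel of `R^{s₁} → R^{s₀}`, whose bar cochains are the
cochains on `R^{s₀}` which are killed by restriction to `R^{s₁}`. The step is dimension shifting:
if `h = δ g` then `h` corresponds to the restriction of `g` to `R^{s₁}`. -/
theorem exists_barDifferential_eq (q : ℕ) : ∀ (X : SplitComplex 𝓡) (j : ℤ)
    (h : BarCochain k R X.Term R (q + 1)) (_ : h ∈ homCochains 𝓡 X.termGrading 𝓡 (q + 1) j)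
    (_ : barDifferential k R _ R (q + 1) h = 0) (_ : barPrecomp X.diff (q + 1) h = 0)
    (_ : X.eval (q + 1) h ∈ X.bdry (q + 1) j),
    ∃ g ∈ homCochains 𝓡 X.termGrading 𝓡 q j,
      barDifferential k R _ R q g = h ∧ barPrecomp X.diff q g = 0 := by
  induction q with
  | zero =>
    rintro X j h hh hδ hd ⟨w, hw, hwe⟩
    have hw' : (X.mat 0).mulVec w = X.eval 1 h := hwe
    have hg := barDifferential_barContraction h hδ
    have hgm := X.barContraction_mem hh
    set g := barContraction h
    have he := X.eval_barDifferential 0 g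
    rw [hg, ← hw'] at he
    have h1 : barDifferential k R _ R 0 (barPrecomp X.diff 0 g) = 0 := by
      rw [barDifferential_precomp, hg, hd]
    set w' := (-1 : k) ^ 1 • (w - X.eval 0 g)
    have h2 : (X.mat 0).mulVec w' = X.shift.eval 0 (barPrecomp X.diff 0 g) := by
      rw [Matrix.mulVec_smul, Matrix.mulVec_sub, he, add_sub_cancel_left, neg_one_pow_smul_smul]
    have hwm : w' ∈ vecGrading 𝓡 _ (X.deg 0 + j) :=
      Submodule.smul_mem _ _ (sub_mem hw (X.eval_mem hgm))
    refine ⟨g - ofVec w', sub_mem hgm (X.ofVec_mem hwm), ?_, ?_⟩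
    · rw [map_sub, hg, barDifferential_ofVec, sub_zero]
    · rw [map_sub, sub_eq_zero]
      refine sub_eq_zero.1 (X.shift.eq_zero_of_eval_eq_zero ?_ ?_)
      · rw [map_sub, h1, barDifferential_precomp, barDifferential_ofVec, map_zero, sub_zero]
      · rw [map_sub, ← h2, sub_eq_zero]
        funext a
        rw [eval_zero_apply, barPrecomp_apply, ofVec_apply, diff_apply,
          ← Matrix.dotProduct_mulVec, single_one_dotProduct]
  | succ q ih =>
    intro X j h hh hδ hd he
    have hg := barDifferential_barContraction h hδ
    have hgm := X.barContraction_mem hh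
    set g := barContraction h
    obtain ⟨g₁, hg₁m, hg₁, hg₁d⟩ := ih X.shift j (barPrecomp X.diff (q + 1) g)
      (X.barPrecomp_diff_mem hgm) (by rw [barDifferential_precomp, hg, hd])
      (barPrecomp_eq_zero X.diff_shift_diff g) (by
        have := X.eval_barDifferential (q + 1) g
        rw [hg, ← sub_eq_iff_eq_add'] at this
        rw [← neg_one_pow_smul_smul (k := k) (q + 1 + 1) (X.shift.eval (q + 1) _), ← this]
        exact Submodule.smul_mem _ _ (sub_mem he (X.mulVec_mem_bdry (X.eval_mem hgm))))
    have hd₁ := X.barPrecomp_diff_barPrecompLin_sec g₁ hg₁d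
    have hm := X.barPrecompLin_sec_mem hg₁m
    set g' := barPrecompLin (X.sec 0) g₁
    refine ⟨g - barDifferential k R _ R q g', sub_mem hgm (X.barDifferential_term_mem hm), ?_, ?_⟩
    · rw [map_sub, hg, barDifferential_barDifferential, sub_zero]
    · rw [map_sub, ← barDifferential_precomp, hd₁, hg₁, sub_self]

/-- Surjectivity of the comparison for the cokernel of `R^{s₁} → R^{s₀}`. -/
theorem exists_eval_sub_mem (q : ℕ) : ∀ (X : SplitComplex 𝓡) (j : ℤ)
    (x : Fin (X.rank q) → R) (_ : x ∈ vecGrading 𝓡 _ (X.deg q + j))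
    (_ : (X.mat q).mulVec x = 0),
    ∃ h ∈ homCochains 𝓡 X.termGrading 𝓡 q j, barDifferential k R _ R q h = 0 ∧
      barPrecomp X.diff q h = 0 ∧ X.eval q h - x ∈ X.bdry q j := by
  induction q with
  | zero =>
    intro X j x hx hx0
    refine ⟨ofVec x, X.ofVec_mem hx, barDifferential_ofVec x, ?_, ?_⟩
    · refine X.shift.eq_zero_of_eval_eq_zero ?_ ?_
      · rw [barDifferential_precomp, barDifferential_ofVec, map_zero]
      · rw [← hx0]
        funext a
        rw [eval_zero_apply, barPrecomp_apply, ofVec_apply, diff_apply,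
          ← Matrix.dotProduct_mulVec, single_one_dotProduct]
    · rw [eval_ofVec, sub_self]
      exact zero_mem _
  | succ q ih =>
    intro X j x hx hx0
    obtain ⟨h₁, hm, hδ, hd, he⟩ := ih X.shift j ((-1 : k) ^ (q + 1) • x)
      (Submodule.smul_mem _ _ hx) (by
        refine (Matrix.mulVec_smul _ _ _).trans ?_
        rw [show (X.shift.mat q).mulVec x = 0 from hx0, smul_zero])
    have hd₁ := X.barPrecomp_diff_barPrecompLin_sec h₁ hd
    have hgm := X.barPrecompLin_sec_mem hm
    set g := barPrecompLin (X.sec 0) h₁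
    refine ⟨barDifferential k R _ R q g, X.barDifferential_term_mem hgm,
      barDifferential_barDifferential q g, ?_, ?_⟩
    · rw [← barDifferential_precomp, hd₁, hδ]
    · rw [eval_barDifferential, hd₁, add_sub_assoc]
      refine add_mem (X.mulVec_mem_bdry (X.eval_mem hgm)) ?_
      have := Submodule.smul_mem _ ((-1 : k) ^ (q + 1)) (X.bdry_shift_le q j he)
      rwa [smul_sub, neg_one_pow_smul_smul] at this

/-- An endomorphism `x ↦ x * U i` of the complex, homogeneous of degree `d`. -/
structure IsChainMap (X : SplitComplex 𝓡) (d : ℤ)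
    (U : ∀ i, Matrix (Fin (X.rank i)) (Fin (X.rank i)) R) : Prop where
  mem : ∀ i a b, U i a b ∈ 𝓡 d
  comm : ∀ i, U (i + 1) * X.mat i = X.mat i * U i

theorem IsChainMap.shift {X : SplitComplex 𝓡} {d : ℤ}
    {U : ∀ i, Matrix (Fin (X.rank i)) (Fin (X.rank i)) R} (hU : X.IsChainMap d U) :
    X.shift.IsChainMap d fun i => U (i + 1) :=
  ⟨fun i => hU.mem (i + 1), fun i => hU.comm (i + 1)⟩

/-- The comparison is compatible with chain maps up to coboundaries. -/
theorem IsChainMap.eval_sub_mem (q : ℕ) : ∀ (X : SplitComplex 𝓡) {d : ℤ}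
    {U : ∀ i, Matrix (Fin (X.rank i)) (Fin (X.rank i)) R} (_ : X.IsChainMap d U) (j : ℤ)
    (h : BarCochain k R X.Term R q) (_ : h ∈ homCochains 𝓡 X.termGrading 𝓡 q j)
    (_ : barDifferential k R _ R q h = 0) (_ : barPrecomp X.diff q h = 0),
    X.eval q (barPrecomp (Matrix.vecMulLinear (U 0)) q h) - (U q).mulVec (X.eval q h) ∈
      X.bdry q (j + d) := by
  induction q with
  | zero =>
    intro X d U hU j h _ hδ _
    suffices hs : X.eval 0 (barPrecomp (Matrix.vecMulLinear (U 0)) 0 h) =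
        (U 0).mulVec (X.eval 0 h) by
      rw [hs, sub_self]; exact zero_mem _
    funext a
    rw [eval_zero_apply, barPrecomp_apply, apply_eq_sum_of_barDifferential_eq_zero hδ]
    refine Finset.sum_congr rfl fun b _ => ?_
    rw [Matrix.vecMulLinear_apply, Matrix.single_one_vecMul]
    rfl
  | succ q ih =>
    intro X d U hU j h hh hδ hd
    have hg := barDifferential_barContraction h hδ
    have hgm := X.barContraction_mem hh
    set g := barContraction h
    have hUm : barPrecomp (Matrix.vecMulLinear (U 0)) q g ∈
        homCochains 𝓡 X.termGrading 𝓡 q (j + d) :=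
      barPrecomp_mem 𝓡 (fun e x hx => vecMul_mem_vecGrading (hU.mem 0) hx (by ring)) hgm
    have hc : barPrecomp X.diff q (barPrecomp (Matrix.vecMulLinear (U 0)) q g) =
        barPrecomp (Matrix.vecMulLinear (U 1)) q (barPrecomp X.diff q g) := by
      refine barPrecomp_comm (fun x => ?_) g
      rw [Matrix.vecMulLinear_apply, Matrix.vecMulLinear_apply, diff_apply, diff_apply,
        Matrix.vecMul_vecMul, Matrix.vecMul_vecMul, hU.comm]
    have hi := ih X.shift hU.shift j (barPrecomp X.diff q g) (X.barPrecomp_diff_mem hgm)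
      (by rw [barDifferential_precomp, hg, hd]) (barPrecomp_eq_zero X.diff_shift_diff g)
    rw [← hg, ← barDifferential_precomp, eval_barDifferential, eval_barDifferential,
      hc, Matrix.mulVec_add, Matrix.mulVec_mulVec, hU.comm, ← Matrix.mulVec_mulVec,
      Matrix.mulVec_smul, add_sub_add_comm, ← Matrix.mulVec_sub, ← smul_sub]
    refine add_mem (X.mulVec_mem_bdry (sub_mem (X.eval_mem hUm)
      (mulVec_mem_vecGrading (hU.mem q) (X.eval_mem hgm) (by ring)))) ?_
    exact Submodule.smul_mem _ _ (X.bdry_shift_le q _ hi)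

end SplitComplex

/-- A graded free resolution of a graded module `M`, exactness being witnessed by graded `k`-linear
maps. -/
structure SplitResolution {M : Type*} [AddCommGroup M] [Module k M] [Module R M]
    [IsScalarTower k R M] (𝓡 : ℤ → Submodule k R) (𝓜 : ℤ → Submodule k M) extends
    SplitComplex 𝓡 where
  aug : (Fin (rank 0) → R) →ₗ[R] M
  aug_mem : ∀ e x, x ∈ vecGrading 𝓡 _ (e - deg 0) → aug x ∈ 𝓜 e
  aug_mat : ∀ x, aug (Matrix.vecMul x (mat 0)) = 0
  augSec : M →ₗ[k] (Fin (rank 0) → R)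
  augSec_mem : ∀ e m, m ∈ 𝓜 e → augSec m ∈ vecGrading 𝓡 _ (e - deg 0)
  aug_augSec : ∀ m, aug (augSec m) = m
  augSec_spec : ∀ x, ∃ z, augSec (aug x) + Matrix.vecMul z (mat 0) = x

namespace SplitResolution

open SplitComplex

variable {M : Type*} [AddCommGroup M] [Module k M] [Module R M] [IsScalarTower k R M]
  {𝓡 : ℤ → Submodule k R} {𝓜 : ℤ → Submodule k M}
  (X : SplitResolution 𝓡 𝓜)

/-- The comparison map from bar cochains of `M` to the complex `Hom_R (R^{s_•}, R)` of column
vectors. -/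
def evalAug (q : ℕ) : BarCochain k R M R q →ₗ[k] (Fin (X.rank q) → R) :=
  X.eval q ∘ₗ barPrecomp X.aug q

theorem evalAug_apply (q : ℕ) (f : BarCochain k R M R q) :
    X.evalAug q f = X.eval q (barPrecomp X.aug q f) := rfl

theorem evalAug_barDifferential (q : ℕ) (f : BarCochain k R M R q) :
    X.evalAug (q + 1) (barDifferential k R M R q f) = (X.mat q).mulVec (X.evalAug q f) := by
  rw [evalAug_apply, ← barDifferential_precomp, eval_barDifferential,
    barPrecomp_eq_zero X.aug_mat, map_zero, smul_zero, add_zero]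
  rfl

theorem barPrecomp_aug_mem {q : ℕ} {j : ℤ} {f : BarCochain k R M R q}
    (hf : f ∈ homCochains 𝓡 𝓜 𝓡 q j) :
    barPrecomp X.aug q f ∈ homCochains 𝓡 X.termGrading 𝓡 q j := by
  simpa using barPrecomp_mem 𝓡 (𝓜 := X.termGrading) (𝓜' := 𝓜) (u := X.aug) (i := 0)
    (fun e x hx => by simpa using X.aug_mem e x hx) hf

theorem barPrecomp_aug_injective {q : ℕ} {f g : BarCochain k R M R q}
    (h : barPrecomp X.aug q f = barPrecomp X.aug q g) : f = g := by
  refine MultilinearMap.ext fun r => LinearMap.ext fun m => ?_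
  have := congrArg (fun F => F r (X.augSec m)) h
  simpa only [barPrecomp_apply, X.aug_augSec] using this

theorem exists_barPrecomp_aug_eq {q : ℕ} {j : ℤ} {h : BarCochain k R X.Term R q}
    (hm : h ∈ homCochains 𝓡 X.termGrading 𝓡 q j) (hd : barPrecomp X.diff q h = 0) :
    ∃ f ∈ homCochains 𝓡 𝓜 𝓡 q j, barPrecomp X.aug q f = h := by
  refine ⟨barPrecompLin X.augSec h,
    fun d e r m hr hx => hm d e r (X.augSec m) hr (X.augSec_mem e m hx), ?_⟩
  refine MultilinearMap.ext fun r => LinearMap.ext fun x => ?_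
  rw [barPrecomp_apply, barPrecompLin_apply]
  obtain ⟨z, hz⟩ := X.augSec_spec x
  have h0 : h r (X.diff z) = 0 := by
    rw [← barPrecomp_apply, hd]; rfl
  have h1 : X.augSec (X.aug x) + X.diff z = x := hz
  conv_rhs => rw [← h1, map_add, h0, add_zero]

variable [SetLike.GradedMonoid 𝓡]

theorem evalAug_mem {q : ℕ} {j : ℤ} {f : BarCochain k R M R q}
    (hf : f ∈ homCochains 𝓡 𝓜 𝓡 q j) : X.evalAug q f ∈ vecGrading 𝓡 _ (X.deg q + j) :=
  X.eval_mem (X.barPrecomp_aug_mem hf)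

theorem mulVec_evalAug {q : ℕ} {j : ℤ} {f : BarCochain k R M R q}
    (hf : f ∈ extCocycles 𝓡 𝓜 𝓡 q j) : (X.mat q).mulVec (X.evalAug q f) = 0 := by
  have h : barDifferential k R M R q f = 0 := hf.2
  rw [← evalAug_barDifferential, h, map_zero]

theorem evalAug_mem_bdry {q : ℕ} {j : ℤ} {f : BarCochain k R M R q}
    (hf : f ∈ extCoboundaries 𝓡 𝓜 𝓡 q j) : X.evalAug q f ∈ X.bdry q j := by
  cases q with
  | zero =>
    rw [(Submodule.mem_bot k).1 hf, map_zero]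
    exact zero_mem _
  | succ q =>
    obtain ⟨g, hg, rfl⟩ := hf
    rw [evalAug_barDifferential]
    exact X.mulVec_mem_bdry (X.evalAug_mem hg)

theorem mem_extCoboundaries {q : ℕ} {j : ℤ} {f : BarCochain k R M R q}
    (hf : f ∈ extCocycles 𝓡 𝓜 𝓡 q j) (h : X.evalAug q f ∈ X.bdry q j) :
    f ∈ extCoboundaries 𝓡 𝓜 𝓡 q j := by
  have hδ : barDifferential k R _ R q (barPrecomp X.aug q f) = 0 := by
    rw [barDifferential_precomp, show barDifferential k R M R q f = 0 from hf.2, map_zero]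
  cases q with
  | zero =>
    refine (Submodule.mem_bot k).2 (X.barPrecomp_aug_injective ?_)
    rw [map_zero]
    exact X.eq_zero_of_eval_eq_zero hδ ((Submodule.mem_bot k).1 h)
  | succ q =>
    obtain ⟨g, hg, hgf, hd⟩ := exists_barDifferential_eq q X.toSplitComplex j _
      (X.barPrecomp_aug_mem hf.1) hδ (barPrecomp_eq_zero X.aug_mat f) h
    obtain ⟨f', hf', rfl⟩ := X.exists_barPrecomp_aug_eq hg hd
    rw [barDifferential_precomp] at hgf
    exact ⟨f', hf', X.barPrecomp_aug_injective hgf⟩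

theorem exists_evalAug_sub_mem {q : ℕ} {j : ℤ} {x : Fin (X.rank q) → R}
    (hx : x ∈ vecGrading 𝓡 _ (X.deg q + j)) (hx0 : (X.mat q).mulVec x = 0) :
    ∃ f ∈ extCocycles 𝓡 𝓜 𝓡 q j, X.evalAug q f - x ∈ X.bdry q j := by
  obtain ⟨h, hm, hδ, hd, he⟩ := exists_eval_sub_mem q X.toSplitComplex j x hx hx0
  obtain ⟨f, hf, rfl⟩ := X.exists_barPrecomp_aug_eq hm hd
  refine ⟨f, ⟨hf, X.barPrecomp_aug_injective ?_⟩, he⟩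
  rw [← barDifferential_precomp, hδ, map_zero]

theorem evalAug_barPrecomp_sub_mem {d : ℤ} {U : ∀ i, Matrix (Fin (X.rank i)) (Fin (X.rank i)) R}
    (hU : X.IsChainMap d U) {u : M →ₗ[R] M} (hu : ∀ x, X.aug (Matrix.vecMul x (U 0)) = u (X.aug x))
    {q : ℕ} {j : ℤ} {f : BarCochain k R M R q} (hf : f ∈ extCocycles 𝓡 𝓜 𝓡 q j) :
    X.evalAug q (barPrecomp u q f) - (U q).mulVec (X.evalAug q f) ∈ X.bdry q (j + d) := by
  have h1 : barPrecomp X.aug q (barPrecomp u q f) =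
      barPrecomp (Matrix.vecMulLinear (U 0)) q (barPrecomp X.aug q f) :=
    barPrecomp_comm (fun x => (hu x).symm) f
  rw [evalAug_apply, h1]
  refine hU.eval_sub_mem q X.toSplitComplex j _ (X.barPrecomp_aug_mem hf.1) ?_
    (barPrecomp_eq_zero X.aug_mat f)
  rw [barDifferential_precomp, show barDifferential k R M R q f = 0 from hf.2, map_zero]

theorem evalAug_barPostcomp (v : R →ₗ[R] R) {q : ℕ} (f : BarCochain k R M R q)
    (a : Fin (X.rank q)) : X.evalAug q (barPostcomp v q f) a = v (X.evalAug q f a) :=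
  X.pathSum_map (v : R →+ R) q (fun c r => f r (X.aug (Pi.single c 1))) a

end SplitResolution

end Comparison

/-! ### Homogeneous generalised inverses and their transfer -/

section GradedLinear

variable {k B : Type*} [Field k] [Ring B] [Algebra k B]

/-- Over a field every linear map has a generalised inverse. -/
theorem exists_generalizedInverse {V W : Type*} [AddCommGroup V] [Module k V] [AddCommGroup W]
    [Module k W] (f : V →ₗ[k] W) : ∃ g : W →ₗ[k] V, ∀ x, f (g (f x)) = f x := by
  obtain ⟨r, hr⟩ := f.rangeRestrict.exists_rightInverse_of_surjective f.range_rangeRestrict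
  obtain ⟨g, hg⟩ := r.exists_extend
  refine ⟨g, fun x => ?_⟩
  have h1 : g (f x) = r (f.rangeRestrict x) := LinearMap.congr_fun hg (f.rangeRestrict x)
  have h2 := LinearMap.congr_fun hr (f.rangeRestrict x)
  rw [h1]
  exact congrArg Subtype.val h2

variable (ℬ : ℤ → Submodule k B) [GradedAlgebra ℬ]

theorem linearMap_ext_of_vecGrading {W : Type*} [AddCommGroup W] [Module k W] {s : ℕ}
    {f g : (Fin s → B) →ₗ[k] W} (h : ∀ e, ∀ x ∈ vecGrading ℬ s e, f x = g x) : f = g := by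
  refine LinearMap.pi_ext fun a b => ?_
  induction b using DirectSum.Decomposition.inductionOn ℬ with
  | zero => rw [Pi.single_zero, map_zero, map_zero]
  | add b b' hb hb' => rw [Pi.single_add, map_add, map_add, hb, hb']
  | @homogeneous e b =>
    refine h e _ (mem_vecGrading.2 fun c => ?_)
    by_cases hc : c = a
    · subst hc; simp
    · simp [hc]

/-- A homogeneous linear map between graded free modules has a homogeneous generalised inverse. -/
theorem exists_graded_generalizedInverse {s t : ℕ} {d : ℤ} (f : (Fin s → B) →ₗ[k] (Fin t → B))
    (hf : ∀ e, ∀ x ∈ vecGrading ℬ s e, f x ∈ vecGrading ℬ t (e + d)) :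
    ∃ g : (Fin t → B) →ₗ[k] (Fin s → B),
      (∀ e, ∀ x ∈ vecGrading ℬ t e, g x ∈ vecGrading ℬ s (e + -d)) ∧ f ∘ₗ g ∘ₗ f = f := by
  choose g₀ hg₀ using fun e : ℤ =>
    exists_generalizedInverse (f ∘ₗ (vecGrading ℬ s e).subtype)
  let g₁ (e : ℤ) : (Fin t → B) →ₗ[k] (Fin s → B) := (vecGrading ℬ s e).subtype ∘ₗ g₀ e
  let G (a : Fin t) : B →ₗ[k] (Fin s → B) :=
    DirectSum.toModule k ℤ _ (fun n => g₁ (n + -d) ∘ₗ LinearMap.single k (fun _ => B) a ∘ₗ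
      (ℬ n).subtype) ∘ₗ (DirectSum.decomposeLinearEquiv ℬ).toLinearMap
  have hG (a : Fin t) (n : ℤ) (b : B) (hb : b ∈ ℬ n) :
      G a b = g₁ (n + -d) (Pi.single a b) := by
    change DirectSum.toModule k ℤ _ _ (DirectSum.decompose ℬ b) = _
    lift b to ℬ n using hb
    rw [DirectSum.decompose_coe]
    exact DirectSum.toModule_lof k _ _
  let g : (Fin t → B) →ₗ[k] (Fin s → B) := ∑ a, G a ∘ₗ LinearMap.proj a
  have hg (n : ℤ) (x : Fin t → B) (hx : x ∈ vecGrading ℬ t n) : g x = g₁ (n + -d) x := by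
    conv_rhs => rw [← Finset.univ_sum_single x, map_sum]
    rw [LinearMap.sum_apply]
    exact Finset.sum_congr rfl fun a _ => hG a n _ (mem_vecGrading.1 hx a)
  refine ⟨g, fun e x hx => ?_, linearMap_ext_of_vecGrading ℬ fun e x hx => ?_⟩
  · rw [hg e x hx]
    exact (g₀ _ x).2
  · rw [LinearMap.comp_apply, LinearMap.comp_apply, hg _ _ (hf e x hx), add_neg_cancel_right]
    exact hg₀ e ⟨x, hx⟩

end GradedLinear

section Transfer

variable {k B C : Type*} [Field k] [Ring B] [Algebra k B] [AddCommGroup C] [Module k C]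
  (ρ : Module.End k B →ₐ[k] Module.End k C) {r s t : ℕ}

/-- The linear map `Cˢ → Cᵗ` obtained from `f : Bˢ → Bᵗ` by applying `ρ : End B → End C` to all
its matrix entries. -/
noncomputable def transfer (f : (Fin s → B) →ₗ[k] (Fin t → B)) : (Fin s → C) →ₗ[k] (Fin t → C) :=
  LinearMap.pi fun b => ∑ a,
    ρ (LinearMap.proj b ∘ₗ f ∘ₗ LinearMap.single k (fun _ => B) a) ∘ₗ LinearMap.proj a

theorem transfer_apply (f : (Fin s → B) →ₗ[k] (Fin t → B)) (x : Fin s → C) (b : Fin t) :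
    transfer ρ f x b =
      ∑ a, ρ (LinearMap.proj b ∘ₗ f ∘ₗ LinearMap.single k (fun _ => B) a) (x a) := by
  simp [transfer]

theorem transfer_comp (f : (Fin s → B) →ₗ[k] (Fin t → B)) (g : (Fin r → B) →ₗ[k] (Fin s → B)) :
    transfer ρ (f ∘ₗ g) = transfer ρ f ∘ₗ transfer ρ g := by
  refine LinearMap.ext fun x => funext fun c => ?_
  rw [LinearMap.comp_apply, transfer_apply, transfer_apply]
  simp only [transfer_apply, map_sum]
  rw [Finset.sum_comm]
  refine Finset.sum_congr rfl fun a _ => ?_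
  have h : (LinearMap.proj c ∘ₗ (f ∘ₗ g) ∘ₗ LinearMap.single k (fun _ => B) a : Module.End k B) =
      ∑ b, (LinearMap.proj c ∘ₗ f ∘ₗ LinearMap.single k (fun _ => B) b : Module.End k B) *
        (LinearMap.proj b ∘ₗ g ∘ₗ LinearMap.single k (fun _ => B) a : Module.End k B) := by
    refine LinearMap.ext fun x => ?_
    rw [LinearMap.sum_apply]
    change f (g (Pi.single a x)) c = ∑ b, f (Pi.single b (g (Pi.single a x) b)) c
    conv_lhs => rw [← Finset.univ_sum_single (g (Pi.single a x)), map_sum, Finset.sum_apply]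
  rw [h, map_sum, LinearMap.sum_apply]
  simp only [map_mul, Module.End.mul_apply]

theorem transfer_diagonal (f : (Fin s → B) →ₗ[k] (Fin s → B)) (T : Module.End k B)
    (hf : ∀ x a, f x a = T (x a)) (x : Fin s → C) (a : Fin s) :
    transfer ρ f x a = ρ T (x a) := by
  rw [transfer_apply, Finset.sum_eq_single a]
  · congr 2
    ext b
    simp [hf]
  · intro b _ hb
    have : (LinearMap.proj a ∘ₗ f ∘ₗ LinearMap.single k (fun _ => B) b : Module.End k B) = 0 := by
      ext c
      simp [hf, hb.symm]
    rw [this, map_zero]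
    rfl
  · simp

theorem transfer_id : transfer ρ (LinearMap.id : (Fin s → B) →ₗ[k] (Fin s → B)) =
    LinearMap.id := by
  refine LinearMap.ext fun x => funext fun a => ?_
  rw [transfer_diagonal ρ _ 1 (fun _ _ => rfl), map_one]
  rfl

theorem transfer_sub (f g : (Fin s → B) →ₗ[k] (Fin t → B)) :
    transfer ρ (f - g) = transfer ρ f - transfer ρ g := by
  refine LinearMap.ext fun x => funext fun b => ?_
  rw [LinearMap.sub_apply, Pi.sub_apply, transfer_apply, transfer_apply, transfer_apply,
    ← Finset.sum_sub_distrib]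
  refine Finset.sum_congr rfl fun a _ => ?_
  rw [LinearMap.sub_comp, LinearMap.comp_sub, map_sub, LinearMap.sub_apply]

/-- An identity `(1 - f g) (1 - h) = 0`, which expresses exactness, transfers from `B` to `C`. -/
theorem transfer_exact {f : (Fin s → B) →ₗ[k] (Fin t → B)} {g : (Fin t → B) →ₗ[k] (Fin s → B)}
    {h : (Fin t → B) →ₗ[k] (Fin t → B)} (hfg : ∀ x, f (g (x - h x)) = x - h x) (x : Fin t → C) :
    transfer ρ f (transfer ρ g (x - transfer ρ h x)) = x - transfer ρ h x := by
  have h1 : f ∘ₗ g ∘ₗ (LinearMap.id - h) = LinearMap.id - h := LinearMap.ext hfg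
  have h2 := congrArg (transfer ρ) h1
  rw [transfer_comp, transfer_comp, transfer_sub, transfer_id] at h2
  exact LinearMap.congr_fun h2 x

theorem transfer_mem {ℬ : ℤ → Submodule k B} {𝒞 : ℤ → Submodule k C} {d : ℤ}
    (hρ : ∀ T : Module.End k B, (∀ e, ∀ b ∈ ℬ e, T b ∈ ℬ (e + d)) →
      ∀ e, ∀ c ∈ 𝒞 e, ρ T c ∈ 𝒞 (e + d))
    {f : (Fin s → B) →ₗ[k] (Fin t → B)}
    (hf : ∀ e, ∀ x ∈ vecGrading ℬ s e, f x ∈ vecGrading ℬ t (e + d)) {e : ℤ} {x : Fin s → C}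
    (hx : ∀ a, x a ∈ 𝒞 e) (b : Fin t) : transfer ρ f x b ∈ 𝒞 (e + d) := by
  rw [transfer_apply]
  refine sum_mem fun a _ => hρ _ (fun e b' hb' => ?_) e _ (hx a)
  refine mem_vecGrading.1 (hf e (Pi.single a b') (mem_vecGrading.2 fun c => ?_)) b
  by_cases hc : c = a
  · subst hc; simpa using hb'
  · simp [hc]

end Transfer

section TransferMul

variable {k B C : Type*} [Field k] [Ring B] [Algebra k B] [Ring C] [Algebra k C]
  (ρ : Module.End k B →ₐ[k] Module.End k C) (ι : B → C) {s t : ℕ}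

theorem transfer_mulVec (hρ : ∀ b c, ρ (LinearMap.mulLeft k b) c = ι b * c)
    (P : Matrix (Fin t) (Fin s) B) (x : Fin s → C) :
    transfer ρ (SplitComplex.mulVecHom k P) x = (P.map ι).mulVec x := by
  funext b
  rw [transfer_apply]
  refine Finset.sum_congr rfl fun a _ => ?_
  change _ = ι (P b a) * x a
  rw [← hρ]
  congr 2
  ext c
  simp [SplitComplex.mulVecHom]

theorem transfer_vecMul (hρ : ∀ b c, ρ (LinearMap.mulRight k b) c = c * ι b)
    (P : Matrix (Fin s) (Fin t) B) (x : Fin s → C) :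
    transfer ρ (P.vecMulLinear.restrictScalars k) x = Matrix.vecMul x (P.map ι) := by
  funext b
  rw [transfer_apply]
  refine Finset.sum_congr rfl fun a _ => ?_
  change _ = x a * ι (P a b)
  rw [← hρ]
  congr 2
  ext c
  simp

end TransferMul

/-! ### The split resolution of the trivial module -/

namespace PureMinimalResolution

variable {k B : Type*} [Field k] [Ring B] [Algebra k B] {ℬ : ℤ → Submodule k B} [GradedAlgebra ℬ]
  [ConnectedGraded ℬ] {m : ℕ} {y : Fin m → B} (Q : PureMinimalResolution ℬ y)

theorem mat_mul_mat (i : ℕ) : Q.mat (i + 1) * Q.mat i = 0 := by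
  ext a b
  have := (Q.exact_succ i (Matrix.vecMul (Pi.single a 1) (Q.mat (i + 1)))).2 ⟨_, rfl⟩
  rw [Matrix.vecMul_vecMul, Matrix.single_one_vecMul] at this
  exact congrFun this b

theorem rank_zero_eq (a b : Fin (Q.rank 0)) : a = b := by
  have := Q.rank_zero
  ext
  omega

variable (ℬ) in
/-- The projection of `Bˢ` onto its component of degree `0`, entrywise `b ↦ ε(b)`. -/
noncomputable def augProj (s : ℕ) : (Fin s → B) →ₗ[k] (Fin s → B) :=
  LinearMap.pi fun a => (Algebra.linearMap k B ∘ₗ (augmentation ℬ).toLinearMap) ∘ₗ LinearMap.proj a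

theorem augProj_apply {s : ℕ} (x : Fin s → B) (a : Fin s) :
    augProj ℬ s x a = algebraMap k B (augmentation ℬ (x a)) := rfl

/-- Right multiplication of row vectors by `mat i`. -/
def rowMap (i : ℕ) : (Fin (Q.rank (i + 1)) → B) →ₗ[k] (Fin (Q.rank i) → B) :=
  (Q.mat i).vecMulLinear.restrictScalars k

theorem rowMap_apply (i : ℕ) (x : Fin (Q.rank (i + 1)) → B) :
    Q.rowMap i x = Matrix.vecMul x (Q.mat i) := rfl

theorem rowMap_mem (i : ℕ) (e : ℤ) (x : Fin (Q.rank (i + 1)) → B) (hx : x ∈ vecGrading ℬ _ e) :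
    Q.rowMap i x ∈ vecGrading ℬ _ (e + (Q.deg (i + 1) - Q.deg i)) :=
  vecMul_mem_vecGrading (Q.homogeneous i) hx rfl

/-- A homogeneous generalised inverse of `rowMap i`. -/
noncomputable def rowInv (i : ℕ) : (Fin (Q.rank i) → B) →ₗ[k] (Fin (Q.rank (i + 1)) → B) :=
  (exists_graded_generalizedInverse ℬ (Q.rowMap i) (Q.rowMap_mem i)).choose

theorem rowInv_mem (i : ℕ) (e : ℤ) (x : Fin (Q.rank i) → B) (hx : x ∈ vecGrading ℬ _ e) :
    Q.rowInv i x ∈ vecGrading ℬ _ (e + -(Q.deg (i + 1) - Q.deg i)) :=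
  (exists_graded_generalizedInverse ℬ (Q.rowMap i) (Q.rowMap_mem i)).choose_spec.1 e x hx

theorem rowMap_rowInv_rowMap (i : ℕ) (x : Fin (Q.rank (i + 1)) → B) :
    Q.rowMap i (Q.rowInv i (Q.rowMap i x)) = Q.rowMap i x :=
  LinearMap.congr_fun
    (exists_graded_generalizedInverse ℬ (Q.rowMap i) (Q.rowMap_mem i)).choose_spec.2 x

theorem rowMap_exact_succ (i : ℕ) (x : Fin (Q.rank (i + 1)) → B) :
    Q.rowMap (i + 1) (Q.rowInv (i + 1) (x - (Q.rowInv i ∘ₗ Q.rowMap i) x)) =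
      x - (Q.rowInv i ∘ₗ Q.rowMap i) x := by
  obtain ⟨z, hz⟩ := (Q.exact_succ i (x - (Q.rowInv i ∘ₗ Q.rowMap i) x)).1 (by
    rw [← rowMap_apply, map_sub, LinearMap.comp_apply, rowMap_rowInv_rowMap, sub_self])
  rw [← hz]
  exact Q.rowMap_rowInv_rowMap (i + 1) z

theorem rowMap_exact_zero (x : Fin (Q.rank 0) → B) :
    Q.rowMap 0 (Q.rowInv 0 (x - augProj ℬ _ x)) = x - augProj ℬ _ x := by
  obtain ⟨z, hz⟩ := (Q.exact_zero (x - augProj ℬ _ x)).1 (Finset.sum_eq_zero fun p _ => by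
    rw [Pi.sub_apply, augProj_apply, map_sub, AlgHom.commutes, Algebra.algebraMap_self_apply,
      sub_self])
  rw [← hz]
  exact Q.rowMap_rowInv_rowMap 0 z

/-- The resolution `Q` of the trivial module, split by the generalised inverses of its
differentials. -/
noncomputable def toSplitResolution :
    SplitResolution (M := TrivialModule ℬ) ℬ (trivialGrading ℬ) where
  rank := Q.rank
  deg := Q.deg
  mat := Q.mat
  homogeneous := Q.homogeneous
  mat_mul_mat := Q.mat_mul_mat
  sec := Q.rowInv
  sec_mem i e x hx := by
    have := Q.rowInv_mem i _ x hx
    convert this using 2; ring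
  sec_spec i x := ⟨_, by
    rw [← rowMap_apply, ← rowMap_apply]
    exact (congrArg _ (Q.rowMap_exact_succ i x)).trans (add_sub_cancel _ _)⟩
  aug :=
    { toFun := fun x => (∑ p, augmentation ℬ (x p) : k)
      map_add' := fun x z => by
        change (∑ p, augmentation ℬ (x p + z p) : k) =
          ∑ p, augmentation ℬ (x p) + ∑ p, augmentation ℬ (z p)
        simp only [map_add, Finset.sum_add_distrib]
      map_smul' := fun b x => by
        change (∑ p, augmentation ℬ (b * x p) : k) = augmentation ℬ b * ∑ p, augmentation ℬ (x p)
        simp only [map_mul, Finset.mul_sum] }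
  aug_mem e x hx := by
    rw [mem_vecGrading, Q.deg_zero, sub_zero] at hx
    rw [trivialGrading]
    split_ifs with h
    · trivial
    · rw [Submodule.mem_bot]
      change (∑ p, augmentation ℬ (x p) : k) = 0
      exact Finset.sum_eq_zero fun p _ => augmentation_eq_zero ℬ h (hx p)
  aug_mat x := (Q.exact_zero _).2 ⟨x, rfl⟩
  augSec :=
    { toFun := fun c _ => algebraMap k B c
      map_add' := fun c d => funext fun _ => map_add (algebraMap k B) c d
      map_smul' := fun c d => funext fun _ =>
        (map_mul (algebraMap k B) c d).trans (Algebra.smul_def c (algebraMap k B d)).symm }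
  augSec_mem e c hc := by
    rw [mem_vecGrading, Q.deg_zero, sub_zero]
    intro a
    rw [trivialGrading] at hc
    split_ifs at hc with h
    · subst h
      exact SetLike.algebraMap_mem_graded ℬ _
    · rw [(Submodule.mem_bot k).1 hc]
      change algebraMap k B 0 ∈ _
      rw [map_zero]
      exact zero_mem _
  aug_augSec c := by
    change ∑ p : Fin (Q.rank 0), augmentation ℬ (algebraMap k B c) = c
    refine (Finset.sum_congr rfl fun _ _ => (augmentation ℬ).commutes c).trans ?_
    rw [Finset.sum_const, Finset.card_univ, Fintype.card_fin, Q.rank_zero, one_smul]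
    rfl
  augSec_spec x := ⟨_, by
    have h : augProj ℬ _ x = fun _ => algebraMap k B (∑ q, augmentation ℬ (x q)) := by
      funext p
      rw [augProj_apply,
        Finset.sum_eq_single p (fun q _ hq => absurd (Q.rank_zero_eq q p) hq) (by simp)]
    rw [← rowMap_apply, Q.rowMap_exact_zero x, h]
    exact add_sub_cancel _ _⟩

theorem augmentation_vecMul {i : ℕ} (z : Fin (Q.rank (i + 1)) → B) (a : Fin (Q.rank i)) :
    augmentation ℬ (Matrix.vecMul z (Q.mat i) a) = 0 := by
  rw [Matrix.vecMul, dotProduct, map_sum]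
  exact Finset.sum_eq_zero fun b _ => by rw [map_mul, Q.minimal, mul_zero]

end PureMinimalResolution

/-! ### Finite global dimension -/

section GlobalDimension

open CategoryTheory

theorem hasProjectiveDimensionLT_of_globalDimension {B : Type u} [Ring B] {h : ℕ}
    (hB : globalDimension B = h) (M : ModuleCat.{u} B) : HasProjectiveDimensionLT M (h + 1) := by
  have h1 : projectiveDimension M ≤ h :=
    hB ▸ le_iSup (fun M : ModuleCat.{u} B => projectiveDimension M) M
  exact (projectiveDimension_le_iff M h).1 h1

theorem shortExact_moduleCat {B : Type u} [Ring B] {K F M : Type u} [AddCommGroup K] [Module B K]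
    [AddCommGroup F] [Module B F] [AddCommGroup M] [Module B M] (f : K →ₗ[B] F) (g : F →ₗ[B] M)
    (hf : Function.Injective f) (hg : Function.Surjective g) (h : Function.Exact f g) :
    (ShortComplex.mk (ModuleCat.ofHom f) (ModuleCat.ofHom g) (by
      ext x; exact h.apply_apply_eq_zero x)).ShortExact := by
  refine ShortComplex.ShortExact.mk' ?_ ((ModuleCat.mono_iff_injective _).2 hf)
    ((ModuleCat.epi_iff_surjective _).2 hg)
  rw [ShortComplex.moduleCat_exact_iff]
  intro x hx
  exact (h x).1 hx

namespace PureMinimalResolution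

variable {k : Type*} {B : Type u} [Field k] [Ring B] [Algebra k B] {ℬ : ℤ → Submodule k B}
  [GradedAlgebra ℬ] [ConnectedGraded ℬ] {m : ℕ} {y : Fin m → B} (Q : PureMinimalResolution ℬ y)

/-- The cokernel of the `i`-th differential, i.e. the `i`-th syzygy of the trivial module. -/
abbrev Syzygy (i : ℕ) : Type u := (Fin (Q.rank i) → B) ⧸ LinearMap.range (Q.mat i).vecMulLinear

theorem hasProjectiveDimensionLT_syzygy_succ (i n : ℕ)
    (h : HasProjectiveDimensionLT (ModuleCat.of B (Q.Syzygy i)) (n + 2)) :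
    HasProjectiveDimensionLT (ModuleCat.of B (Q.Syzygy (i + 1))) (n + 1) := by
  let f : Q.Syzygy (i + 1) →ₗ[B] (Fin (Q.rank i) → B) :=
    Submodule.liftQ _ (Q.mat i).vecMulLinear (by
      rintro _ ⟨z, rfl⟩
      exact (Q.exact_succ i _).2 ⟨z, rfl⟩)
  have hf : Function.Injective f := by
    rw [← LinearMap.ker_eq_bot]
    refine Submodule.ker_liftQ_eq_bot _ _ _ fun x hx => ?_
    exact (Q.exact_succ i x).1 hx
  have hfg : Function.Exact f (Submodule.mkQ (LinearMap.range (Q.mat i).vecMulLinear)) := by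
    rw [LinearMap.exact_iff, Submodule.ker_mkQ, Submodule.range_liftQ]
  have hP : HasProjectiveDimensionLT (ModuleCat.of B (Fin (Q.rank i) → B)) 1 := by
    rw [← projective_iff_hasProjectiveDimensionLT_one, ← IsProjective.iff_projective]
    infer_instance
  exact (shortExact_moduleCat f _ hf (Submodule.mkQ_surjective _) hfg).hasProjectiveDimensionLT_X₁
    (n + 1) (hasProjectiveDimensionLT_of_ge _ 1 _ (by omega)) h

theorem hasProjectiveDimensionLT_syzygy (n : ℕ) : ∀ i,
    HasProjectiveDimensionLT (ModuleCat.of B (Q.Syzygy i)) (n + 1) →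
    HasProjectiveDimensionLT (ModuleCat.of B (Q.Syzygy (i + n))) 1 := by
  induction n with
  | zero => exact fun i h => h
  | succ n ih =>
    intro i h
    have := ih (i + 1) (Q.hasProjectiveDimensionLT_syzygy_succ i n h)
    rwa [show i + 1 + n = i + (n + 1) by ring] at this

/-- If the `h`-th syzygy is projective, then `Wᵢ = 0` for `i = h + 1`: a splitting of `B ⊗ W_h`
onto the syzygy gives a matrix `Z` with `(1 - P Z) P = 0` for `P = mat h`, hence `1 - P Z` factors
through `mat (h + 1)`, and both `P` and `mat (h + 1)` vanish under the augmentation. -/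
theorem rank_succ_eq_zero (h : ℕ) (hP : Module.Projective B (Q.Syzygy h)) : Q.rank (h + 1) = 0 := by
  obtain ⟨σ, hσ⟩ := Module.projective_lifting_property
    (Submodule.mkQ (LinearMap.range (Q.mat h).vecMulLinear)) LinearMap.id
    (Submodule.mkQ_surjective _)
  let π : (Fin (Q.rank h) → B) →ₗ[B] (Fin (Q.rank h) → B) :=
    LinearMap.id - σ ∘ₗ Submodule.mkQ (LinearMap.range (Q.mat h).vecMulLinear)
  have hπ (x) : ∃ z, Matrix.vecMul z (Q.mat h) = π x := by
    have : π x ∈ LinearMap.range (Q.mat h).vecMulLinear := by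
      rw [← Submodule.Quotient.mk_eq_zero, ← Submodule.mkQ_apply]
      change Submodule.mkQ _ (x - σ (Submodule.mkQ _ x)) = 0
      rw [map_sub, sub_eq_zero]
      exact (LinearMap.congr_fun hσ (Submodule.mkQ _ x)).symm
    exact this
  choose z hz using hπ
  by_contra hne
  let j : Fin (Q.rank (h + 1)) := ⟨0, Nat.pos_of_ne_zero hne⟩
  let r : Fin (Q.rank h) → B := Q.mat h j
  have hr : π r = r := by
    have h0 : Submodule.mkQ (LinearMap.range (Q.mat h).vecMulLinear) r = 0 := by
      rw [Submodule.mkQ_apply, Submodule.Quotient.mk_eq_zero]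
      exact ⟨Pi.single j 1, Matrix.single_one_vecMul j (Q.mat h)⟩
    change r - σ _ = r
    rw [h0, map_zero, sub_zero]
  let w : Fin (Q.rank (h + 1)) → B := ∑ p, r p • z (Pi.single p 1)
  have hw : Matrix.vecMul (Pi.single j 1 - w) (Q.mat h) = 0 := by
    rw [Matrix.sub_vecMul, Matrix.single_one_vecMul, sub_eq_zero]
    have h1 : r = ∑ p, r p • (Pi.single p 1 : Fin (Q.rank h) → B) := pi_eq_sum_univ' r
    have h2 : Matrix.vecMul w (Q.mat h) = ∑ p, r p • π (Pi.single p 1) := by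
      rw [← Matrix.vecMulLinear_apply, map_sum]
      refine Finset.sum_congr rfl fun p _ => ?_
      rw [map_smul, Matrix.vecMulLinear_apply, hz]
    rw [h2]
    change r = _
    conv_lhs => rw [← hr, h1, map_sum]
    simp only [map_smul]
  obtain ⟨t, ht⟩ := (Q.exact_succ h _).1 hw
  have h3 := Q.augmentation_vecMul t j
  have h4 : augmentation ℬ (w j) = 0 := by
    change augmentation ℬ ((∑ p, r p • z (Pi.single p 1)) j) = 0
    rw [Finset.sum_apply, map_sum]
    refine Finset.sum_eq_zero fun p _ => ?_
    rw [Pi.smul_apply, smul_eq_mul, map_mul, Q.minimal, zero_mul]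
  rw [ht, Pi.sub_apply, Pi.single_eq_same, map_sub, map_one, h4, sub_zero] at h3
  exact one_ne_zero h3

theorem rank_eq_zero_of_rank_eq_zero {i : ℕ} (h : Q.rank i = 0) : Q.rank (i + 1) = 0 := by
  by_contra hne
  let j : Fin (Q.rank (i + 1)) := ⟨0, Nat.pos_of_ne_zero hne⟩
  obtain ⟨t, ht⟩ := (Q.exact_succ i (Pi.single j 1)).1 (funext fun a => (h ▸ a : Fin 0).elim0)
  have h3 := Q.augmentation_vecMul t j
  rw [ht, Pi.single_eq_same, map_one] at h3
  exact one_ne_zero h3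

theorem rank_eq_zero {h : ℕ} (hB : globalDimension B = h) (i : ℕ) (hi : h < i) : Q.rank i = 0 := by
  induction i, hi using Nat.le_induction with
  | base =>
    refine Q.rank_succ_eq_zero h ?_
    have h1 := Q.hasProjectiveDimensionLT_syzygy h 0
      (hasProjectiveDimensionLT_of_globalDimension hB _)
    rw [zero_add, ← projective_iff_hasProjectiveDimensionLT_one] at h1
    exact (IsProjective.iff_projective _).2 h1
  | succ i _ ih => exact Q.rank_eq_zero_of_rank_eq_zero ih

end PureMinimalResolution

end GlobalDimension

/-! ### The dual complex of column vectors -/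

section Pad

variable {k R : Type*} [Field k] [Ring R] [Algebra k R]

/-- The ranks of a complex shifted by one, starting with `0`. -/
def padRank (s : ℕ → ℕ) : ℕ → ℕ
  | 0 => 0
  | i + 1 => s i

/-- The degrees of a complex shifted by one. -/
def padDeg (l : ℕ → ℤ) : ℕ → ℤ
  | 0 => 0
  | i + 1 => l i

/-- The matrix of the differential *into* position `i` of the dual complex of column vectors, which
is the `(i - 1)`-st matrix of the complex for `i > 0`, and has no columns for `i = 0`. -/
def padMat {s : ℕ → ℕ} (M : ∀ i, Matrix (Fin (s (i + 1))) (Fin (s i)) R) :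
    ∀ i, Matrix (Fin (s i)) (Fin (padRank s i)) R
  | 0 => Matrix.of fun _ x => Fin.elim0 x
  | i + 1 => M i

theorem padMat_map {S : Type*} {s : ℕ → ℕ} (M : ∀ i, Matrix (Fin (s (i + 1))) (Fin (s i)) R)
    [Ring S] (f : R → S) (i : ℕ) : (padMat M i).map f = padMat (fun i => (M i).map f) i := by
  cases i with
  | zero => ext a b; exact b.elim0
  | succ i => rfl

theorem padMat_mem {𝓡 : ℤ → Submodule k R} {s : ℕ → ℕ} {l : ℕ → ℤ}
    {M : ∀ i, Matrix (Fin (s (i + 1))) (Fin (s i)) R}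
    (hM : ∀ i a b, M i a b ∈ 𝓡 (l (i + 1) - l i)) :
    ∀ i a b, padMat M i a b ∈ 𝓡 (l i - padDeg l i)
  | 0, _, b => Fin.elim0 b
  | i + 1, a, b => hM i a b

theorem SplitComplex.mem_bdry_iff {𝓡 : ℤ → Submodule k R} (X : SplitComplex 𝓡) (q : ℕ) (j : ℤ)
    (x : Fin (X.rank q) → R) : x ∈ X.bdry q j ↔
      ∃ w ∈ vecGrading 𝓡 (padRank X.rank q) (padDeg X.deg q + j),
        (padMat X.mat q).mulVec w = x := by
  cases q with
  | zero =>
    refine ⟨fun h => ⟨fun a => Fin.elim0 a, mem_vecGrading.2 fun a => Fin.elim0 a, ?_⟩, ?_⟩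
    · rw [(Submodule.mem_bot k).1 h]
      rfl
    · rintro ⟨w, _, rfl⟩
      exact (Submodule.mem_bot k).2 rfl
  | succ q => rfl

end Pad

theorem subsingleton_uExt_iff {k R M N : Type*} [Field k] [Ring R] [Algebra k R]
    [AddCommGroup M] [Module k M] [Module R M] [IsScalarTower k R M]
    [AddCommGroup N] [Module k N] [Module R N] [IsScalarTower k R N]
    {𝓡 : ℤ → Submodule k R} {𝓜 : ℤ → Submodule k M} {𝓝 : ℤ → Submodule k N} {n : ℕ} {j : ℤ} :
    Subsingleton (uExt 𝓡 𝓜 𝓝 n j) ↔ ∀ f ∈ extCocycles 𝓡 𝓜 𝓝 n j, f ∈ extCoboundaries 𝓡 𝓜 𝓝 n j := by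
  rw [Submodule.Quotient.subsingleton_iff, Submodule.submoduleOf,
    Submodule.comap_subtype_eq_top]
  rfl

namespace PureMinimalResolution

variable {k : Type*} {B : Type u} [Field k] [Ring B] [Algebra k B] {ℬ : ℤ → Submodule k B}
  [GradedAlgebra ℬ] [ConnectedGraded ℬ] {m : ℕ} {y : Fin m → B} (Q : PureMinimalResolution ℬ y)

theorem augmentation_padMat_mulVec : ∀ (i : ℕ) (w : Fin (padRank Q.rank i) → B)
    (a : Fin (Q.rank i)), augmentation ℬ ((padMat Q.mat i).mulVec w a) = 0
  | 0, w, a => map_zero _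
  | i + 1, w, a => by
    change augmentation ℬ (∑ b, Q.mat i a b * w b) = 0
    rw [map_sum]
    exact Finset.sum_eq_zero fun b _ => by rw [map_mul, Q.minimal, zero_mul]

theorem augmentation_eq_zero_of_mem_bdry {i : ℕ} {j : ℤ} {x : Fin (Q.rank i) → B}
    (hx : x ∈ Q.toSplitResolution.bdry i j) (a : Fin (Q.rank i)) : augmentation ℬ (x a) = 0 := by
  obtain ⟨w, _, rfl⟩ := (Q.toSplitResolution.mem_bdry_iff i j x).1 hx
  exact Q.augmentation_padMat_mulVec i w a

variable {hB : ℕ} {lB : ℤ} (hreg : IsASRegular ℬ hB lB)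
include hreg

theorem mulVec_top_eq_zero (x : Fin (Q.rank hB) → B) : (Q.mat hB).mulVec x = 0 := by
  have h := Q.rank_eq_zero hreg.globalDimension_eq (hB + 1) (Nat.lt_succ_self _)
  exact funext fun a => (h ▸ a : Fin 0).elim0

theorem rank_top_ne_zero : Q.rank hB ≠ 0 := by
  intro h
  have hs : Subsingleton (uExt ℬ (trivialGrading ℬ) ℬ hB (-lB)) := by
    rw [subsingleton_uExt_iff]
    intro f hf
    refine Q.toSplitResolution.mem_extCoboundaries hf ?_
    have : Q.toSplitResolution.evalAug hB f = 0 := funext fun a => (h ▸ a : Fin 0).elim0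
    rw [this]
    exact zero_mem _
  obtain ⟨e⟩ := hreg.ext_eq
  have := e.symm.toEquiv.subsingleton
  exact not_subsingleton k this

/-- The classes in `\underline{Ext}^{hB}(k, B)` of the basis vectors of the last term are linearly
independent, since the differentials vanish under the augmentation. -/
theorem exists_surjective_uExt : ∃ Λ : uExt ℬ (trivialGrading ℬ) ℬ hB (-Q.deg hB) →ₗ[k]
    (Fin (Q.rank hB) → k), Function.Surjective Λ := by
  let ev : extCocycles ℬ (trivialGrading ℬ) ℬ hB (-Q.deg hB) →ₗ[k] (Fin (Q.rank hB) → k) :=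
    (LinearMap.pi fun a => (augmentation ℬ).toLinearMap ∘ₗ LinearMap.proj a) ∘ₗ
      Q.toSplitResolution.evalAug hB ∘ₗ Submodule.subtype _
  refine ⟨Submodule.liftQ _ ev fun f hf => ?_, ?_⟩
  · funext a
    exact Q.augmentation_eq_zero_of_mem_bdry (Q.toSplitResolution.evalAug_mem_bdry hf) a
  · intro c
    obtain ⟨f, hf, hfe⟩ := Q.toSplitResolution.exists_evalAug_sub_mem (q := hB) (j := -Q.deg hB)
      (x := fun a => algebraMap k B (c a)) (mem_vecGrading.2 fun a => by
        change _ ∈ ℬ (Q.deg hB + -Q.deg hB)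
        rw [add_neg_cancel]
        exact SetLike.algebraMap_mem_graded ℬ _) (Q.mulVec_top_eq_zero hreg _)
    refine ⟨Submodule.Quotient.mk ⟨f, hf⟩, funext fun a => ?_⟩
    have h := Q.augmentation_eq_zero_of_mem_bdry hfe a
    change augmentation ℬ (Q.toSplitResolution.evalAug hB f a - algebraMap k B (c a)) = 0 at h
    rw [map_sub, AlgHom.commutes, sub_eq_zero] at h
    exact h

theorem deg_top : Q.deg hB = lB := by
  by_contra hne
  obtain ⟨Λ, hΛ⟩ := Q.exists_surjective_uExt hreg
  have := hreg.ext_eq_zero hB (-Q.deg hB) (fun h => hne (neg_injective h.2))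
  have hs : Subsingleton (Fin (Q.rank hB) → k) := hΛ.subsingleton
  have a : Fin (Q.rank hB) := ⟨0, Nat.pos_of_ne_zero (Q.rank_top_ne_zero hreg)⟩
  exact one_ne_zero (congrFun (hs.elim (fun _ => (1 : k)) 0) a)

theorem rank_top : Q.rank hB = 1 := by
  obtain ⟨Λ, hΛ⟩ := Q.exists_surjective_uExt hreg
  obtain ⟨e⟩ := hreg.ext_eq
  rw [← Q.deg_top hreg] at e
  have h := LinearMap.finrank_le_finrank_of_surjective (f := Λ ∘ₗ e.symm.toLinearMap)
    (hΛ.comp e.symm.surjective)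
  rw [Module.finrank_fin_fun, Module.finrank_self] at h
  have := Q.rank_top_ne_zero hreg
  omega

/-- Homogeneous exactness of the complex of column vectors. -/
theorem exists_padMat_mulVec_eq {i : ℕ} {e : ℤ} {x : Fin (Q.rank i) → B}
    (hx : x ∈ vecGrading ℬ _ e) (hx0 : (Q.mat i).mulVec x = 0) (hne : ¬ (i = hB ∧ e = 0)) :
    ∃ w, (padMat Q.mat i).mulVec w = x := by
  obtain ⟨f, hf, hfe⟩ := Q.toSplitResolution.exists_evalAug_sub_mem (q := i) (j := e - Q.deg i)
    (x := x) (by change x ∈ vecGrading ℬ _ (Q.deg i + (e - Q.deg i)); rwa [add_sub_cancel]) hx0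
  have hs := hreg.ext_eq_zero i (e - Q.deg i) (by
    rintro ⟨rfl, h⟩
    rw [Q.deg_top hreg] at h
    exact hne ⟨rfl, by omega⟩)
  have hfb := Q.toSplitResolution.evalAug_mem_bdry (subsingleton_uExt_iff.1 hs f hf)
  have hxb : x ∈ Q.toSplitResolution.bdry i (e - Q.deg i) :=
    sub_sub_cancel (Q.toSplitResolution.evalAug i f) x ▸ sub_mem hfb hfe
  obtain ⟨w, _, hw⟩ := (Q.toSplitResolution.mem_bdry_iff _ _ _).1 hxb
  exact ⟨w, hw⟩

omit hreg

/-- Left multiplication of column vectors by `padMat Q.mat i`. -/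
def colMap (i : ℕ) : (Fin (padRank Q.rank i) → B) →ₗ[k] (Fin (Q.rank i) → B) :=
  SplitComplex.mulVecHom k (padMat Q.mat i)

theorem colMap_mem (i : ℕ) (e : ℤ) (x : Fin (padRank Q.rank i) → B) (hx : x ∈ vecGrading ℬ _ e) :
    Q.colMap i x ∈ vecGrading ℬ _ (e + (Q.deg i - padDeg Q.deg i)) :=
  mulVec_mem_vecGrading (padMat_mem Q.homogeneous i) hx (add_comm _ _)

/-- A homogeneous generalised inverse of `colMap i`. -/
noncomputable def colInv (i : ℕ) : (Fin (Q.rank i) → B) →ₗ[k] (Fin (padRank Q.rank i) → B) :=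
  (exists_graded_generalizedInverse ℬ (Q.colMap i) (Q.colMap_mem i)).choose

theorem colInv_mem (i : ℕ) (e : ℤ) (x : Fin (Q.rank i) → B) (hx : x ∈ vecGrading ℬ _ e) :
    Q.colInv i x ∈ vecGrading ℬ _ (e + -(Q.deg i - padDeg Q.deg i)) :=
  (exists_graded_generalizedInverse ℬ (Q.colMap i) (Q.colMap_mem i)).choose_spec.1 e x hx

theorem colMap_colInv_colMap (i : ℕ) (x : Fin (padRank Q.rank i) → B) :
    Q.colMap i (Q.colInv i (Q.colMap i x)) = Q.colMap i x :=
  LinearMap.congr_fun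
    (exists_graded_generalizedInverse ℬ (Q.colMap i) (Q.colMap_mem i)).choose_spec.2 x

/-- Left multiplication of column vectors by `Q.mat i`. -/
def colNext (i : ℕ) : (Fin (Q.rank i) → B) →ₗ[k] (Fin (Q.rank (i + 1)) → B) := Q.colMap (i + 1)

/-- A homogeneous generalised inverse of `colNext i`. -/
noncomputable def colNextInv (i : ℕ) : (Fin (Q.rank (i + 1)) → B) →ₗ[k] (Fin (Q.rank i) → B) :=
  Q.colInv (i + 1)

theorem augProj_mem {s : ℕ} (e : ℤ) (x : Fin s → B) (hx : x ∈ vecGrading ℬ _ e) :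
    augProj ℬ s x ∈ vecGrading ℬ _ e := by
  rw [mem_vecGrading] at hx ⊢
  intro a
  rw [augProj_apply]
  by_cases he : e = 0
  · subst he; exact SetLike.algebraMap_mem_graded ℬ _
  · rw [augmentation_eq_zero ℬ he (hx a), map_zero]; exact zero_mem _

theorem sub_augProj_eq_zero {s : ℕ} (x : Fin s → B) (hx : x ∈ vecGrading ℬ _ 0) :
    x - augProj ℬ s x = 0 := by
  funext a
  have h := mem_vecGrading.1 hx a
  rw [ConnectedGraded.zero (𝒜 := ℬ)] at h
  obtain ⟨c, hc⟩ := Submodule.mem_one.1 h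
  rw [Pi.sub_apply, augProj_apply, ← hc, AlgHom.commutes]
  exact sub_self _

include hreg

/-- Exactness of the complex of column vectors away from `hB`. -/
theorem colMap_exact {i : ℕ} (hi : i ≠ hB) (x : Fin (Q.rank i) → B) :
    Q.colMap i (Q.colInv i (x - (Q.colNextInv i ∘ₗ Q.colNext i) x)) =
      x - (Q.colNextInv i ∘ₗ Q.colNext i) x := by
  have key : Q.colMap i ∘ₗ Q.colInv i ∘ₗ (LinearMap.id - Q.colNextInv i ∘ₗ Q.colNext i) =
      LinearMap.id - Q.colNextInv i ∘ₗ Q.colNext i := by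
    refine linearMap_ext_of_vecGrading ℬ fun e x hx => ?_
    have h1 : x - (Q.colNextInv i ∘ₗ Q.colNext i) x ∈ vecGrading ℬ _ e := by
      refine sub_mem hx ?_
      have := Q.colInv_mem (i + 1) _ _ (Q.colMap_mem (i + 1) e x hx)
      rwa [add_neg_cancel_right] at this
    obtain ⟨w, hw⟩ := Q.exists_padMat_mulVec_eq hreg h1 (by
      change Q.colNext i (x - Q.colNextInv i (Q.colNext i x)) = 0
      exact (map_sub _ _ _).trans (sub_eq_zero.2 (Q.colMap_colInv_colMap (i + 1) x).symm))
      (fun h => hi h.1)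
    rw [LinearMap.comp_apply, LinearMap.comp_apply, LinearMap.sub_apply, LinearMap.id_apply, ← hw]
    exact Q.colMap_colInv_colMap i w
  exact LinearMap.congr_fun key x

/-- The cokernel of the last differential of the complex of column vectors is the trivial module,
through the augmentation. -/
theorem colMap_exact_top (x : Fin (Q.rank hB) → B) :
    Q.colMap hB (Q.colInv hB (x - augProj ℬ _ x)) = x - augProj ℬ _ x := by
  have key : Q.colMap hB ∘ₗ Q.colInv hB ∘ₗ (LinearMap.id - augProj ℬ (Q.rank hB)) =
      LinearMap.id - augProj ℬ (Q.rank hB) := by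
    refine linearMap_ext_of_vecGrading ℬ fun e x hx => ?_
    have h1 : x - augProj ℬ _ x ∈ vecGrading ℬ _ e := sub_mem hx (augProj_mem e x hx)
    by_cases he : e = 0
    · subst he
      rw [LinearMap.comp_apply, LinearMap.comp_apply, LinearMap.sub_apply, LinearMap.id_apply,
        sub_augProj_eq_zero x hx, map_zero, map_zero]
    · obtain ⟨w, hw⟩ := Q.exists_padMat_mulVec_eq hreg h1 (Q.mulVec_top_eq_zero hreg _)
        (fun h => he h.2)
      rw [LinearMap.comp_apply, LinearMap.comp_apply, LinearMap.sub_apply, LinearMap.id_apply,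
        ← hw]
      exact Q.colMap_colInv_colMap hB w
  exact LinearMap.congr_fun key x

end PureMinimalResolution

/-! ### Bigraded structure of the twisted tensor product -/

section Generation

variable {k B : Type*} [Field k] [Ring B] [Algebra k B]

/-- A graded subalgebra which contains homogeneous generators is everything. -/
theorem eq_of_graded_generation (ℬ : ℤ → Submodule k B) [GradedAlgebra ℬ] {m : ℕ} {y : Fin m → B}
    (hy : Algebra.adjoin k (Set.range y) = ⊤) {l : ℤ} (P : ℤ → Submodule k B)
    (hP : ∀ n, P n ≤ ℬ n) (h1 : 1 ∈ P 0) (hmul : ∀ n n', P n * P n' ≤ P (n + n'))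
    (hyP : ∀ i, y i ∈ P l) (n : ℤ) : ℬ n ≤ P n := by
  have hS : (⨆ n, P n) * (⨆ n, P n) ≤ ⨆ n, P n := by
    rw [Submodule.iSup_mul]
    refine iSup_le fun i => ?_
    rw [Submodule.mul_iSup]
    exact iSup_le fun j => (hmul i j).trans (le_iSup P (i + j))
  have htop (b : B) : b ∈ ⨆ n, P n := by
    have hb : b ∈ Algebra.adjoin k (Set.range y) := by rw [hy]; trivial
    induction hb using Algebra.adjoin_induction with
    | mem b hb =>
      obtain ⟨i, rfl⟩ := hb
      exact Submodule.mem_iSup_of_mem l (hyP i)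
    | algebraMap c =>
      rw [Algebra.algebraMap_eq_smul_one]
      exact Submodule.smul_mem _ _ (Submodule.mem_iSup_of_mem 0 h1)
    | add b b' _ _ h h' => exact add_mem h h'
    | mul b b' _ _ h h' => exact hS (Submodule.mul_mem_mul h h')
  have hproj : (⨆ i, P i) ≤ (P n).comap (GradedAlgebra.proj ℬ n) := by
    refine iSup_le fun i b hb => ?_
    rw [Submodule.mem_comap, GradedAlgebra.proj_apply]
    by_cases hi : i = n
    · subst hi
      rwa [DirectSum.decompose_of_mem_same ℬ (hP i hb)]
    · rw [DirectSum.decompose_of_mem_ne ℬ (hP i hb) hi]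
      exact zero_mem _
  intro b hb
  have := hproj (htop b)
  rwa [Submodule.mem_comap, GradedAlgebra.proj_apply, DirectSum.decompose_of_mem_same ℬ hb] at this

end Generation

namespace TwistedTensor

variable {k A B : Type*} [Field k] [Ring A] [Algebra k A] [Ring B] [Algebra k B]
  {𝒜 : ℤ → Submodule k A} {ℬ : ℤ → Submodule k B} (T : GradedTwistingMap 𝒜 ℬ)

theorem tmul_eq (a : A) (b : B) : tmul T a b = ιA T a * ιB T b := by
  rw [mul_def]
  change _ = twistedMul T.τ (a ⊗ₜ 1) (1 ⊗ₜ b)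
  rw [twistedMul_tmul, τ_one_tmul]
  simp [tmul]

theorem ιB_mul_ιA (b : B) (a : A) :
    ιB T b * ιA T a = (T.τ (b ⊗ₜ a) : A ⊗[k] B) := by
  rw [mul_def]
  change twistedMul T.τ (1 ⊗ₜ b) (a ⊗ₜ 1) = _
  rw [twistedMul_tmul, LinearMap.mulLeft_one, LinearMap.mulRight_one, TensorProduct.map_id]
  rfl

/-- The span of the products `a b`, for `a` and `b` homogeneous of degrees `d` and `n`. -/
noncomputable def bigrading (d n : ℤ) : Submodule k (TwistedTensor T) :=
  (𝒜 d).map (ιA T).toLinearMap * (ℬ n).map (ιB T).toLinearMap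

/-- The span of the products `b a`, for `a` and `b` homogeneous of degrees `d` and `n`. -/
noncomputable def bigradingRev (n d : ℤ) : Submodule k (TwistedTensor T) :=
  (ℬ n).map (ιB T).toLinearMap * (𝒜 d).map (ιA T).toLinearMap

variable {T}

theorem mem_bigrading {d n : ℤ} {a : A} {b : B} (ha : a ∈ 𝒜 d) (hb : b ∈ ℬ n) :
    ιA T a * ιB T b ∈ bigrading T d n :=
  Submodule.mul_mem_mul (Submodule.mem_map_of_mem ha) (Submodule.mem_map_of_mem hb)

theorem mem_bigradingRev {d n : ℤ} {a : A} {b : B} (ha : a ∈ 𝒜 d) (hb : b ∈ ℬ n) :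
    ιB T b * ιA T a ∈ bigradingRev T n d :=
  Submodule.mul_mem_mul (Submodule.mem_map_of_mem hb) (Submodule.mem_map_of_mem ha)

theorem bigrading_le {d n : ℤ} {P : Submodule k (TwistedTensor T)} :
    bigrading T d n ≤ P ↔ ∀ a ∈ 𝒜 d, ∀ b ∈ ℬ n, ιA T a * ιB T b ∈ P := by
  refine ⟨fun h a ha b hb => h (mem_bigrading ha hb), fun h => Submodule.mul_le.2 ?_⟩
  rintro _ ⟨a, ha, rfl⟩ _ ⟨b, hb, rfl⟩
  exact h a ha b hb

theorem bigradingRev_le {d n : ℤ} {P : Submodule k (TwistedTensor T)} :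
    bigradingRev T n d ≤ P ↔ ∀ b ∈ ℬ n, ∀ a ∈ 𝒜 d, ιB T b * ιA T a ∈ P := by
  refine ⟨fun h b hb a ha => h (mem_bigradingRev ha hb), fun h => Submodule.mul_le.2 ?_⟩
  rintro _ ⟨b, hb, rfl⟩ _ ⟨a, ha, rfl⟩
  exact h b hb a ha

theorem grading_eq (e : ℤ) : grading T e = ⨆ i, bigrading T i (e - i) := by
  refine le_antisymm (iSup_mono fun i => ?_) (iSup_mono fun i => ?_)
  · refine Submodule.map₂_le.2 fun a ha b hb => ?_
    have := mem_bigrading (T := T) ha hb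
    rw [← tmul_eq] at this
    exact this
  · refine bigrading_le.2 fun a ha b hb => ?_
    rw [← tmul_eq]
    exact Submodule.apply_mem_map₂ (TensorProduct.mk k A B) ha hb

theorem bigrading_le_grading {d n e : ℤ} (h : d + n = e) : bigrading T d n ≤ grading T e := by
  rw [grading_eq]
  refine le_iSup_of_le d ?_
  rw [show e - d = n by omega]

theorem map_mul_map_le [GradedAlgebra 𝒜] (d d' : ℤ) :
    (𝒜 d).map (ιA T).toLinearMap * (𝒜 d').map (ιA T).toLinearMap ≤
      (𝒜 (d + d')).map (ιA T).toLinearMap := by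
  rw [← Submodule.map_mul]
  exact Submodule.map_mono (Submodule.mul_le.2 fun a ha b hb => SetLike.mul_mem_graded ha hb)

theorem mapB_mul_mapB_le [GradedAlgebra ℬ] (d d' : ℤ) :
    (ℬ d).map (ιB T).toLinearMap * (ℬ d').map (ιB T).toLinearMap ≤
      (ℬ (d + d')).map (ιB T).toLinearMap := by
  rw [← Submodule.map_mul]
  exact Submodule.map_mono (Submodule.mul_le.2 fun a ha b hb => SetLike.mul_mem_graded ha hb)

theorem ιA_mem_grading [GradedAlgebra ℬ] {e : ℤ} {a : A} (ha : a ∈ 𝒜 e) : ιA T a ∈ grading T e := by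
  refine bigrading_le_grading (add_zero e) ?_
  have := mem_bigrading (T := T) ha (SetLike.GradedOne.one_mem (A := ℬ))
  rwa [map_one, mul_one] at this

theorem ιB_mem_grading [GradedAlgebra 𝒜] {e : ℤ} {b : B} (hb : b ∈ ℬ e) : ιB T b ∈ grading T e := by
  refine bigrading_le_grading (zero_add e) ?_
  have := mem_bigrading (T := T) (SetLike.GradedOne.one_mem (A := 𝒜)) hb
  rwa [map_one, one_mul] at this

end TwistedTensor

namespace DiagonalTwistingMap

open TwistedTensor

variable {k A B : Type*} [Field k] [Ring A] [Algebra k A] [Ring B] [Algebra k B]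
  {𝒜 : ℤ → Submodule k A} [GradedAlgebra 𝒜] {ℬ : ℤ → Submodule k B} [GradedAlgebra ℬ]
  {m : ℕ} {y : Fin m → B} (D : DiagonalTwistingMap 𝒜 ℬ y) {l : ℤ} (hl : ∀ i, y i ∈ ℬ l)

include hl

theorem bigradingRev_le_bigrading (n d : ℤ) :
    bigradingRev D.toGradedTwistingMap n d ≤ bigrading D.toGradedTwistingMap d n := by
  let T := D.toGradedTwistingMap
  let P (n : ℤ) : Submodule k B := ℬ n ⊓
    { carrier := {b | ∀ d, ∀ a ∈ 𝒜 d, ιB T b * ιA T a ∈ bigrading T d n}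
      add_mem' := fun hb hb' d a ha => by
        rw [map_add, add_mul]; exact add_mem (hb d a ha) (hb' d a ha)
      zero_mem' := fun d a _ => by rw [map_zero, zero_mul]; exact zero_mem _
      smul_mem' := fun c b hb d a ha => by
        rw [map_smul, smul_mul_assoc]; exact Submodule.smul_mem _ _ (hb d a ha) }
  refine bigradingRev_le.2 fun b hb => (eq_of_graded_generation ℬ D.generating.adjoin_eq_top P
    (fun n => inf_le_left) ⟨SetLike.GradedOne.one_mem, fun d a ha => ?_⟩ (fun n n' => ?_)
    (fun i => ⟨hl i, fun d a ha => ?_⟩) n hb).2 d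
  · have := mem_bigrading (T := T) ha (SetLike.GradedOne.one_mem (A := ℬ))
    rw [map_one, mul_one] at this
    rwa [map_one, one_mul]
  · refine Submodule.mul_le.2 fun b hb b' hb' =>
      ⟨SetLike.mul_mem_graded hb.1 hb'.1, fun d a ha => ?_⟩
    rw [map_mul, mul_assoc]
    have h1 : bigrading T d n' ≤ (bigrading T d (n + n')).comap (LinearMap.mulLeft k (ιB T b)) := by
      refine bigrading_le.2 fun a ha b' hb' => ?_
      rw [Submodule.mem_comap, LinearMap.mulLeft_apply, ← mul_assoc]
      have h2 : bigrading T d n * (ℬ n').map (ιB T).toLinearMap ≤ bigrading T d (n + n') := by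
        rw [bigrading, mul_assoc]
        exact mul_le_mul_right (mapB_mul_mapB_le n n') _
      exact h2 (Submodule.mul_mem_mul (hb.2 d a ha) (Submodule.mem_map_of_mem hb'))
    exact h1 (hb'.2 d a ha)
  · rw [ιB_mul_ιA]
    have h : (D.τ (y i ⊗ₜ a) : A ⊗[k] B) = ∑ t, tmul T (D.σ a i t) (y t) := D.τ_tmul i a
    rw [h]
    refine sum_mem fun t _ => ?_
    rw [tmul_eq]
    exact mem_bigrading (D.σ_graded d a ha i t) (hl t)

theorem bigrading_le_bigradingRev (hσ : IsInvertibleMatrixHom 𝒜 D.σ) (d n : ℤ) :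
    bigrading D.toGradedTwistingMap d n ≤ bigradingRev D.toGradedTwistingMap n d := by
  let T := D.toGradedTwistingMap
  obtain ⟨ψ, hψ, -, hψσ⟩ := hσ
  let P (n : ℤ) : Submodule k B := ℬ n ⊓
    { carrier := {b | ∀ d, ∀ a ∈ 𝒜 d, ιA T a * ιB T b ∈ bigradingRev T n d}
      add_mem' := fun hb hb' d a ha => by
        rw [map_add, mul_add]; exact add_mem (hb d a ha) (hb' d a ha)
      zero_mem' := fun d a _ => by rw [map_zero, mul_zero]; exact zero_mem _
      smul_mem' := fun c b hb d a ha => by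
        rw [map_smul, mul_smul_comm]; exact Submodule.smul_mem _ _ (hb d a ha) }
  refine bigrading_le.2 fun a ha b hb => (eq_of_graded_generation ℬ D.generating.adjoin_eq_top P
    (fun n => inf_le_left) ⟨SetLike.GradedOne.one_mem, fun d a ha => ?_⟩ (fun n n' => ?_)
    (fun t => ⟨hl t, fun d a ha => ?_⟩) n hb).2 d a ha
  · have := mem_bigradingRev (T := T) ha (SetLike.GradedOne.one_mem (A := ℬ))
    rw [map_one, one_mul] at this
    rwa [map_one, mul_one]
  · refine Submodule.mul_le.2 fun b hb b' hb' =>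
      ⟨SetLike.mul_mem_graded hb.1 hb'.1, fun d a ha => ?_⟩
    rw [map_mul, ← mul_assoc]
    have h1 : bigradingRev T n d ≤
        (bigradingRev T (n + n') d).comap (LinearMap.mulRight k (ιB T b')) := by
      refine bigradingRev_le.2 fun b hb a ha => ?_
      rw [Submodule.mem_comap, LinearMap.mulRight_apply, mul_assoc]
      have h2 : (ℬ n).map (ιB T).toLinearMap * bigradingRev T n' d ≤ bigradingRev T (n + n') d := by
        rw [bigradingRev, ← mul_assoc]
        exact mul_le_mul_left (mapB_mul_mapB_le n n') _
      exact h2 (Submodule.mul_mem_mul (Submodule.mem_map_of_mem hb) (hb'.2 d a ha))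
    exact h1 (hb.2 d a ha)
  · -- `a yₜ = ∑ᵢ yᵢ ψᵢₜ(a)` by the second identity defining the inverse `ψ` of `σ`
    have h : ιA T a * ιB T (y t) = ∑ i, ιB T (y i) * ιA T (ψ a i t) := by
      have h1 (i) : ιB T (y i) * ιA T (ψ a i t) = ∑ s, ιA T (D.σ (ψ a i t) i s) * ιB T (y s) := by
        rw [ιB_mul_ιA]
        refine (D.τ_tmul i (ψ a i t)).trans ?_
        exact Finset.sum_congr rfl fun s _ => tmul_eq T _ _
      have h2 (s) : ∑ i, ιA T (D.σ (ψ a i t) i s) * ιB T (y s) =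
          ιA T (if t = s then a else 0) * ιB T (y s) := by
        rw [← Finset.sum_mul, ← map_sum, hψσ t s a]
      rw [Finset.sum_congr rfl fun i _ => h1 i, Finset.sum_comm,
        Finset.sum_congr rfl fun s _ => h2 s, Finset.sum_eq_single t, if_pos rfl]
      · intro s _ hs
        rw [if_neg hs.symm, map_zero, zero_mul]
      · simp
    rw [h]
    exact sum_mem fun i _ => mem_bigradingRev (hψ d a ha i t) (hl i)

theorem bigrading_mul_bigrading_le (d n d' n' : ℤ) :
    bigrading D.toGradedTwistingMap d n * bigrading D.toGradedTwistingMap d' n' ≤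
      bigrading D.toGradedTwistingMap (d + d') (n + n') := by
  let T := D.toGradedTwistingMap
  have h : (ℬ n).map (ιB T).toLinearMap * bigrading T d' n' ≤
      (𝒜 d').map (ιA T).toLinearMap * (ℬ (n + n')).map (ιB T).toLinearMap := by
    rw [bigrading, ← mul_assoc]
    refine (mul_le_mul_left (D.bigradingRev_le_bigrading hl n d') _).trans ?_
    rw [bigrading, mul_assoc]
    exact mul_le_mul_right (mapB_mul_mapB_le n n') _
  calc bigrading T d n * bigrading T d' n'
      = (𝒜 d).map (ιA T).toLinearMap * ((ℬ n).map (ιB T).toLinearMap * bigrading T d' n') := by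
        rw [bigrading, mul_assoc]
    _ ≤ (𝒜 d).map (ιA T).toLinearMap *
        ((𝒜 d').map (ιA T).toLinearMap * (ℬ (n + n')).map (ιB T).toLinearMap) :=
        mul_le_mul_right h _
    _ ≤ _ := by
        rw [← mul_assoc]
        exact mul_le_mul_left (map_mul_map_le d d') _

theorem gradedMonoid_grading : SetLike.GradedMonoid (grading D.toGradedTwistingMap) where
  one_mem := by
    have := ιA_mem_grading (T := D.toGradedTwistingMap) (SetLike.GradedOne.one_mem (A := 𝒜))
    rwa [map_one] at this
  mul_mem i j x z hx hz := by
    suffices h : grading D.toGradedTwistingMap i * grading D.toGradedTwistingMap j ≤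
      grading D.toGradedTwistingMap (i + j) from h (Submodule.mul_mem_mul hx hz)
    rw [grading_eq, grading_eq, Submodule.iSup_mul]
    refine iSup_le fun d => ?_
    rw [Submodule.mul_iSup]
    exact iSup_le fun d' => (D.bigrading_mul_bigrading_le hl _ _ _ _).trans
      (bigrading_le_grading (by ring))

end DiagonalTwistingMap

/-! ### Bijectivity of the twisting map -/

section LocallyFinite

variable {k V ι : Type*} [Field k] [AddCommGroup V] [Module k V]

/-- An endomorphism which maps each member of a spanning family of finite-dimensional subspaces
onto itself is bijective. -/
theorem bijective_of_map_eq (θ : V →ₗ[k] V) (W : ι → Submodule k V)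
    (hfin : ∀ i, FiniteDimensional k (W i)) (hW : ∀ i, (W i).map θ = W i) (htop : ⨆ i, W i = ⊤) :
    Function.Bijective θ := by
  have hJ (J : Finset ι) : (⨆ i ∈ J, W i).map θ = ⨆ i ∈ J, W i := by
    simp only [Submodule.map_iSup, hW]
  have hx (x : V) : ∃ J : Finset ι, x ∈ ⨆ i ∈ J, W i :=
    Submodule.mem_iSup_iff_exists_finset.1 (htop ▸ Submodule.mem_top)
  constructor
  · rw [injective_iff_map_eq_zero]
    intro x h0
    obtain ⟨J, hJx⟩ := hx x
    have : FiniteDimensional k (⨆ i ∈ J, W i : Submodule k V) := by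
      rw [← Finset.sup_eq_iSup]; infer_instance
    let θ' := θ.restrict (p := ⨆ i ∈ J, W i) (q := ⨆ i ∈ J, W i)
      (fun z hz => by have := Submodule.mem_map_of_mem (f := θ) hz; rwa [hJ] at this)
    have hs : Function.Surjective θ' := by
      rintro ⟨z, hz⟩
      rw [← hJ] at hz
      obtain ⟨w, hw, rfl⟩ := hz
      exact ⟨⟨w, hw⟩, rfl⟩
    have hi := LinearMap.injective_iff_surjective.2 hs
    have h1 : θ' ⟨x, hJx⟩ = 0 := Subtype.ext h0
    exact congrArg Subtype.val ((injective_iff_map_eq_zero _).1 hi _ h1)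
  · intro x
    obtain ⟨J, hJx⟩ := hx x
    rw [← hJ] at hJx
    obtain ⟨w, _, rfl⟩ := hJx
    exact ⟨w, rfl⟩

end LocallyFinite

namespace TwistedTensor

variable {k A B : Type*} [Field k] [Ring A] [Algebra k A] [Ring B] [Algebra k B]
  {𝒜 : ℤ → Submodule k A} {ℬ : ℤ → Submodule k B} (T : GradedTwistingMap 𝒜 ℬ)

/-- The identification `a ⊗ b ↦ a b` of `A ⊗ B` with the twisted tensor product. -/
noncomputable def ofTensor : A ⊗[k] B ≃ₗ[k] TwistedTensor T := LinearEquiv.refl k (A ⊗[k] B)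

theorem ofTensor_tmul (a : A) (b : B) : ofTensor T (a ⊗ₜ b) = ιA T a * ιB T b := by
  rw [← tmul_eq]
  rfl

/-- The map `b ⊗ a ↦ b a` from `B ⊗ A` to the twisted tensor product. -/
noncomputable def ofTensorRev : B ⊗[k] A →ₗ[k] TwistedTensor T :=
  (ofTensor T).toLinearMap ∘ₗ T.τ

theorem ofTensorRev_tmul (b : B) (a : A) : ofTensorRev T (b ⊗ₜ a) = ιB T b * ιA T a := by
  rw [ιB_mul_ιA]
  rfl

theorem map_ofTensorRev (n d : ℤ) :
    (Submodule.map₂ (TensorProduct.mk k B A) (ℬ n) (𝒜 d)).map (ofTensorRev T) =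
      bigradingRev T n d := by
  refine le_antisymm ?_ ?_
  · rw [Submodule.map_le_iff_le_comap]
    refine Submodule.map₂_le.2 fun b hb a ha => ?_
    rw [Submodule.mem_comap, TensorProduct.mk_apply, ofTensorRev_tmul]
    exact mem_bigradingRev ha hb
  · refine bigradingRev_le.2 fun b hb a ha => ?_
    rw [← ofTensorRev_tmul]
    exact Submodule.mem_map_of_mem (Submodule.apply_mem_map₂ (TensorProduct.mk k B A) hb ha)

theorem map_comm_bigrading (n d : ℤ) :
    (bigrading T d n).map
      ((TensorProduct.comm k A B).toLinearMap ∘ₗ (ofTensor T).symm.toLinearMap) =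
    Submodule.map₂ (TensorProduct.mk k B A) (ℬ n) (𝒜 d) := by
  have h (a : A) (b : B) : ((TensorProduct.comm k A B).toLinearMap ∘ₗ (ofTensor T).symm.toLinearMap)
      (ιA T a * ιB T b) = b ⊗ₜ a := by
    rw [← ofTensor_tmul]
    change TensorProduct.comm k A B ((ofTensor T).symm (ofTensor T (a ⊗ₜ b))) = _
    rw [LinearEquiv.symm_apply_apply]
    rfl
  refine le_antisymm ?_ ?_
  · rw [Submodule.map_le_iff_le_comap]
    refine bigrading_le.2 fun a ha b hb => ?_
    rw [Submodule.mem_comap, h]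
    exact Submodule.apply_mem_map₂ (TensorProduct.mk k B A) hb ha
  · refine Submodule.map₂_le.2 fun b hb a ha => ?_
    rw [TensorProduct.mk_apply, ← h]
    exact Submodule.mem_map_of_mem (mem_bigrading ha hb)

end TwistedTensor

namespace DiagonalTwistingMap

open TwistedTensor

variable {k A B : Type*} [Field k] [Ring A] [Algebra k A] [Ring B] [Algebra k B]
  {𝒜 : ℤ → Submodule k A} [GradedAlgebra 𝒜] {ℬ : ℤ → Submodule k B} [GradedAlgebra ℬ]
  [ConnectedGraded 𝒜] [ConnectedGraded ℬ]
  {m : ℕ} {y : Fin m → B} (D : DiagonalTwistingMap 𝒜 ℬ y) {l : ℤ}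

omit [ConnectedGraded 𝒜] [ConnectedGraded ℬ] in
theorem iSup_map₂_eq_top :
    ⨆ p : ℤ × ℤ, Submodule.map₂ (TensorProduct.mk k B A) (ℬ p.1) (𝒜 p.2) = ⊤ := by
  rw [← TensorProduct.map₂_mk_top_top_eq_top,
    ← (DirectSum.Decomposition.isInternal ℬ).submodule_iSup_eq_top,
    ← (DirectSum.Decomposition.isInternal 𝒜).submodule_iSup_eq_top,
    Submodule.map₂_iSup_left]
  simp only [Submodule.map₂_iSup_right, iSup_prod]

/-- Since `σ` is invertible, `b ⊗ a ↦ b a` maps `Bₙ ⊗ A_d` onto `A_d ⊗ Bₙ`; these spaces have the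
same finite dimension, so that the map is bijective. -/
theorem ofTensorRev_bijective (hl : ∀ i, y i ∈ ℬ l) (hσ : IsInvertibleMatrixHom 𝒜 D.σ) :
    Function.Bijective (ofTensorRev D.toGradedTwistingMap) := by
  have h := bijective_of_map_eq ((TensorProduct.comm k A B).toLinearMap ∘ₗ
      (ofTensor D.toGradedTwistingMap).symm.toLinearMap ∘ₗ ofTensorRev D.toGradedTwistingMap)
    (fun p : ℤ × ℤ => Submodule.map₂ (TensorProduct.mk k B A) (ℬ p.1) (𝒜 p.2))
    (fun p => Module.Finite.iff_fg.2 (Submodule.FG.map₂ _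
      (Module.Finite.iff_fg.1 (ConnectedGraded.finite p.1))
      (Module.Finite.iff_fg.1 (ConnectedGraded.finite p.2))))
    (fun p => by
      rw [← LinearMap.comp_assoc, Submodule.map_comp, map_ofTensorRev,
        le_antisymm (D.bigradingRev_le_bigrading hl p.1 p.2)
          (D.bigrading_le_bigradingRev hl hσ p.2 p.1), map_comm_bigrading])
    iSup_map₂_eq_top
  rwa [LinearMap.coe_comp, LinearMap.coe_comp, LinearEquiv.coe_coe, LinearEquiv.coe_coe,
    Function.Bijective.of_comp_iff' (TensorProduct.comm k A B).bijective,
    Function.Bijective.of_comp_iff' (ofTensor D.toGradedTwistingMap).symm.bijective] at h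

/-! ### Endomorphisms of `B` acting on the twisted tensor product -/

/-- The action of `End B` on `A ⊗ B` through the second factor. -/
noncomputable def rowHom :
    Module.End k B →ₐ[k] Module.End k (TwistedTensor D.toGradedTwistingMap) :=
  ((ofTensor D.toGradedTwistingMap).conjAlgEquiv k).toAlgHom.comp
    (Module.End.lTensorAlgHom k B A)

theorem rowHom_apply (S : Module.End k B) (a : A) (b : B) :
    D.rowHom S (ιA D.toGradedTwistingMap a * ιB D.toGradedTwistingMap b) =
      ιA D.toGradedTwistingMap a * ιB D.toGradedTwistingMap (S b) := by
  rw [← ofTensor_tmul, ← ofTensor_tmul]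
  change ofTensor _ (LinearMap.lTensor A S ((ofTensor _).symm (ofTensor _ _))) = _
  rw [LinearEquiv.symm_apply_apply, LinearMap.lTensor_tmul]

theorem rowHom_mem_bigrading {S : Module.End k B} {δ : ℤ} (hS : ∀ e, ∀ b ∈ ℬ e, S b ∈ ℬ (e + δ))
    (d e : ℤ) (c : TwistedTensor D.toGradedTwistingMap)
    (hc : c ∈ bigrading D.toGradedTwistingMap d e) :
    D.rowHom S c ∈ bigrading D.toGradedTwistingMap d (e + δ) := by
  suffices h : bigrading D.toGradedTwistingMap d e ≤
      (bigrading D.toGradedTwistingMap d (e + δ)).comap (D.rowHom S) from h hc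
  refine bigrading_le.2 fun a ha b hb => ?_
  rw [Submodule.mem_comap, rowHom_apply]
  exact mem_bigrading ha (hS e b hb)

theorem rowHom_mem_grading {S : Module.End k B} {δ : ℤ} (hS : ∀ e, ∀ b ∈ ℬ e, S b ∈ ℬ (e + δ))
    (e : ℤ) (c : TwistedTensor D.toGradedTwistingMap) (hc : c ∈ grading D.toGradedTwistingMap e) :
    D.rowHom S c ∈ grading D.toGradedTwistingMap (e + δ) := by
  suffices h : grading D.toGradedTwistingMap e ≤
      (grading D.toGradedTwistingMap (e + δ)).comap (D.rowHom S) from h hc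
  rw [grading_eq]
  exact iSup_le fun d c hc => bigrading_le_grading (by ring) (D.rowHom_mem_bigrading hS d _ c hc)

theorem linearMap_ext {W : Type*} [AddCommGroup W] [Module k W]
    {f g : TwistedTensor D.toGradedTwistingMap →ₗ[k] W}
    (h : ∀ a b, f (ιA D.toGradedTwistingMap a * ιB D.toGradedTwistingMap b) =
      g (ιA D.toGradedTwistingMap a * ιB D.toGradedTwistingMap b)) : f = g := by
  refine LinearMap.ext fun x => ?_
  induction x using tmul_induction with
  | h0 => rw [map_zero, map_zero]
  | ht a b => rw [tmul_eq, h]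
  | ha x z hx hz => rw [map_add, map_add, hx, hz]

theorem rowHom_mulRight (b : B) (c : TwistedTensor D.toGradedTwistingMap) :
    D.rowHom (LinearMap.mulRight k b) c = c * ιB D.toGradedTwistingMap b := by
  refine LinearMap.congr_fun (g := LinearMap.mulRight k (ιB D.toGradedTwistingMap b))
    (D.linearMap_ext fun a b' => ?_) c
  rw [rowHom_apply, LinearMap.mulRight_apply, LinearMap.mulRight_apply, map_mul, mul_assoc]

theorem πA_ιA (a : A) : D.πA (ιA D.toGradedTwistingMap a) = a := by
  change augmentation ℬ 1 • a = a
  rw [map_one, one_smul]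

theorem πA_ιB (b : B) : D.πA (ιB D.toGradedTwistingMap b) = algebraMap k A (augmentation ℬ b) := by
  rw [Algebra.algebraMap_eq_smul_one]
  rfl

theorem πA_mem {e : ℤ} {c : TwistedTensor D.toGradedTwistingMap}
    (hc : c ∈ grading D.toGradedTwistingMap e) : D.πA c ∈ 𝒜 e := by
  suffices h : grading D.toGradedTwistingMap e ≤ (𝒜 e).comap D.πA.toLinearMap from h hc
  rw [grading_eq]
  refine iSup_le fun d => bigrading_le.2 fun a ha b hb => ?_
  change D.πA (ιA D.toGradedTwistingMap a * ιB D.toGradedTwistingMap b) ∈ 𝒜 e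
  rw [map_mul, πA_ιA, πA_ιB]
  by_cases h : e - d = 0
  · rw [← Algebra.commutes, ← Algebra.smul_def, show e = d by omega]
    exact Submodule.smul_mem _ _ ha
  · rw [augmentation_eq_zero ℬ h hb, map_zero, mul_zero]
    exact zero_mem _

variable (ℬ) in
/-- The projection of `B` onto its component of degree `0`. -/
noncomputable def augEnd : Module.End k B := Algebra.linearMap k B ∘ₗ (augmentation ℬ).toLinearMap

theorem rowHom_augEnd (c : TwistedTensor D.toGradedTwistingMap) :
    D.rowHom (augEnd ℬ) c = ιA D.toGradedTwistingMap (D.πA c) := by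
  refine LinearMap.congr_fun
    (g := (ιA D.toGradedTwistingMap).toLinearMap ∘ₗ D.πA.toLinearMap)
    (D.linearMap_ext fun a b => ?_) c
  rw [rowHom_apply]
  change ιA _ a * ιB _ (algebraMap k B (augmentation ℬ b)) = ιA _ (D.πA _)
  rw [map_mul, πA_ιA, πA_ιB, AlgHom.commutes, map_mul, AlgHom.commutes]

section Column

variable (hl : ∀ i, y i ∈ ℬ l) (hσ : IsInvertibleMatrixHom 𝒜 D.σ)

/-- The identification `b ⊗ a ↦ b a` of `B ⊗ A` with the twisted tensor product. -/
noncomputable def revEquiv : B ⊗[k] A ≃ₗ[k] TwistedTensor D.toGradedTwistingMap :=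
  LinearEquiv.ofBijective (ofTensorRev D.toGradedTwistingMap) (D.ofTensorRev_bijective hl hσ)

/-- The action of `End B` on `A ⊗^τ B ≅ B ⊗ A` through the first factor. -/
noncomputable def colHom :
    Module.End k B →ₐ[k] Module.End k (TwistedTensor D.toGradedTwistingMap) :=
  ((D.revEquiv hl hσ).conjAlgEquiv k).toAlgHom.comp (Module.End.rTensorAlgHom k B A)

theorem colHom_apply (S : Module.End k B) (b : B) (a : A) :
    D.colHom hl hσ S (ιB D.toGradedTwistingMap b * ιA D.toGradedTwistingMap a) =
      ιB D.toGradedTwistingMap (S b) * ιA D.toGradedTwistingMap a := by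
  rw [← ofTensorRev_tmul, ← ofTensorRev_tmul]
  change D.revEquiv hl hσ (LinearMap.rTensor A S ((D.revEquiv hl hσ).symm
    (D.revEquiv hl hσ (b ⊗ₜ a)))) = _
  rw [LinearEquiv.symm_apply_apply, LinearMap.rTensor_tmul]
  rfl

theorem colHom_mem_grading {S : Module.End k B} {δ : ℤ} (hS : ∀ e, ∀ b ∈ ℬ e, S b ∈ ℬ (e + δ))
    (e : ℤ) (c : TwistedTensor D.toGradedTwistingMap) (hc : c ∈ grading D.toGradedTwistingMap e) :
    D.colHom hl hσ S c ∈ grading D.toGradedTwistingMap (e + δ) := by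
  suffices h : grading D.toGradedTwistingMap e ≤
      (grading D.toGradedTwistingMap (e + δ)).comap (D.colHom hl hσ S) from h hc
  rw [grading_eq]
  refine iSup_le fun d => (D.bigrading_le_bigradingRev hl hσ d (e - d)).trans
    (bigradingRev_le.2 fun b hb a ha => ?_)
  rw [Submodule.mem_comap, colHom_apply]
  exact bigrading_le_grading (d := d) (n := e - d + δ) (by ring)
    (D.bigradingRev_le_bigrading hl _ _ (mem_bigradingRev ha (hS _ b hb)))

include hl hσ in
theorem linearMap_ext_rev {W : Type*} [AddCommGroup W] [Module k W]
    {f g : TwistedTensor D.toGradedTwistingMap →ₗ[k] W}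
    (h : ∀ b a, f (ιB D.toGradedTwistingMap b * ιA D.toGradedTwistingMap a) =
      g (ιB D.toGradedTwistingMap b * ιA D.toGradedTwistingMap a)) : f = g := by
  refine LinearMap.ext fun x => ?_
  obtain ⟨z, rfl⟩ := (D.ofTensorRev_bijective hl hσ).2 x
  induction z with
  | zero => rw [map_zero, map_zero, map_zero]
  | tmul b a => rw [ofTensorRev_tmul, h]
  | add x z hx hz => rw [map_add, map_add, map_add, hx, hz]

theorem colHom_mulLeft (b : B) (c : TwistedTensor D.toGradedTwistingMap) :
    D.colHom hl hσ (LinearMap.mulLeft k b) c = ιB D.toGradedTwistingMap b * c := by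
  refine LinearMap.congr_fun (g := LinearMap.mulLeft k (ιB D.toGradedTwistingMap b))
    (D.linearMap_ext_rev hl hσ fun b' a => ?_) c
  rw [colHom_apply, LinearMap.mulLeft_apply, LinearMap.mulLeft_apply, map_mul, mul_assoc]

theorem colHom_augEnd (c : TwistedTensor D.toGradedTwistingMap) :
    D.colHom hl hσ (augEnd ℬ) c = ιA D.toGradedTwistingMap (D.πA c) := by
  refine LinearMap.congr_fun
    (g := (ιA D.toGradedTwistingMap).toLinearMap ∘ₗ D.πA.toLinearMap)
    (D.linearMap_ext_rev hl hσ fun b a => ?_) c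
  rw [colHom_apply]
  change ιB _ (algebraMap k B (augmentation ℬ b)) * ιA _ a = ιA _ (D.πA _)
  rw [map_mul, πA_ιA, πA_ιB, AlgHom.commutes, map_mul, AlgHom.commutes]

end Column

end DiagonalTwistingMap

/-! ### The resolution of `A` over the twisted tensor product -/

namespace PureMinimalResolution

variable {k B : Type*} [Field k] [Ring B] [Algebra k B] {ℬ : ℤ → Submodule k B} [GradedAlgebra ℬ]
  [ConnectedGraded ℬ] {m : ℕ} {y : Fin m → B} (Q : PureMinimalResolution ℬ y)

/-- Purity of the resolution forces the generators to have the same degree. -/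
theorem generator_mem (i : Fin m) : y i ∈ ℬ (Q.deg 1 - Q.deg 0) := by
  have h := Q.homogeneous 0 (Fin.cast Q.rank_one.symm i) ⟨0, by rw [Q.rank_zero]; exact one_pos⟩
  rw [Q.mat_zero] at h
  exact h

end PureMinimalResolution

namespace DiagonalTwistingMap

open TwistedTensor

variable {k A B : Type*} [Field k] [Ring A] [Algebra k A] [Ring B] [Algebra k B]
  {𝒜 : ℤ → Submodule k A} [GradedAlgebra 𝒜] {ℬ : ℤ → Submodule k B} [GradedAlgebra ℬ]
  [ConnectedGraded 𝒜] [ConnectedGraded ℬ]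
  {m : ℕ} {y : Fin m → B} (D : DiagonalTwistingMap 𝒜 ℬ y) (Q : PureMinimalResolution ℬ y)

/-- The matrix of the `i`-th differential of `A ⊗^τ Q`. -/
noncomputable abbrev matC (i : ℕ) :
    Matrix (Fin (Q.rank (i + 1))) (Fin (Q.rank i)) (TwistedTensor D.toGradedTwistingMap) :=
  (Q.mat i).map (ιB D.toGradedTwistingMap)

theorem resolutionDiff_apply (i : ℕ) (x) :
    D.resolutionDiff Q i x = Matrix.vecMul x (D.matC Q i) := rfl

theorem matC_mem (i : ℕ) (a b) :
    D.matC Q i a b ∈ grading D.toGradedTwistingMap (Q.deg (i + 1) - Q.deg i) :=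
  ιB_mem_grading (Q.homogeneous i a b)

theorem matC_mul_matC (i : ℕ) : D.matC Q (i + 1) * D.matC Q i = 0 := by
  refine (Matrix.map_mul (f := (ιB D.toGradedTwistingMap).toRingHom)).symm.trans ?_
  rw [Q.mat_mul_mat, Matrix.map_zero _ (map_zero _)]

theorem πA_matC (i : ℕ) (a b) : D.πA (D.matC Q i a b) = 0 := by
  change D.πA (ιB D.toGradedTwistingMap (Q.mat i a b)) = 0
  rw [πA_ιB, Q.minimal, map_zero]

theorem πA_vecMul_matC (i : ℕ) (x) (b) : D.πA (Matrix.vecMul x (D.matC Q i) b) = 0 := by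
  rw [Matrix.vecMul, dotProduct, map_sum]
  exact Finset.sum_eq_zero fun a _ => by rw [map_mul, πA_matC, mul_zero]

/-- The graded `k`-linear map from `C ⊗ Wᵢ` to `C ⊗ W_{i+1}` induced by the generalised inverse of
the `i`-th differential of `Q`. -/
noncomputable def rowSec (i : ℕ) : (Fin (Q.rank i) → TwistedTensor D.toGradedTwistingMap) →ₗ[k]
    (Fin (Q.rank (i + 1)) → TwistedTensor D.toGradedTwistingMap) :=
  transfer D.rowHom (Q.rowInv i)

theorem rowSec_mem (i : ℕ) (e : ℤ) (x)
    (hx : x ∈ vecGrading (grading D.toGradedTwistingMap) (Q.rank i) (e - Q.deg i)) :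
    D.rowSec Q i x ∈ vecGrading (grading D.toGradedTwistingMap) _ (e - Q.deg (i + 1)) := by
  rw [mem_vecGrading] at hx ⊢
  intro b
  have := transfer_mem D.rowHom (𝒞 := grading D.toGradedTwistingMap)
    (fun S hS e c hc => D.rowHom_mem_grading hS e c hc) (Q.rowInv_mem i) hx b
  rwa [show e - Q.deg i + -(Q.deg (i + 1) - Q.deg i) = e - Q.deg (i + 1) by ring] at this

theorem transfer_rowMap (i : ℕ) (x) :
    transfer D.rowHom (Q.rowMap i) x = Matrix.vecMul x (D.matC Q i) :=
  transfer_vecMul D.rowHom (ιB D.toGradedTwistingMap) D.rowHom_mulRight (Q.mat i) x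

theorem vecMul_rowSec_succ (i : ℕ) (x) :
    Matrix.vecMul (D.rowSec Q (i + 1) (x - D.rowSec Q i (Matrix.vecMul x (D.matC Q i))))
      (D.matC Q (i + 1)) = x - D.rowSec Q i (Matrix.vecMul x (D.matC Q i)) := by
  have h := transfer_exact D.rowHom (Q.rowMap_exact_succ i) x
  rw [transfer_comp, LinearMap.comp_apply, transfer_rowMap, transfer_rowMap] at h
  exact h

theorem vecMul_rowSec_zero (x : Fin (Q.rank 0) → TwistedTensor D.toGradedTwistingMap) :
    Matrix.vecMul (D.rowSec Q 0 (x - fun p => ιA D.toGradedTwistingMap (D.πA (x p))))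
      (D.matC Q 0) = x - fun p => ιA D.toGradedTwistingMap (D.πA (x p)) := by
  have h := transfer_exact D.rowHom Q.rowMap_exact_zero x
  have h1 : transfer D.rowHom (PureMinimalResolution.augProj ℬ (Q.rank 0)) x =
      fun p => ιA D.toGradedTwistingMap (D.πA (x p)) := by
    funext p
    rw [← rowHom_augEnd]
    exact transfer_diagonal D.rowHom _ (augEnd ℬ) (fun _ _ => rfl) x p
  rw [h1, transfer_rowMap] at h
  exact h

theorem vecMul_rowSec_of_vecMul_eq_zero {i : ℕ} {x : Fin (Q.rank (i + 1)) → _}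
    (hx : Matrix.vecMul x (D.matC Q i) = 0) :
    Matrix.vecMul (D.rowSec Q (i + 1) x) (D.matC Q (i + 1)) = x := by
  have h := D.vecMul_rowSec_succ Q i x
  rwa [hx, map_zero, sub_zero] at h

theorem vecMul_rowSec_of_πA_eq_zero {x : Fin (Q.rank 0) → _} (hx : ∀ p, D.πA (x p) = 0) :
    Matrix.vecMul (D.rowSec Q 0 x) (D.matC Q 0) = x := by
  have h := D.vecMul_rowSec_zero Q x
  have h0 : (fun p => ιA D.toGradedTwistingMap (D.πA (x p))) = 0 := funext fun p => by
    rw [hx, map_zero]; rfl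
  rwa [h0, sub_zero] at h

theorem resolutionAug_apply (x) (p : Fin (Q.rank 0)) : D.resolutionAug Q x = D.πA (x p) := by
  change ∑ p, D.πA (x p) = D.πA (x p)
  exact Finset.sum_eq_single p (fun q _ hq => absurd (Q.rank_zero_eq q p) hq) (by simp)

/-- The resolution `A ⊗^τ Q` of `A`, split by the maps `rowSec`. -/
noncomputable def toSplitResolution :
    SplitResolution (R := TwistedTensor D.toGradedTwistingMap) (M := A)
      (grading D.toGradedTwistingMap) 𝒜 where
  rank := Q.rank
  deg := Q.deg
  mat := D.matC Q
  homogeneous := D.matC_mem Q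
  mat_mul_mat := D.matC_mul_matC Q
  sec := D.rowSec Q
  sec_mem := D.rowSec_mem Q
  sec_spec i x := ⟨_, by rw [D.vecMul_rowSec_succ Q i x]; exact add_sub_cancel _ _⟩
  aug := D.resolutionAug Q
  aug_mem e x hx := by
    rw [mem_vecGrading, Q.deg_zero, sub_zero] at hx
    change ∑ p, D.πA (x p) ∈ 𝒜 e
    exact sum_mem fun p _ => D.πA_mem (hx p)
  aug_mat x := by
    change ∑ p, D.πA (Matrix.vecMul x (D.matC Q 0) p) = 0
    exact Finset.sum_eq_zero fun p _ => D.πA_vecMul_matC Q 0 x p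
  augSec := LinearMap.pi fun _ => (ιA D.toGradedTwistingMap).toLinearMap
  augSec_mem e a ha := by
    rw [mem_vecGrading, Q.deg_zero, sub_zero]
    exact fun _ => ιA_mem_grading ha
  aug_augSec a := by
    rw [D.resolutionAug_apply Q _ ⟨0, by rw [Q.rank_zero]; exact one_pos⟩]
    exact D.πA_ιA a
  augSec_spec x := ⟨_, by
    rw [D.vecMul_rowSec_zero Q x]
    refine (congrArg (· + _) ?_).trans (add_sub_cancel _ _)
    funext p
    rw [D.resolutionAug_apply Q x p]
    rfl⟩

theorem resolutionAug_surjective : Function.Surjective (D.resolutionAug Q) := fun a =>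
  ⟨_, (D.toSplitResolution Q).aug_augSec a⟩

theorem resolutionAug_eq_zero_iff (x) :
    D.resolutionAug Q x = 0 ↔ ∃ z, D.resolutionDiff Q 0 z = x := by
  constructor
  · intro h
    exact ⟨_, D.vecMul_rowSec_of_πA_eq_zero Q fun p => (D.resolutionAug_apply Q x p).symm.trans h⟩
  · rintro ⟨z, rfl⟩
    exact (D.toSplitResolution Q).aug_mat z

theorem resolutionDiff_eq_zero_iff (i : ℕ) (x) :
    D.resolutionDiff Q i x = 0 ↔ ∃ z, D.resolutionDiff Q (i + 1) z = x := by
  constructor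
  · exact fun h => ⟨_, D.vecMul_rowSec_of_vecMul_eq_zero Q h⟩
  · rintro ⟨z, rfl⟩
    rw [resolutionDiff_apply, resolutionDiff_apply, Matrix.vecMul_vecMul, matC_mul_matC,
      Matrix.vecMul_zero]

/-! ### The bimodule structure on the resolution -/

/-- A row vector with entries in `A` is determined by its product with a differential. -/
theorem eq_zero_of_vecMul_eq_zero (i : ℕ) {x : Fin (Q.rank (i + 1)) → A}
    (hx : Matrix.vecMul (fun a => ιA D.toGradedTwistingMap (x a)) (D.matC Q i) = 0) : x = 0 := by
  have h := D.vecMul_rowSec_of_vecMul_eq_zero Q hx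
  funext a
  rw [← D.πA_ιA (x a)]
  exact (congrArg D.πA (congrFun h a)).symm.trans (D.πA_vecMul_matC Q _ _ a)

/-- The matrix over `A`, regarded as a matrix over the twisted tensor product. -/
noncomputable abbrev mapA {s t : ℕ} (P : Matrix (Fin s) (Fin t) A) :
    Matrix (Fin s) (Fin t) (TwistedTensor D.toGradedTwistingMap) :=
  P.map (ιA D.toGradedTwistingMap)

theorem mapA_mul {r s t : ℕ} (P : Matrix (Fin r) (Fin s) A) (P' : Matrix (Fin s) (Fin t) A) :
    D.mapA (P * P') = D.mapA P * D.mapA P' :=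
  Matrix.map_mul (f := (ιA D.toGradedTwistingMap).toRingHom)

theorem mapA_add {s t : ℕ} (P P' : Matrix (Fin s) (Fin t) A) :
    D.mapA (P + P') = D.mapA P + D.mapA P' :=
  Matrix.map_add _ (map_add _) _ _

theorem mapA_sub {s t : ℕ} (P P' : Matrix (Fin s) (Fin t) A) :
    D.mapA (P - P') = D.mapA P - D.mapA P' :=
  Matrix.map_sub _ (map_sub _) _ _

theorem mapA_smul {s t : ℕ} (c : k) (P : Matrix (Fin s) (Fin t) A) :
    D.mapA (c • P) = c • D.mapA P :=
  Matrix.map_smul _ c (fun a => map_smul (ιA D.toGradedTwistingMap) c a) P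

theorem mapA_one {s : ℕ} : D.mapA (1 : Matrix (Fin s) (Fin s) A) = 1 :=
  Matrix.map_one _ (map_zero _) (map_one _)

/-- A matrix with entries in `A` is determined by its product with a differential. -/
theorem eq_of_mapA_mul_eq (i : ℕ) {s : ℕ} {P P' : Matrix (Fin s) (Fin (Q.rank (i + 1))) A}
    (h : D.mapA P * D.matC Q i = D.mapA P' * D.matC Q i) : P = P' := by
  rw [← sub_eq_zero]
  ext a b
  refine congrFun (D.eq_zero_of_vecMul_eq_zero Q i (x := (P - P') a) ?_) b
  have h1 : D.mapA (P - P') * D.matC Q i = 0 := by rw [mapA_sub, Matrix.sub_mul, h, sub_self]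
  exact congrFun h1 a

end DiagonalTwistingMap

namespace DiagonalTwistingMap

open TwistedTensor

variable {k A B : Type*} [Field k] [Ring A] [Algebra k A] [Ring B] [Algebra k B]
  {𝒜 : ℤ → Submodule k A} [GradedAlgebra 𝒜] {ℬ : ℤ → Submodule k B} [GradedAlgebra ℬ]
  [ConnectedGraded 𝒜] [ConnectedGraded ℬ]
  {m : ℕ} {y : Fin m → B} (D : DiagonalTwistingMap 𝒜 ℬ y) (Q : PureMinimalResolution ℬ y)

theorem vecMul_rowSec_vecMul (i : ℕ) (x) :
    Matrix.vecMul (D.rowSec Q i (Matrix.vecMul x (D.matC Q i))) (D.matC Q i) =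
      Matrix.vecMul x (D.matC Q i) := by
  have h : Q.rowMap i ∘ₗ Q.rowInv i ∘ₗ Q.rowMap i = Q.rowMap i :=
    LinearMap.ext (Q.rowMap_rowInv_rowMap i)
  have h1 := LinearMap.congr_fun (congrArg (transfer D.rowHom) h) x
  rw [transfer_comp, transfer_comp, LinearMap.comp_apply, LinearMap.comp_apply, transfer_rowMap,
    transfer_rowMap] at h1
  exact h1

theorem ιA_πA_of_mem_bigrading {d n : ℤ} (hn : n = 0) {c : TwistedTensor D.toGradedTwistingMap}
    (hc : c ∈ bigrading D.toGradedTwistingMap d n) : ιA D.toGradedTwistingMap (D.πA c) = c := by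
  subst hn
  suffices h : bigrading D.toGradedTwistingMap d 0 ≤ LinearMap.eqLocus
      ((ιA D.toGradedTwistingMap).toLinearMap ∘ₗ D.πA.toLinearMap) LinearMap.id from h hc
  refine bigrading_le.2 fun a _ b hb => ?_
  rw [ConnectedGraded.zero (𝒜 := ℬ)] at hb
  obtain ⟨c, rfl⟩ := Submodule.mem_one.1 hb
  change ιA _ (D.πA (ιA _ a * ιB _ (algebraMap k B c))) = ιA _ a * ιB _ (algebraMap k B c)
  rw [AlgHom.commutes, map_mul, AlgHom.commutes, πA_ιA, map_mul, AlgHom.commutes]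

/-- A graded matrix homomorphism on the `i`-th term lifts along the `i`-th differential as soon as
it preserves the image of the latter. The lift has entries in `A` because the resolution is pure:
the entries of `matC i * φ(a)` all have the same degree in `B` as those of `matC i`, so that the
quotient by `matC i` has degree zero in `B`. -/
theorem exists_lift (i : ℕ) {φ : A →ₐ[k] Matrix (Fin (Q.rank i)) (Fin (Q.rank i)) A}
    (hφ : IsGradedMatrixHom 𝒜 φ)
    (hz : ∀ a r, ∃ z, Matrix.vecMul z (D.matC Q i) = (D.matC Q i * D.mapA (φ a)) r) :
    ∃ φ' : A →ₐ[k] Matrix (Fin (Q.rank (i + 1))) (Fin (Q.rank (i + 1))) A,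
      IsGradedMatrixHom 𝒜 φ' ∧ ∀ a, D.mapA (φ' a) * D.matC Q i = D.matC Q i * D.mapA (φ a) := by
  let Z : A →ₗ[k] Matrix (Fin (Q.rank (i + 1))) (Fin (Q.rank (i + 1)))
      (TwistedTensor D.toGradedTwistingMap) :=
    { toFun := fun a => Matrix.of fun r => D.rowSec Q i ((D.matC Q i * D.mapA (φ a)) r)
      map_add' := fun a a' => by
        funext r
        rw [map_add, mapA_add, Matrix.mul_add]
        exact map_add (D.rowSec Q i) _ _
      map_smul' := fun c a => by
        funext r
        rw [map_smul, mapA_smul, Matrix.mul_smul]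
        exact map_smul (D.rowSec Q i) c _ }
  have hZ (a : A) : Z a * D.matC Q i = D.matC Q i * D.mapA (φ a) := by
    funext r
    obtain ⟨z, hz⟩ := hz a r
    have := D.vecMul_rowSec_vecMul Q i z
    rw [hz] at this
    exact this
  have hmem (d : ℤ) (a : A) (ha : a ∈ 𝒜 d) (r b) :
      Z a r b ∈ bigrading D.toGradedTwistingMap d
        (Q.deg (i + 1) - Q.deg i + -(Q.deg (i + 1) - Q.deg i)) := by
    refine transfer_mem D.rowHom (𝒞 := bigrading D.toGradedTwistingMap d)
      (fun S hS e c hc => D.rowHom_mem_bigrading hS d e c hc) (Q.rowInv_mem i) (fun p => ?_) b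
    rw [Matrix.mul_apply]
    refine sum_mem fun q _ => D.bigradingRev_le_bigrading Q.generator_mem _ _ ?_
    exact mem_bigradingRev (hφ d a ha q p) (Q.homogeneous i r q)
  let L : A →ₗ[k] Matrix (Fin (Q.rank (i + 1))) (Fin (Q.rank (i + 1))) A :=
    D.πA.toLinearMap.mapMatrix ∘ₗ Z
  have hL (a : A) : D.mapA (L a) = Z a := by
    induction a using DirectSum.Decomposition.inductionOn 𝒜 with
    | zero => rw [map_zero, map_zero]; exact Matrix.map_zero _ (map_zero _)
    | @homogeneous d a =>
      ext r b
      exact D.ιA_πA_of_mem_bigrading (add_neg_cancel _) (hmem d a a.2 r b)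
    | add a a' h h' => rw [map_add, map_add, mapA_add, h, h']
  have hLφ (a : A) : D.mapA (L a) * D.matC Q i = D.matC Q i * D.mapA (φ a) := by rw [hL, hZ]
  refine ⟨AlgHom.ofLinearMap L ?_ fun a a' => ?_, fun d a ha r b => ?_, hLφ⟩
  · refine D.eq_of_mapA_mul_eq Q i ?_
    rw [hLφ, map_one, mapA_one, mapA_one, Matrix.mul_one, Matrix.one_mul]
  · refine D.eq_of_mapA_mul_eq Q i ?_
    rw [hLφ, map_mul, mapA_mul, mapA_mul, Matrix.mul_assoc, hLφ, ← Matrix.mul_assoc,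
      ← Matrix.mul_assoc, hLφ]
  · have h := hmem d a ha r b
    rw [add_neg_cancel] at h
    exact D.πA_mem (bigrading_le_grading (add_zero d) h)

/-- The relation `yⱼ a = ∑ₜ σⱼₜ(a) yₜ`, read as an intertwining property of the first
differential. -/
theorem mapA_σ_mul_matC_zero (a : A) :
    D.mapA ((D.σ a).submatrix (Fin.cast Q.rank_one) (Fin.cast Q.rank_one)) * D.matC Q 0 =
      D.matC Q 0 * D.mapA (Matrix.scalar (Fin (Q.rank 0)) a) := by
  ext j p
  have h1 : (D.matC Q 0 * D.mapA (Matrix.scalar (Fin (Q.rank 0)) a)) j p =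
      ιB D.toGradedTwistingMap (y (Fin.cast Q.rank_one j)) * ιA D.toGradedTwistingMap a := by
    rw [Matrix.mul_apply, Finset.sum_eq_single p
      (fun q _ hq => absurd (Q.rank_zero_eq q p) hq) (by simp)]
    change ιB D.toGradedTwistingMap (Q.mat 0 j p) *
      ιA D.toGradedTwistingMap (Matrix.diagonal (fun _ => a) p p) = _
    rw [Q.mat_zero, Matrix.diagonal_apply_eq]
  have h2 : (D.mapA ((D.σ a).submatrix (Fin.cast Q.rank_one) (Fin.cast Q.rank_one)) *
      D.matC Q 0) j p = ∑ t, ιA D.toGradedTwistingMap (D.σ a (Fin.cast Q.rank_one j) t) *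
        ιB D.toGradedTwistingMap (y t) := by
    rw [Matrix.mul_apply, ← Equiv.sum_comp (finCongr Q.rank_one)]
    refine Finset.sum_congr rfl fun t _ => ?_
    change _ * ιB D.toGradedTwistingMap (Q.mat 0 t p) = _
    rw [Q.mat_zero]
    rfl
  rw [h1, h2, ιB_mul_ιA]
  refine Eq.trans ?_ (D.τ_tmul _ a).symm
  exact Finset.sum_congr rfl fun t _ => (tmul_eq D.toGradedTwistingMap _ _).symm

theorem exists_isBimoduleResolution : ∃ φ, D.IsBimoduleResolution Q φ := by
  let P (i : ℕ) : Type _ := {φ : A →ₐ[k] Matrix (Fin (Q.rank i)) (Fin (Q.rank i)) A //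
    IsGradedMatrixHom 𝒜 φ ∧
    ∀ a r, ∃ z, Matrix.vecMul z (D.matC Q i) = (D.matC Q i * D.mapA (φ a)) r}
  have hstep (i : ℕ) (φ : P i) : ∃ φ' : P (i + 1),
      ∀ a, D.mapA (φ'.1 a) * D.matC Q i = D.matC Q i * D.mapA (φ.1 a) := by
    obtain ⟨φ', h1, h2⟩ := D.exists_lift Q i φ.2.1 φ.2.2
    refine ⟨⟨φ', h1, fun a r => ⟨_, D.vecMul_rowSec_of_vecMul_eq_zero Q ?_⟩⟩, h2⟩
    have : (D.matC Q (i + 1) * D.mapA (φ' a)) * D.matC Q i = 0 := by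
      rw [Matrix.mul_assoc, h2, ← Matrix.mul_assoc, matC_mul_matC, Matrix.zero_mul]
    exact congrFun this r
  choose step hstep using hstep
  let φ₀ : P 0 := ⟨Matrix.scalarAlgHom (Fin (Q.rank 0)) k, fun d a ha p q => by
      change Matrix.diagonal (fun _ => a) p q ∈ 𝒜 d
      rw [Q.rank_zero_eq p q, Matrix.diagonal_apply_eq]
      exact ha, fun a r => ⟨_, D.vecMul_rowSec_of_πA_eq_zero Q fun p => by
      rw [Matrix.mul_apply, map_sum]
      exact Finset.sum_eq_zero fun q _ => by rw [map_mul, πA_matC, zero_mul]⟩⟩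
  let Φ (i : ℕ) : P i := Nat.rec φ₀ step i
  have hΦ (i : ℕ) (a : A) :
      D.mapA ((Φ (i + 1)).1 a) * D.matC Q i = D.matC Q i * D.mapA ((Φ i).1 a) := hstep i (Φ i) a
  refine ⟨fun i => (Φ i).1, fun i => (Φ i).2.1, fun a => rfl, fun a j p => ?_, fun i x a => ?_,
    fun x a => ?_, D.resolutionAug_surjective Q, D.resolutionAug_eq_zero_iff Q,
    D.resolutionDiff_eq_zero_iff Q⟩
  · have h := D.eq_of_mapA_mul_eq Q 0 ((hΦ 0 a).trans (D.mapA_σ_mul_matC_zero Q a).symm)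
    exact congrFun (congrFun h j) p
  · rw [resolutionDiff_apply, resolutionDiff_apply, twistedRightAction, twistedRightAction,
      Matrix.vecMul_vecMul, Matrix.vecMul_vecMul, hΦ]
  · have p : Fin (Q.rank 0) := ⟨0, by rw [Q.rank_zero]; exact one_pos⟩
    rw [D.resolutionAug_apply Q _ p, D.resolutionAug_apply Q _ p]
    have h : D.twistedRightAction (Φ 0).1 x a p = x p * ιA D.toGradedTwistingMap a := by
      rw [twistedRightAction, Matrix.vecMul, dotProduct, Finset.sum_eq_single p
        (fun q _ hq => absurd (Q.rank_zero_eq q p) hq) (by simp)]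
      change x p * ιA D.toGradedTwistingMap (Matrix.diagonal (fun _ => a) p p) = _
      rw [Matrix.diagonal_apply_eq]
    rw [h, map_mul, πA_ιA]

end DiagonalTwistingMap

/-! ### The dual complex over the twisted tensor product -/

namespace DiagonalTwistingMap

open TwistedTensor

variable {k A : Type*} {B : Type u} [Field k] [Ring A] [Algebra k A] [Ring B] [Algebra k B]
  {𝒜 : ℤ → Submodule k A} [GradedAlgebra 𝒜] {ℬ : ℤ → Submodule k B} [GradedAlgebra ℬ]
  [ConnectedGraded 𝒜] [ConnectedGraded ℬ]
  {m : ℕ} {y : Fin m → B} (D : DiagonalTwistingMap 𝒜 ℬ y) (Q : PureMinimalResolution ℬ y)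

theorem πA_padMat_mulVec : ∀ (i : ℕ) (w : Fin (padRank Q.rank i) → _) (a : Fin (Q.rank i)),
    D.πA ((padMat (D.matC Q) i).mulVec w a) = 0
  | 0, w, a => map_zero _
  | i + 1, w, a => by
    change D.πA (∑ b, D.matC Q i a b * w b) = 0
    rw [map_sum]
    exact Finset.sum_eq_zero fun b _ => by rw [map_mul, πA_matC, zero_mul]

theorem πA_eq_zero_of_mem_bdry {i : ℕ} {j : ℤ} {x : Fin (Q.rank i) → _}
    (hx : x ∈ (D.toSplitResolution Q).bdry i j) (a : Fin (Q.rank i)) : D.πA (x a) = 0 := by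
  obtain ⟨w, _, rfl⟩ := ((D.toSplitResolution Q).mem_bdry_iff i j x).1 hx
  exact D.πA_padMat_mulVec Q i w a

variable (hσ : IsInvertibleMatrixHom 𝒜 D.σ)

/-- The graded `k`-linear map on column vectors over `C` induced by the generalised inverse of the
`i`-th differential of the dual complex of `Q`. -/
noncomputable def colSec (i : ℕ) : (Fin (Q.rank i) → TwistedTensor D.toGradedTwistingMap) →ₗ[k]
    (Fin (padRank Q.rank i) → TwistedTensor D.toGradedTwistingMap) :=
  transfer (D.colHom Q.generator_mem hσ) (Q.colInv i)

theorem colSec_mem (i : ℕ) (j : ℤ) (x)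
    (hx : x ∈ vecGrading (grading D.toGradedTwistingMap) (Q.rank i) (Q.deg i + j)) :
    D.colSec Q hσ i x ∈ vecGrading (grading D.toGradedTwistingMap) _ (padDeg Q.deg i + j) := by
  rw [mem_vecGrading] at hx ⊢
  intro b
  have := transfer_mem (D.colHom Q.generator_mem hσ) (𝒞 := grading D.toGradedTwistingMap)
    (fun S hS e c hc => D.colHom_mem_grading _ _ hS e c hc) (Q.colInv_mem i) hx b
  rwa [show Q.deg i + j + -(Q.deg i - padDeg Q.deg i) = padDeg Q.deg i + j by ring] at this

theorem transfer_colMap (i : ℕ) (x) :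
    transfer (D.colHom Q.generator_mem hσ) (Q.colMap i) x =
      (padMat (D.matC Q) i).mulVec x := by
  refine (transfer_mulVec (D.colHom Q.generator_mem hσ) (ιB D.toGradedTwistingMap)
    (D.colHom_mulLeft _ _) (padMat Q.mat i) x).trans ?_
  rw [padMat_map]

theorem mem_bdry_of_mulVec_colSec {i : ℕ} {j : ℤ} {x : Fin (Q.rank i) → _}
    (hx : x ∈ vecGrading (grading D.toGradedTwistingMap) (Q.rank i) (Q.deg i + j))
    (h : (padMat (D.matC Q) i).mulVec (D.colSec Q hσ i x) = x) :
    x ∈ (D.toSplitResolution Q).bdry i j :=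
  ((D.toSplitResolution Q).mem_bdry_iff i j x).2 ⟨_, D.colSec_mem Q hσ i j x hx, h⟩

variable {hB : ℕ} {lB : ℤ} (hreg : IsASRegular ℬ hB lB)
include hreg

/-- Exactness of the dual complex away from `hB`. -/
theorem mulVec_colSec {i : ℕ} (hi : i ≠ hB) {x : Fin (Q.rank i) → _}
    (hx : (D.matC Q i).mulVec x = 0) :
    (padMat (D.matC Q) i).mulVec (D.colSec Q hσ i x) = x := by
  have h := transfer_exact (D.colHom Q.generator_mem hσ) (Q.colMap_exact hreg hi) x
  have h0 : transfer (D.colHom Q.generator_mem hσ) (Q.colNext i) x = 0 :=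
    (D.transfer_colMap Q hσ (i + 1) x).trans hx
  rw [transfer_comp, LinearMap.comp_apply, h0, map_zero, sub_zero, transfer_colMap] at h
  exact h

/-- The cokernel of the dual complex in position `hB` is detected by `π_A`. -/
theorem mulVec_colSec_top {x : Fin (Q.rank hB) → _} (hx : ∀ a, D.πA (x a) = 0) :
    (padMat (D.matC Q) hB).mulVec (D.colSec Q hσ hB x) = x := by
  have h := transfer_exact (D.colHom Q.generator_mem hσ) (Q.colMap_exact_top hreg) x
  have h1 : transfer (D.colHom Q.generator_mem hσ)
      (PureMinimalResolution.augProj ℬ (Q.rank hB)) x = 0 := by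
    funext p
    refine (transfer_diagonal _ _ (augEnd ℬ) (fun _ _ => rfl) x p).trans ?_
    rw [colHom_augEnd, hx, map_zero]
    rfl
  rw [h1, sub_zero, transfer_colMap] at h
  exact h

end DiagonalTwistingMap

/-! ### Uniqueness of the determinant -/

namespace DiagonalTwistingMap

open TwistedTensor

section Unique

variable {k A B : Type*} [Field k] [Ring A] [Algebra k A] [Ring B] [Algebra k B]
  {𝒜 : ℤ → Submodule k A} [GradedAlgebra 𝒜] {ℬ : ℤ → Submodule k B} [GradedAlgebra ℬ]
  [ConnectedGraded 𝒜] [ConnectedGraded ℬ]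
  {m : ℕ} {y : Fin m → B} {D : DiagonalTwistingMap 𝒜 ℬ y}

/-- The class which corresponds to `1 ∈ A` under the isomorphism of `\underline{Ext}^d` with
`^ν A(l)`. -/
theorem IsDeterminantOfType.exists_generator {ν : A ≃ₐ[k] A} {d : ℕ} {l : ℤ}
    (h : D.IsDeterminantOfType ν d l) :
    ∃ x : D.Ext d (-l), x ≠ 0 ∧
      ∀ (i : ℤ) (a : 𝒜 i), D.extLeftMul a d (-l) x =
        D.extRightMul (⟨ν a, h.graded i a a.2⟩ : 𝒜 i) d (-l) x := by
  have := ConnectedGraded.nontrivial (𝒜 := 𝒜)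
  obtain ⟨e, hleft, hright⟩ := h.ext_iso
  have h1 : (1 : A) ∈ 𝒜 (-l + l) := by
    rw [neg_add_cancel]; exact SetLike.GradedOne.one_mem
  have hx : ((e (-l)) ((e (-l)).symm ⟨1, h1⟩) : A) = 1 := by rw [LinearEquiv.apply_symm_apply]
  refine ⟨(e (-l)).symm ⟨1, h1⟩, fun h0 => ?_, fun i a => (e (-l + i)).injective (Subtype.ext ?_)⟩
  · rw [h0, map_zero] at hx
    exact zero_ne_one hx
  · rw [hleft, hright, hx, mul_one, one_mul]

theorem IsDeterminantOfType.le {ν ν' : A ≃ₐ[k] A} {d : ℕ} {l l' : ℤ}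
    (h : D.IsDeterminantOfType ν d l) (h' : D.IsDeterminantOfType ν' d l') : l ≤ l' := by
  obtain ⟨x, hx, -⟩ := h.exists_generator
  obtain ⟨e, -, -⟩ := h'.ext_iso
  by_contra hl
  refine hx ((e (-l)).injective (Subtype.ext ?_))
  have h1 : (e (-l) x : A) = 0 := (Submodule.mem_bot k).1
    ((ConnectedGraded.neg (𝒜 := 𝒜) (-l + l') (by omega)).le (e (-l) x).2)
  rw [h1, map_zero]
  rfl

/-- In the bimodule `^ν A(l)` the generator `x` of lowest degree is unique up to a scalar, and it
satisfies `a x = x ν(a)`. -/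
theorem IsDeterminantOfType.unique {ν ν' : A ≃ₐ[k] A} {d d' : ℕ} {l l' : ℤ}
    (h : D.IsDeterminantOfType ν d l) (h' : D.IsDeterminantOfType ν' d' l') : ν' = ν := by
  obtain ⟨x, hx, hνx⟩ := h.exists_generator
  obtain rfl : d = d' := by
    by_contra hd
    have := h'.ext_eq_zero d hd (-l)
    exact hx (Subsingleton.elim _ _)
  obtain rfl : l = l' := le_antisymm (h.le h') (h'.le h)
  obtain ⟨e, hleft, hright⟩ := h'.ext_iso
  have hc : (e (-l) x : A) ∈ (1 : Submodule k A) :=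
    ((congrArg 𝒜 (neg_add_cancel l)).trans (ConnectedGraded.zero (𝒜 := 𝒜))).le (e (-l) x).2
  have hc0 : (e (-l) x : A) ≠ 0 := fun h0 =>
    hx ((e (-l)).injective (Subtype.ext (h0.trans (by rw [map_zero]; rfl))))
  obtain ⟨c, hc⟩ := Submodule.mem_one.1 hc
  rw [← hc] at hc0
  have hc' : c ≠ 0 := fun h0 => hc0 (by rw [h0, map_zero])
  refine AlgEquiv.ext fun a => ?_
  induction a using DirectSum.Decomposition.inductionOn 𝒜 with
  | zero => rw [map_zero, map_zero]
  | add a b ha hb => rw [map_add, map_add, ha, hb]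
  | @homogeneous i a =>
    have h1 := hleft i a (-l) x
    rw [hνx, hright, ← hc, ← Algebra.commutes, ← Algebra.smul_def, ← Algebra.smul_def] at h1
    exact (smul_right_injective A hc' h1).symm

end Unique

/-! ### Bijectivity of graded endomorphisms -/

section Bijective

variable {k A : Type*} [Field k] [Ring A] [Algebra k A] (𝒜 : ℤ → Submodule k A) [GradedAlgebra 𝒜]
  [ConnectedGraded 𝒜]

theorem bijective_of_graded_injective {f : A →ₐ[k] A} (hf : ∀ d, ∀ a ∈ 𝒜 d, f a ∈ 𝒜 d)
    (hi : ∀ a, f a = 0 → a = 0) : Function.Bijective f := by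
  refine ⟨(injective_iff_map_eq_zero f).2 hi, fun b => ?_⟩
  induction b using DirectSum.Decomposition.inductionOn 𝒜 with
  | zero => exact ⟨0, map_zero f⟩
  | @homogeneous d b =>
    have := ConnectedGraded.finite (𝒜 := 𝒜) d
    let g := f.toLinearMap.restrict (p := 𝒜 d) (q := 𝒜 d) (hf d)
    have hg : Function.Injective g := (injective_iff_map_eq_zero g).2 fun a ha =>
      Subtype.ext (hi _ (congrArg Subtype.val ha))
    obtain ⟨a, ha⟩ := LinearMap.injective_iff_surjective.1 hg b
    exact ⟨a, congrArg Subtype.val ha⟩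
  | add b b' h h' =>
    obtain ⟨a, rfl⟩ := h
    obtain ⟨a', rfl⟩ := h'
    exact ⟨a + a', map_add f a a'⟩

end Bijective

/-! ### The bimodule `\underline{Ext}(A, A ⊗^τ B)` -/

section Top

variable {k A : Type*} {B : Type u} [Field k] [Ring A] [Algebra k A] [Ring B] [Algebra k B]
  {𝒜 : ℤ → Submodule k A} [GradedAlgebra 𝒜] {ℬ : ℤ → Submodule k B} [GradedAlgebra ℬ]
  [ConnectedGraded 𝒜] [ConnectedGraded ℬ]
  {m : ℕ} {y : Fin m → B} (D : DiagonalTwistingMap 𝒜 ℬ y) (Q : PureMinimalResolution ℬ y)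

namespace IsBimoduleResolution

variable {D Q} {φ : ∀ i, A →ₐ[k] Matrix (Fin (Q.rank i)) (Fin (Q.rank i)) A}
  (H : D.IsBimoduleResolution Q φ)
include H

theorem mapA_mul_matC (i : ℕ) (a : A) :
    D.mapA (φ (i + 1) a) * D.matC Q i = D.matC Q i * D.mapA (φ i a) := by
  funext r
  have h := H.diff_right i (Pi.single r 1) a
  rw [resolutionDiff_apply, resolutionDiff_apply, twistedRightAction, twistedRightAction,
    Matrix.vecMul_vecMul, Matrix.vecMul_vecMul, Matrix.single_one_vecMul,
    Matrix.single_one_vecMul] at h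
  exact h

variable (hσ : IsInvertibleMatrixHom 𝒜 D.σ) {hB : ℕ} {lB : ℤ} (hreg : IsASRegular ℬ hB lB)
include hσ hreg

/-- If `φ_{i+1}(a) = 0` then the columns of `φᵢ(a)` are cycles of the dual complex, hence
boundaries, and boundaries are killed by `π_A`. -/
theorem eq_zero_of_succ_eq_zero {i : ℕ} (hi : i < hB) {a : A} (ha : φ (i + 1) a = 0) :
    φ i a = 0 := by
  have h := H.mapA_mul_matC i a
  have h0 : D.mapA (0 : Matrix (Fin (Q.rank (i + 1))) (Fin (Q.rank (i + 1))) A) = 0 :=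
    Matrix.map_zero _ (map_zero _)
  rw [ha, h0, Matrix.zero_mul] at h
  ext p c
  have hx : (D.matC Q i).mulVec (fun p => ιA D.toGradedTwistingMap (φ i a p c)) = 0 :=
    funext fun r => (congrFun (congrFun h r) c).symm
  have h1 := D.πA_padMat_mulVec Q i
    (D.colSec Q hσ i fun p => ιA D.toGradedTwistingMap (φ i a p c)) p
  rw [D.mulVec_colSec Q hσ hreg hi.ne hx, πA_ιA] at h1
  exact h1

theorem eq_zero_of_eq_zero {a : A} : ∀ i ≤ hB, φ i a = 0 → a = 0
  | 0, _, ha => by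
    have p : Fin (Q.rank 0) := ⟨0, by rw [Q.rank_zero]; exact one_pos⟩
    have h := congrFun (congrFun (H.zero a) p) p
    rw [ha] at h
    exact (Matrix.diagonal_apply_eq (fun _ => a) p).symm.trans h.symm
  | i + 1, hi, ha =>
    eq_zero_of_eq_zero i (by omega) (H.eq_zero_of_succ_eq_zero hσ hreg (by omega) ha)

omit hσ hreg

/-- The matrices `φᵢ(a)` lift right multiplication by `a` to the resolution. -/
theorem isChainMap [SetLike.GradedMonoid (grading D.toGradedTwistingMap)] {d : ℤ} {a : A}
    (ha : a ∈ 𝒜 d) :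
    (D.toSplitResolution Q).IsChainMap d fun i => D.mapA (φ i a) :=
  ⟨fun i p q => ιA_mem_grading (H.graded i d a ha p q), fun i => H.mapA_mul_matC i a⟩

end IsBimoduleResolution

variable (hσ : IsInvertibleMatrixHom 𝒜 D.σ) {hB : ℕ} {lB : ℤ} (hreg : IsASRegular ℬ hB lB)

include Q hσ hreg in
theorem subsingleton_ext {i : ℕ} (hi : i ≠ hB) (j : ℤ) : Subsingleton (D.Ext i j) := by
  have := D.gradedMonoid_grading Q.generator_mem
  rw [subsingleton_uExt_iff]
  intro f hf
  refine (D.toSplitResolution Q).mem_extCoboundaries hf ?_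
  exact D.mem_bdry_of_mulVec_colSec Q hσ ((D.toSplitResolution Q).evalAug_mem hf.1)
    (D.mulVec_colSec Q hσ hreg hi ((D.toSplitResolution Q).mulVec_evalAug hf))

include hreg in
theorem fin_rank_top_eq (p q : Fin (Q.rank hB)) : p = q := by
  have := Q.rank_top hreg
  ext
  omega

/-- Evaluation of cocycles of degree `hB` on the resolution, followed by `π_A`. -/
noncomputable def topMap (p : Fin (Q.rank hB)) (j : ℤ) :
    extCocycles (grading D.toGradedTwistingMap) 𝒜 (grading D.toGradedTwistingMap) hB j →ₗ[k] A :=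
  D.πA.toLinearMap ∘ₗ LinearMap.proj p ∘ₗ (D.toSplitResolution Q).evalAug hB ∘ₗ
    Submodule.subtype _

theorem πA_eq_of_sub_mem_bdry {p : Fin (Q.rank hB)} {j : ℤ}
    {x z : Fin (Q.rank hB) → TwistedTensor D.toGradedTwistingMap}
    (h : x - z ∈ (D.toSplitResolution Q).bdry hB j) : D.πA (x p) = D.πA (z p) := by
  have := D.πA_eq_zero_of_mem_bdry Q h p
  rwa [Pi.sub_apply, map_sub, sub_eq_zero] at this

include hreg in
theorem topMap_mem (p : Fin (Q.rank hB)) (j : ℤ) (f) : D.topMap Q p j f ∈ 𝒜 (j + lB) := by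
  have := D.gradedMonoid_grading Q.generator_mem
  have h := mem_vecGrading.1 ((D.toSplitResolution Q).evalAug_mem f.2.1) p
  change _ ∈ grading D.toGradedTwistingMap (Q.deg hB + j) at h
  rw [Q.deg_top hreg, add_comm] at h
  exact D.πA_mem h

theorem topMap_eq_zero (p : Fin (Q.rank hB)) (j : ℤ) (f)
    (hf : f.1 ∈ extCoboundaries (grading D.toGradedTwistingMap) 𝒜
      (grading D.toGradedTwistingMap) hB j) : D.topMap Q p j f = 0 := by
  have := D.gradedMonoid_grading Q.generator_mem
  exact D.πA_eq_zero_of_mem_bdry Q ((D.toSplitResolution Q).evalAug_mem_bdry hf) p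

include hσ hreg in
theorem mem_extCoboundaries_of_topMap_eq_zero (p : Fin (Q.rank hB)) (j : ℤ) (f)
    (h : D.topMap Q p j f = 0) : f.1 ∈ extCoboundaries (grading D.toGradedTwistingMap) 𝒜
      (grading D.toGradedTwistingMap) hB j := by
  have := D.gradedMonoid_grading Q.generator_mem
  refine (D.toSplitResolution Q).mem_extCoboundaries f.2 ?_
  refine D.mem_bdry_of_mulVec_colSec Q hσ ((D.toSplitResolution Q).evalAug_mem f.2.1)
    (D.mulVec_colSec_top Q hσ hreg fun q => ?_)
  rw [fin_rank_top_eq Q hreg q p]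
  exact h

include hreg in
theorem exists_topMap_eq (p : Fin (Q.rank hB)) (j : ℤ) {a : A} (ha : a ∈ 𝒜 (j + lB)) :
    ∃ f, D.topMap Q p j f = a := by
  have := D.gradedMonoid_grading Q.generator_mem
  have h0 : Q.rank (hB + 1) = 0 :=
    Q.rank_eq_zero hreg.globalDimension_eq (hB + 1) (Nat.lt_succ_self _)
  obtain ⟨f, hf, hfe⟩ := (D.toSplitResolution Q).exists_evalAug_sub_mem (q := hB) (j := j)
    (x := fun _ => ιA D.toGradedTwistingMap a) (mem_vecGrading.2 fun _ => by
      change _ ∈ grading D.toGradedTwistingMap (Q.deg hB + j)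
      rw [Q.deg_top hreg, add_comm]
      exact ιA_mem_grading ha) (funext fun b => (h0 ▸ b : Fin 0).elim0)
  exact ⟨⟨f, hf⟩, (D.πA_eq_of_sub_mem_bdry Q hfe).trans (D.πA_ιA a)⟩

end Top

end DiagonalTwistingMap

namespace DiagonalTwistingMap

open TwistedTensor

variable {k A : Type*} {B : Type u} [Field k] [Ring A] [Algebra k A] [Ring B] [Algebra k B]
  {𝒜 : ℤ → Submodule k A} [GradedAlgebra 𝒜] {ℬ : ℤ → Submodule k B} [GradedAlgebra ℬ]
  [ConnectedGraded 𝒜] [ConnectedGraded ℬ]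
  {m : ℕ} {y : Fin m → B} (D : DiagonalTwistingMap 𝒜 ℬ y) (Q : PureMinimalResolution ℬ y)
  (hσ : IsInvertibleMatrixHom 𝒜 D.σ) {hB : ℕ} {lB : ℤ} (hreg : IsASRegular ℬ hB lB)

/-- The isomorphism of `\underline{Ext}^{hB}` with `A(lB)` induced by `topMap`. -/
noncomputable def topEquiv (p : Fin (Q.rank hB)) (j : ℤ) : D.Ext hB j ≃ₗ[k] 𝒜 (j + lB) :=
  LinearEquiv.ofBijective
    (Submodule.liftQ _ ((D.topMap Q p j).codRestrict (𝒜 (j + lB)) (D.topMap_mem Q hreg p j))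
      fun f hf => Subtype.ext (D.topMap_eq_zero Q p j f hf)) (by
    constructor
    · rw [injective_iff_map_eq_zero]
      intro x hx
      induction x using Submodule.Quotient.induction_on with
      | _ f =>
        rw [Submodule.Quotient.mk_eq_zero]
        exact D.mem_extCoboundaries_of_topMap_eq_zero Q hσ hreg p j f (congrArg Subtype.val hx)
    · rintro ⟨a, ha⟩
      obtain ⟨f, hf⟩ := D.exists_topMap_eq Q hreg p j ha
      exact ⟨Submodule.Quotient.mk f, Subtype.ext hf⟩)

theorem topEquiv_extRightMul (p : Fin (Q.rank hB)) (i : ℤ) (a : 𝒜 i) (j : ℤ) (x : D.Ext hB j) :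
    (D.topEquiv Q hσ hreg p (j + i) (D.extRightMul a hB j x) : A) =
      (D.topEquiv Q hσ hreg p j x : A) * a := by
  have := D.gradedMonoid_grading Q.generator_mem
  induction x using Submodule.Quotient.induction_on with
  | _ f =>
    change D.πA ((D.toSplitResolution Q).evalAug hB (barPostcomp (D.rightMulC (a : A)) hB f.1) p) =
      D.πA ((D.toSplitResolution Q).evalAug hB f.1 p) * a
    have h := (D.toSplitResolution Q).evalAug_barPostcomp (D.rightMulC (a : A)) f.1 p
    rw [h, rightMulC_apply, map_mul, πA_ιA]

theorem IsBimoduleResolution.topEquiv_extLeftMul {D : DiagonalTwistingMap 𝒜 ℬ y}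
    {Q : PureMinimalResolution ℬ y} {φ : ∀ i, A →ₐ[k] Matrix (Fin (Q.rank i)) (Fin (Q.rank i)) A}
    (H : D.IsBimoduleResolution Q φ) (hσ : IsInvertibleMatrixHom 𝒜 D.σ)
    (p : Fin (Q.rank hB)) (i : ℤ) (a : 𝒜 i) (j : ℤ) (x : D.Ext hB j) :
    (D.topEquiv Q hσ hreg p (j + i) (D.extLeftMul a hB j x) : A) =
      φ hB a p p * (D.topEquiv Q hσ hreg p j x : A) := by
  have := D.gradedMonoid_grading Q.generator_mem
  induction x using Submodule.Quotient.induction_on with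
  | _ f =>
    have h := (D.toSplitResolution Q).evalAug_barPrecomp_sub_mem (H.isChainMap a.2)
      (u := D.rightMulA (a : A)) (fun x => H.aug_right x a) f.2
    refine (D.πA_eq_of_sub_mem_bdry Q (p := p) h).trans ?_
    change D.πA (∑ q, ιA D.toGradedTwistingMap (φ hB a p q) *
      (D.toSplitResolution Q).evalAug hB f.1 q) = _
    rw [Finset.sum_eq_single p (fun q _ hq => absurd (fin_rank_top_eq Q hreg q p) hq) (by simp),
      map_mul, πA_ιA]
    rfl

/-- The last matrix homomorphism `φ_{hB} : A → M₁(A) = A`. -/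
noncomputable def topHom {Q : PureMinimalResolution ℬ y}
    (φ : ∀ i, A →ₐ[k] Matrix (Fin (Q.rank i)) (Fin (Q.rank i)) A) (hreg : IsASRegular ℬ hB lB)
    (p : Fin (Q.rank hB)) : A →ₐ[k] A :=
  AlgHom.ofLinearMap
    { toFun := fun a => φ hB a p p
      map_add' := fun a b => by rw [map_add]; rfl
      map_smul' := fun c a => by rw [map_smul]; rfl }
    (by
      change φ hB 1 p p = 1
      rw [map_one, Matrix.one_apply_eq])
    (fun a b => by
      change φ hB (a * b) p p = φ hB a p p * φ hB b p p
      rw [map_mul, Matrix.mul_apply,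
        Finset.sum_eq_single p (fun q _ hq => absurd (fin_rank_top_eq Q hreg q p) hq) (by simp)])

theorem IsBimoduleResolution.exists_algEquiv {D : DiagonalTwistingMap 𝒜 ℬ y}
    {Q : PureMinimalResolution ℬ y} {φ : ∀ i, A →ₐ[k] Matrix (Fin (Q.rank i)) (Fin (Q.rank i)) A}
    (H : D.IsBimoduleResolution Q φ) (hσ : IsInvertibleMatrixHom 𝒜 D.σ)
    (hreg : IsASRegular ℬ hB lB) :
    ∃ ν : A ≃ₐ[k] A, (∀ a p q, φ hB a p q = ν a) ∧ D.IsDeterminantOfType ν hB lB := by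
  let p : Fin (Q.rank hB) := ⟨0, by rw [Q.rank_top hreg]; exact one_pos⟩
  let f : A →ₐ[k] A := topHom φ hreg p
  have hf (a : A) (p' q') : φ hB a p' q' = f a := by
    rw [fin_rank_top_eq Q hreg p' p, fin_rank_top_eq Q hreg q' p]
    rfl
  have hgr (d : ℤ) (a : A) (ha : a ∈ 𝒜 d) : f a ∈ 𝒜 d := H.graded hB d a ha p p
  have hbij := bijective_of_graded_injective 𝒜 hgr fun a ha =>
    H.eq_zero_of_eq_zero hσ hreg hB le_rfl (Matrix.ext fun p' q' => (hf a p' q').trans ha)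
  exact ⟨AlgEquiv.ofBijective f hbij, hf, hgr, fun i hi j => D.subsingleton_ext Q hσ hreg hi j,
    D.topEquiv Q hσ hreg p, fun i a j x => H.topEquiv_extLeftMul hreg hσ p i a j x,
    fun i a j x => D.topEquiv_extRightMul Q hσ hreg p i a j x⟩

end DiagonalTwistingMap

theorem mainTheorem5 {k A B : Type*} [Field k] [Ring A] [Algebra k A] [Ring B] [Algebra k B]
    (𝒜 : ℤ → Submodule k A) [GradedAlgebra 𝒜] [ConnectedGraded 𝒜]
    (ℬ : ℤ → Submodule k B) [GradedAlgebra ℬ] [ConnectedGraded ℬ]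
    {m : ℕ} (y : Fin m → B)
    (D : DiagonalTwistingMap 𝒜 ℬ y)
    (Q : PureMinimalResolution ℬ y)
    (hB : ℕ) (lB : ℤ) (hreg : IsASRegular ℬ hB lB)
    (hσ : IsInvertibleMatrixHom 𝒜 D.σ) :
    (∃ φ, D.IsBimoduleResolution Q φ) ∧
    ∀ φ, D.IsBimoduleResolution Q φ →
      Q.rank hB = 1 ∧ Q.deg hB = lB ∧ (∀ i, hB < i → Q.rank i = 0) ∧
      ∃ ν : A ≃ₐ[k] A,
        (∀ a p q, φ hB a p q = ν a) ∧
        D.IsDeterminantOfType ν hB lB ∧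
        ∀ ν' : A ≃ₐ[k] A, D.IsDeterminant ν' → ν' = ν := by
  refine ⟨D.exists_isBimoduleResolution Q, fun φ H => ⟨Q.rank_top hreg, Q.deg_top hreg,
    Q.rank_eq_zero hreg.globalDimension_eq, ?_⟩⟩
  obtain ⟨ν, hν, hdet⟩ := H.exists_algEquiv hσ hreg
  exact ⟨ν, hν, hdet, fun ν' ⟨d, l, h'⟩ => hdet.unique h'⟩
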